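/- Let $\gamma\subset\mathbb C$ be a smooth Jordan curve (regularly parametrized by a smooth $1$-periodic map), let $s,t\in(0,1/2]$ and $\phi\in(0,\pi)$, and equip $\mathbb C^2$ with its standard symplectic form $\omega$ (equal, up to scale, to $dz\wedge d\bar z+dw\wedge d\bar w$). Let $$F_r=\begin{pmatrix} r&1-r\\ \sqrt{r(1-r)}&-\sqrt{r(1-r)}\end{pmatrix},\qquad R_\phi=\begin{pmatrix}1&0\\0&e^{i\phi}\end{pmatrix},$$ $$T_1=R_\phi\circ F_s(\gamma\times\gamma),\qquad T_2=F_t(\gamma\times\gamma).$$ Choose coordinates $(x_1,y_1,x_2,y_2)$, $x_1\in\mathbb R/\mathbb Z$, $|y_1|,|x_2|,|y_2|<\varepsilon$, on a neighbourhood $N$ of $\gamma\times\{0\}=\{y_1=x_2=y_2=0\}$ in $\mathbb C^2$ in which $\omega=dx_1\wedge dy_1+dx_2\wedge dy_2$, $T_1\cap N=\{y_1=y_2=0\}$ and $T_2\cap N=\{y_1=x_2=0\}$. Let $0<\delta<\varepsilon$, and smooth the cross $\{y_2=0\}\cup\{x_2=0\}$ in the $(x_2,y_2)$-plane, inside $\{|x_2|,|y_2|\le\delta\}$,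 by two smooth regular arcs in opposite quadrants, each of which turns monotonically (both coordinates are monotone along it) from a half $x_2$-axis to a half $y_2$-axis and agrees with these half axes outside that square. Let $T$ be the immersed surface obtained from $T_1\cup T_2$ by replacing, in every slice $x_1=\mathrm{constant}$, $y_1=0$ of $N$, the cross by the two arcs; outside $N$ the sheets of $T$ that come from $T_1$ and from $T_2$ are kept apart in the domain of the immersion, also where $T_1$ and $T_2$ meet. (The domain of $T$ is a torus.) Then, for every such choice of coordinates, $\delta$ and arcs, $T$ is Lagrangian: it has at every point of its domain a well-defined tangent plane, which is Lagrangian. Every loop $\alpha$ in the domain of $T$ has a well-defined Maslov index $\mu(\alpha)\in\mathbb Z$, the Maslov index of the loop of tangent planes of $T$ along $\alpha$, i.e. the degree of $\det(u,v)^2/|\det(u,v)|^2\in S^1$ for real bases $(u,v)$ of these planes in $\mathbb C^2$. The minimum Maslov number of $T$ is exactly $4$: the subgroup of $\mathbb Z$ generated by the Maslov indices of all loops in the domain of $T$, which is $\mu(H_1(T;\mathbb Z))$, equals $4\mathbb Z$. -/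

import Mathlib

open scoped ContDiff

namespace CyclicQuad

/-! ### Symplectic linear algebra in `ℂ²` -/

/-- The complex plane `ℂ²`, with coordinates `(z, w)`. -/
abbrev C2 : Type := ℂ × ℂ

/-- The standard symplectic form of `ℂ²`: in real coordinates `z = x + i y`, `w = u + i v` it is
`dx ∧ dy + du ∧ dv`, which is `dz ∧ dz̄ + dw ∧ dw̄` up to the scale factor `-2i`. -/
noncomputable def omega (p q : C2) : ℝ :=
  ((starRingEnd ℂ) p.1 * q.1 + (starRingEnd ℂ) p.2 * q.2).im

/-- A Lagrangian plane: a real plane on which `omega` vanishes. -/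
def IsLagrangian (P : Submodule ℝ C2) : Prop :=
  Module.finrank ℝ P = 2 ∧ ∀ u ∈ P, ∀ v ∈ P, omega u v = 0

/-- The complex determinant of a pair of vectors of `ℂ²`. -/
def det2 (u v : C2) : ℂ := u.1 * v.2 - u.2 * v.1

/-- `n` is the Maslov index of the loop `P` of Lagrangian planes: the degree of the loop
`det(u, v)² / |det(u, v)|²` in the unit circle, where `(u t, v t)` is a real basis of `P t`.
This number does not depend on the real basis, so the basis need not vary continuously; for an
orthonormal basis it is the square of the determinant of a unitary frame. -/
def HasMaslovIndex (P : unitInterval → Submodule ℝ C2) (n : ℤ) : Prop :=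
  ∃ (u v : unitInterval → C2) (θ : C(unitInterval, ℝ)),
    (∀ τ, P τ = Submodule.span ℝ {u τ, v τ} ∧ det2 (u τ) (v τ) ≠ 0 ∧
      det2 (u τ) (v τ) ^ 2 = ((‖det2 (u τ) (v τ)‖ ^ 2 : ℝ) : ℂ) * Complex.exp ((θ τ : ℂ) * Complex.I)) ∧
    θ 1 - θ 0 = 2 * Real.pi * n

/-! ### Immersed surfaces -/

/-- A local parametrization of an immersed surface in `ℂ²`. The points of the surface are written as
pairs `(p, ℓ)` of the point `p` of `ℂ²` onto which they are mapped and a real label `ℓ` that tells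
apart different points of the surface with the same image. -/
structure Patch where
  /-- the parameter domain -/
  dom : Set (ℝ × ℝ)
  /-- the parametrization -/
  map : ℝ × ℝ → C2 × ℝ

/-- The surface parametrized by a family of patches, with the topology induced from `ℂ² × ℝ`;
the first projection is the immersion of the surface into `ℂ²`. -/
def surface (A : Set Patch) : Set (C2 × ℝ) := ⋃ f ∈ A, f.map '' f.dom

/-- `P` is the tangent plane, in `ℂ²`, of the immersed surface at its point `q`: the range of the
differential of the immersion, computed in a patch. -/
def IsTangentPlane (A : Set Patch) (q : C2 × ℝ) (P : Submodule ℝ C2) : Prop :=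
  ∃ f ∈ A, ∃ x ∈ f.dom, f.map x = q ∧
    P = LinearMap.range (fderiv ℝ (fun y => (f.map y).1) x).toLinearMap

/-- The immersed surface has a well-defined tangent plane at each point, and it is Lagrangian. -/
def IsImmersedLagrangian (A : Set Patch) : Prop :=
  (∀ q ∈ surface A, ∃! P, IsTangentPlane A q P) ∧
    ∀ q P, IsTangentPlane A q P → IsLagrangian P

/-- `n` is the Maslov index of the loop `α` in the immersed surface: the Maslov index of the loop
of tangent planes along `α`. -/
def IsLoopIndex (A : Set Patch) {x : surface A} (α : Path x x) (n : ℤ) : Prop :=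
  ∃ P : unitInterval → Submodule ℝ C2,
    (∀ τ, IsTangentPlane A (α τ : C2 × ℝ) (P τ)) ∧ HasMaslovIndex P n

/-- `m` is the minimum Maslov number of an immersed surface `L`: `μ (H₁(L; ℤ)) = m ℤ`, where `μ` is
the Maslov class. Since `H₁(L; ℤ)` is generated by the classes of loops, `μ (H₁(L; ℤ))` is the
subgroup of `ℤ` generated by the Maslov indices of the loops in `L`. -/
def IsMinimumMaslovNumber (A : Set Patch) (m : ℕ) : Prop :=
  AddSubgroup.closure {n : ℤ | ∃ (x : surface A) (α : Path x x), IsLoopIndex A α n} =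
    AddSubgroup.zmultiples (m : ℤ)

/-! ### Smooth Jordan curves and the two tori -/

/-- `γ` is a regular, `1`-periodic parametrization of a smooth Jordan curve. -/
structure IsSmoothJordan (γ : ℝ → ℂ) : Prop where
  smooth : ContDiff ℝ ∞ γ
  periodic : Function.Periodic γ 1
  regular : ∀ a, deriv γ a ≠ 0
  injOn : Set.InjOn γ (Set.Ico 0 1)

/-- The linear map `F_r` of `ℂ²`. -/
noncomputable def mapF (r : ℝ) (p : C2) : C2 :=
  ((r : ℂ) * p.1 + ((1 - r : ℝ) : ℂ) * p.2,
    (Real.sqrt (r * (1 - r)) : ℂ) * p.1 - (Real.sqrt (r * (1 - r)) : ℂ) * p.2)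

/-- The linear map `R_φ` of `ℂ²`. -/
noncomputable def mapR (φ : ℝ) (p : C2) : C2 := (p.1, Complex.exp ((φ : ℂ) * Complex.I) * p.2)

/-- The torus `T₁ = R_φ ∘ F_s (γ × γ)`. -/
def torus1 (γ : ℝ → ℂ) (s φ : ℝ) : Set C2 :=
  (fun p => mapR φ (mapF s p)) '' (Set.range γ ×ˢ Set.range γ)

/-- The torus `T₂ = F_t (γ × γ)`. -/
def torus2 (γ : ℝ → ℂ) (t : ℝ) : Set C2 :=
  mapF t '' (Set.range γ ×ˢ Set.range γ)

/-! ### Smoothing the clean intersection -/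

/-- Coordinates `(x₁, y₁, x₂, y₂)`; the first one is read modulo `1`. -/
abbrev Coord : Type := ℝ × ℝ × ℝ × ℝ

/-- The set `|y₁|, |x₂|, |y₂| < ε`. -/
def openBox (ε : ℝ) : Set Coord := {p | |p.2.1| < ε ∧ |p.2.2.1| < ε ∧ |p.2.2.2| < ε}

/-- The set `|y₁|, |x₂|, |y₂| ≤ δ`. -/
def closedBox (δ : ℝ) : Set Coord := {p | |p.2.1| ≤ δ ∧ |p.2.2.1| ≤ δ ∧ |p.2.2.2| ≤ δ}

/-- `Ψ` is the inverse of a system of coordinates `(x₁, y₁, x₂, y₂)`, defined in a neighbourhood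
`N = Ψ (openBox ε)` of `γ × {0}`, with core circle `γ × {0}`, such that
`ω = dx₁ ∧ dy₁ + dx₂ ∧ dy₂`, `T₁ ∩ N = {y₁ = y₂ = 0}` and `T₂ ∩ N = {y₁ = x₂ = 0}`. -/
structure IsAdaptedChart (γ : ℝ → ℂ) (s t φ ε : ℝ) (Ψ : Coord → C2) : Prop where
  smooth : ContDiffOn ℝ ∞ Ψ (openBox ε)
  injective : ∀ p ∈ openBox ε, ∀ q ∈ openBox ε,
    Ψ p = Ψ q ↔ (∃ k : ℤ, q.1 = p.1 + k) ∧ q.2 = p.2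
  symplectic : ∀ p ∈ openBox ε, ∀ u v : Coord,
    omega (fderiv ℝ Ψ p u) (fderiv ℝ Ψ p v) =
      (u.1 * v.2.1 - u.2.1 * v.1) + (u.2.2.1 * v.2.2.2 - u.2.2.2 * v.2.2.1)
  core : Set.range (fun x : ℝ => Ψ (x, 0, 0, 0)) = Set.range γ ×ˢ {0}
  mem_torus1 : ∀ p ∈ openBox ε, Ψ p ∈ torus1 γ s φ ↔ p.2.1 = 0 ∧ p.2.2.2 = 0
  mem_torus2 : ∀ p ∈ openBox ε, Ψ p ∈ torus2 γ t ↔ p.2.1 = 0 ∧ p.2.2.1 = 0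

/-- `c` is a smooth regular arc in the quadrant `x ≥ 0, y ≥ 0` that comes in along the `x`-axis,
turns monotonically at distance at most `δ` from the axes' crossing, and leaves along the
`y`-axis. -/
structure IsSmoothingArc (δ : ℝ) (c : ℝ → ℝ × ℝ) : Prop where
  smooth : ContDiff ℝ ∞ c
  incoming : ∀ τ ≤ -δ, c τ = (-τ, 0)
  outgoing : ∀ τ ≥ δ, c τ = (0, τ)
  regular : ∀ τ, deriv c τ ≠ 0
  monotone_fst : ∀ τ, (deriv c τ).1 ≤ 0
  monotone_snd : ∀ τ, 0 ≤ (deriv c τ).2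

/-- The choices made in smoothing the intersection of `T₁` and `T₂` along `γ × {0}`: adapted
coordinates, a size `δ`, and the smoothing of the cross `{y₂ = 0} ∪ {x₂ = 0}` in the
`(x₂, y₂)`-plane inside the box of size `δ` by two disjoint arcs in opposite quadrants, namely
`(x, σ y)` for `(x, y)` on the arc `c₁` and `(-x, -σ y)` for `(x, y)` on the arc `c₂`. The sign `σ`
is the choice of one of the two pairs of opposite quadrants. -/
structure Smoothing (γ : ℝ → ℂ) (s t φ : ℝ) where
  ε : ℝ
  δ : ℝ
  δ_pos : 0 < δ
  δ_lt : δ < ε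
  Ψ : Coord → C2
  chart : IsAdaptedChart γ s t φ ε Ψ
  σ : ℝ
  σ_sign : σ = 1 ∨ σ = -1
  c₁ : ℝ → ℝ × ℝ
  c₂ : ℝ → ℝ × ℝ
  arc₁ : IsSmoothingArc δ c₁
  arc₂ : IsSmoothingArc δ c₂

namespace Smoothing

variable {γ : ℝ → ℂ} {s t φ : ℝ} (D : Smoothing γ s t φ)

/-- The part of `T₁` outside of the surgery region, with label `0`. -/
noncomputable def outer1 : Patch where
  dom := {x | mapR φ (mapF s (γ x.1, γ x.2)) ∉ D.Ψ '' closedBox D.δ}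
  map := fun x => (mapR φ (mapF s (γ x.1, γ x.2)), 0)

/-- The part of `T₂` outside of the surgery region, with label `1`. -/
noncomputable def outer2 : Patch where
  dom := {x | mapF t (γ x.1, γ x.2) ∉ D.Ψ '' closedBox D.δ}
  map := fun x => (mapF t (γ x.1, γ x.2), 1)

/-- The product of the circle in the `x₁`-direction with the arc `κ (x, σ y)`, `(x, y) = c τ`, in
the plane `y₁ = 0`. The label `y / (x + y)` increases from `0` on the incoming half axis, which lies
in `T₁`, to `1` on the outgoing half axis, which lies in `T₂`. -/
noncomputable def neck (κ : ℝ) (c : ℝ → ℝ × ℝ) : Patch where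
  dom := {x | |x.2| < D.ε}
  map := fun x =>
    (D.Ψ (x.1, 0, κ * (c x.2).1, κ * (D.σ * (c x.2).2)), (c x.2).2 / ((c x.2).1 + (c x.2).2))

/-- The immersed surface `T` that results from smoothing `T₁ ∪ T₂` along `γ × {0}`. The labels
keep the points of `T₁` and of `T₂` outside of the surgery region apart, also where `T₁` and `T₂`
meet; these intersection points become the self-intersections of `T`. -/
noncomputable def T : Set Patch :=
  {D.outer1, D.outer2, D.neck 1 D.c₁, D.neck (-1) D.c₂}

end Smoothing

end CyclicQuad

/-! The Maslov index is the degree of the phase det² / |det|² of the tangent planes. All indices lie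
in 4ℤ as soon as the phase has a continuous fourth root on the surface; the proof constructs one,
`Branch.root`.

Let ϑ be a continuous argument of γ'. By the Umlaufsatz (`IsSmoothJordan.exists_tangentAngle`) it
changes by ±2π around γ. The determinant of F_r is real, so the phase of R_φ F_r (γ × γ) at (a, b)
is exp 2i(φ + ϑ(a) + ϑ(b)) (`hasPhase_tor`). Up to a constant, its fourth root is exp(i(φ + ϑ(a) +
ϑ(b))/2), which changes sign when just one of a, b makes a turn. It is single-valued on the annulus
a < b < a + 1, the torus minus its diagonal, because there a and b turn together; but its limits on
the two sides of the diagonal are opposite (`outerValue_sheet`).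

The smoothing cuts both tori along precisely this circle, γ × {0}, and joins their sides by two
necks. On both necks the tangent line in the (x₂, y₂)-plane turns in the same sense from one axis to
the other, since opposite quadrants differ by a half turn. One formula therefore continues the root
along either neck, up to the sign κ = ±1 of the neck. On T₁ and on T₂ the root also changes sign
from one neck to the other, so the four pieces fit together (`outerRel₁_neckRel`,
`outerRel₂_neckRel`).

Along a loop the fourth root has an integral degree k, so the index is 4k (`exists_loopIndex`). On a
parallel of γ × {0} both ϑ(a) and ϑ(b) change by 2π or both by -2π, the phase makes four turns, and
the index is ±4 (`exists_coreLoop`). -/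

namespace CyclicQuad

/-! ### Continuous arguments -/

/-- The point `exp (i x)` of the unit circle. -/
noncomputable def cis (x : ℝ) : ℂ := Complex.exp ((x : ℂ) * Complex.I)

theorem cis_add (x y : ℝ) : cis (x + y) = cis x * cis y := by
  simp [cis, add_mul, Complex.exp_add]

theorem norm_cis (x : ℝ) : ‖cis x‖ = 1 := Complex.norm_exp_ofReal_mul_I x

theorem cis_ne_zero (x : ℝ) : cis x ≠ 0 := Complex.exp_ne_zero _

theorem continuous_cis : Continuous cis := by unfold cis; fun_prop

theorem cis_pow (x : ℝ) (n : ℕ) : cis x ^ n = cis (n * x) := by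
  rw [cis, cis, ← Complex.exp_nat_mul]; push_cast; ring_nf

theorem cis_eq_cis_iff {x y : ℝ} : cis x = cis y ↔ ∃ k : ℤ, x = y + 2 * Real.pi * k := by
  rw [cis, cis, Complex.exp_eq_exp_iff_exists_int]
  refine exists_congr fun k => ?_
  have h : (y : ℂ) * Complex.I + k * (2 * Real.pi * Complex.I) =
      ((y + 2 * Real.pi * k : ℝ) : ℂ) * Complex.I := by push_cast; ring
  rw [h, mul_left_inj' Complex.I_ne_zero, Complex.ofReal_inj]

theorem cis_pi : cis Real.pi = -1 := by simp [cis, Complex.exp_pi_mul_I]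

theorem cis_arg {z : ℂ} : (z : ℂ) = ‖z‖ * cis z.arg := (Complex.norm_mul_exp_arg_mul_I z).symm

/-- Two positive multiples of points of the unit circle agree only if the points agree. -/
theorem cis_eq_of_mul_eq {r s x y : ℝ} (hr : 0 < r) (hs : 0 < s)
    (h : (r : ℂ) * cis x = s * cis y) : cis x = cis y := by
  have hn := congrArg norm h
  simp only [norm_mul, norm_cis, mul_one, Complex.norm_real, Real.norm_of_nonneg hr.le,
    Real.norm_of_nonneg hs.le] at hn
  subst hn
  exact mul_left_cancel₀ (by exact_mod_cast hr.ne') h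

theorem isSimplyConnected_of_convex {E : Type*} [NormedAddCommGroup E] [NormedSpace ℝ E]
    {U : Set E} (h : Convex ℝ U) (h' : U.Nonempty) : IsSimplyConnected U := by
  have := h.contractibleSpace h'
  show SimplyConnectedSpace U
  infer_instance

theorem exists_continuousOn_arg {E : Type*} [NormedAddCommGroup E] [NormedSpace ℝ E]
    {U : Set E} (hU : Convex ℝ U) (hne : U.Nonempty) (ho : IsOpen U) {g : E → ℂ}
    (hg : ContinuousOn g U) (h0 : ∀ x ∈ U, g x ≠ 0) :
    ∃ θ : E → ℝ, ContinuousOn θ U ∧ ∀ x ∈ U, g x = ‖g x‖ * cis (θ x) := by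
  obtain ⟨f, hf, hfg⟩ := Complex.exists_continuousOn_eqOn_exp_comp
    (isSimplyConnected_of_convex hU hne) ho hg (by rintro ⟨x, hx, h⟩; exact h0 x hx h)
  refine ⟨fun x => (f x).im, Complex.continuous_im.comp_continuousOn hf, fun x hx => ?_⟩
  have h := hfg hx
  simp only [Function.comp] at h
  rw [← h, Complex.norm_exp, cis, Complex.ofReal_exp, ← Complex.exp_add, Complex.re_add_im]

theorem IsPreconnected.eq_of_int_valued {X : Type*} [TopologicalSpace X] {U : Set X}
    (hU : IsPreconnected U) {f : X → ℝ} (hf : ContinuousOn f U) {c : ℝ} (hc : 0 < c)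
    (h : ∀ x ∈ U, ∃ k : ℤ, f x = c * k) {x y : X} (hx : x ∈ U) (hy : y ∈ U) : f x = f y := by
  by_contra hne
  wlog hlt : f x < f y generalizing x y
  · exact this hy hx (Ne.symm hne) (lt_of_le_of_ne (not_lt.1 hlt) (Ne.symm hne))
  obtain ⟨k, hk⟩ := h x hx
  obtain ⟨l, hl⟩ := h y hy
  rw [hk, hl, mul_lt_mul_iff_right₀ hc] at hlt
  have hkl : k + 1 ≤ l := by exact_mod_cast hlt
  have hkl' : (k : ℝ) + 1 ≤ l := by exact_mod_cast hkl
  -- A half-integral multiple of c lies strictly between two distinct values and is not attained.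
  obtain ⟨z, hz, hfz⟩ := hU.intermediate_value hx hy hf
    (show c * (k + 1 / 2) ∈ Set.Icc (f x) (f y) by
      rw [hk, hl]; constructor <;> apply mul_le_mul_of_nonneg_left _ hc.le <;> linarith)
  obtain ⟨m, hm⟩ := h z hz
  rw [hm] at hfz
  have h1 := mul_left_cancel₀ hc.ne' hfz
  have h2 : (2 * m : ℝ) = 2 * k + 1 := by linarith
  have h3 : 2 * m = 2 * k + 1 := by exact_mod_cast h2
  omega

/-! ### Smooth Jordan curves -/

namespace IsSmoothJordan

variable {γ : ℝ → ℂ} (hγ : IsSmoothJordan γ)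
include hγ

theorem periodic_int (a : ℝ) (k : ℤ) : γ (a + k) = γ a := by
  simpa using hγ.periodic.int_mul k a

theorem eq_iff {a b : ℝ} : γ a = γ b ↔ ∃ k : ℤ, b = a + k := by
  constructor
  · intro h
    have hf : ∀ x, γ (Int.fract x) = γ x := fun x => by
      conv_rhs => rw [← Int.fract_add_floor x, hγ.periodic_int]
    have := hγ.injOn ⟨Int.fract_nonneg a, Int.fract_lt_one a⟩
      ⟨Int.fract_nonneg b, Int.fract_lt_one b⟩ (by rw [hf, hf, h])
    rw [Int.fract_eq_fract] at this
    obtain ⟨z, hz⟩ := this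
    exact ⟨-z, by push_cast; linarith⟩
  · rintro ⟨k, rfl⟩; exact (hγ.periodic_int a k).symm

theorem differentiable : Differentiable ℝ γ := hγ.smooth.differentiable (by simp)

theorem continuous_deriv : Continuous (deriv γ) := hγ.smooth.continuous_deriv (by simp)

theorem deriv_periodic (a : ℝ) (k : ℤ) : deriv γ (a + k) = deriv γ a := by
  have : (fun x => γ (x + k)) = γ := funext fun x => hγ.periodic_int x k
  rw [← deriv_comp_add_const, this]

/-- By compactness γ embeds ℝ/ℤ into ℂ, so z factors continuously through ℝ/ℤ, and a map from a
simply connected set lifts through the covering ℝ → ℝ/ℤ. -/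
theorem exists_lift {E : Type*} [NormedAddCommGroup E] [NormedSpace ℝ E]
    {U : Set E} (hU : Convex ℝ U) (hne : U.Nonempty) (ho : IsOpen U) {z : E → ℂ}
    (hz : ContinuousOn z U) (hr : ∀ x ∈ U, z x ∈ Set.range γ) :
    ∃ a : E → ℝ, ContinuousOn a U ∧ ∀ x ∈ U, γ (a x) = z x := by
  classical
  let g : AddCircle (1 : ℝ) → ℂ := hγ.periodic.lift
  have hgc : Continuous g := hγ.differentiable.continuous.quotient_lift _
  have hgi : Function.Injective g := by
    intro x y
    induction x using QuotientAddGroup.induction_on with | _ x => ?_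
    induction y using QuotientAddGroup.induction_on with | _ y => ?_
    intro h
    obtain ⟨k, hk⟩ := hγ.eq_iff.1 (show γ x = γ y from h)
    rw [eq_comm, ← sub_eq_zero, ← QuotientAddGroup.mk_sub]
    exact (AddCircle.coe_eq_zero_iff (1 : ℝ)).2 ⟨k, by simp [hk]⟩
  have hge := (hgc.isClosedEmbedding hgi).isEmbedding
  have hrg : ∀ x ∈ U, z x ∈ Set.range g := by
    intro x hx
    obtain ⟨a, ha⟩ := hr x hx
    exact ⟨(a : AddCircle (1 : ℝ)), ha⟩
  let w : C(U, AddCircle (1 : ℝ)) :=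
    ⟨fun x => hge.toHomeomorph.symm ⟨z x, hrg x x.2⟩,
      hge.toHomeomorph.symm.continuous.comp
        ((continuousOn_iff_continuous_domRestrict.1 hz).subtype_mk _)⟩
  have hw : ∀ x : U, g (w x) = z x := fun x =>
    congrArg Subtype.val (hge.toHomeomorph.apply_symm_apply ⟨z x, hrg x x.2⟩)
  have h1 : SimplyConnectedSpace U := isSimplyConnected_of_convex hU hne
  have h2 := ho.locallyPathConnectedSpace
  obtain ⟨x₀, hx₀⟩ := hne
  obtain ⟨e₀, he₀⟩ := QuotientAddGroup.mk_surjective (w ⟨x₀, hx₀⟩)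
  obtain ⟨F, ⟨-, hF⟩, -⟩ := (AddCircle.isCoveringMap_coe (1 : ℝ)).existsUnique_continuousMap_lifts
    w ⟨x₀, hx₀⟩ e₀ he₀
  refine ⟨fun x => if hx : x ∈ U then F ⟨x, hx⟩ else 0, ?_, fun x hx => ?_⟩
  · rw [continuousOn_iff_continuous_domRestrict]
    convert! F.continuous with x
    simp
  · simp only [hx, dif_pos]
    rw [← hw ⟨x, hx⟩, ← congrFun hF ⟨x, hx⟩]
    rfl

/-- The projection ℓ to the tangent direction ζ turns γ into a real function with derivative |ζ|² ≠
0; near x, the lift is its local inverse applied to ℓ ∘ z. -/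
theorem differentiableAt_lift {E : Type*} [NormedAddCommGroup E] [NormedSpace ℝ E]
    {a : E → ℝ} {z : E → ℂ} {x : E} (ha : ContinuousAt a x) (hz : DifferentiableAt ℝ z x)
    (h : ∀ᶠ y in nhds x, γ (a y) = z y) : DifferentiableAt ℝ a x := by
  set ζ := deriv γ (a x)
  let ℓ : ℂ →L[ℝ] ℝ := Complex.reCLM.comp
    ((ContinuousLinearMap.mul ℝ ℂ) ((starRingEnd ℂ) ζ))
  have hs : HasStrictDerivAt γ ζ (a x) :=
    (hγ.smooth.contDiffAt.hasStrictDerivAt (by simp))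
  have hs' : HasStrictDerivAt (fun y => ℓ (γ y)) (ℓ ζ) (a x) :=
    (ℓ.hasStrictFDerivAt (x := γ (a x))).comp_hasStrictDerivAt (a x) hs
  have hne : ℓ ζ ≠ 0 := by
    have : ℓ ζ = Complex.normSq ζ := by
      show ((starRingEnd ℂ) ζ * ζ).re = _
      rw [mul_comm, Complex.mul_conj]; simp
    rw [this]
    simpa [Complex.normSq_eq_zero] using hγ.regular (a x)
  have hinv := hs'.to_localInverse hne
  have hleft : ∀ᶠ y in nhds (a x),
      HasStrictDerivAt.localInverse (fun y => ℓ (γ y)) (ℓ ζ) (a x) hs' hne (ℓ (γ y)) = y :=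
    HasStrictFDerivAt.eventually_left_inverse _
  have hz' : z x = γ (a x) := h.self_of_nhds.symm
  have hd : DifferentiableAt ℝ (fun y =>
      HasStrictDerivAt.localInverse (fun y => ℓ (γ y)) (ℓ ζ) (a x) hs' hne (ℓ (z y))) x := by
    refine DifferentiableAt.comp x (g := HasStrictDerivAt.localInverse _ _ _ hs' hne) ?_
      (ℓ.differentiableAt.comp x hz)
    rw [hz']
    exact hinv.hasDerivAt.differentiableAt
  refine hd.congr_of_eventuallyEq ?_
  filter_upwards [ha.eventually hleft, h] with y hy1 hy2
  rw [← hy2, hy1]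

end IsSmoothJordan

/-! ### Hopf's Umlaufsatz -/

/-- The difference quotient `(γ b - γ a) / (b - a)`, extended by the derivative to `a = b`. -/
noncomputable def slopeMean (γ : ℝ → ℂ) (a b : ℝ) : ℂ :=
  ∫ t in (0 : ℝ)..1, deriv γ (a + t * (b - a))

/-- A multiple of the chord `γ b - γ a` which does not vanish for `a ≤ b ≤ a + 1`. -/
noncomputable def chord (γ : ℝ → ℂ) (a b : ℝ) : ℂ := slopeMean γ a b - slopeMean γ b (a + 1)

theorem slopeMean_self (γ : ℝ → ℂ) (a : ℝ) : slopeMean γ a a = deriv γ a := by simp [slopeMean]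

namespace IsSmoothJordan

variable {γ : ℝ → ℂ} (hγ : IsSmoothJordan γ)
include hγ

theorem continuous_slopeMean : Continuous fun p : ℝ × ℝ => slopeMean γ p.1 p.2 := by
  unfold slopeMean
  apply intervalIntegral.continuous_parametric_intervalIntegral_of_continuous'
  exact hγ.continuous_deriv.comp (by fun_prop)

theorem slopeMean_mul (a b : ℝ) : ((b - a : ℝ) : ℂ) * slopeMean γ a b = γ b - γ a := by
  have hd : ∀ t ∈ Set.uIcc (0 : ℝ) 1, HasDerivAt (fun t => γ (a + t * (b - a)))
      (((b - a : ℝ) : ℂ) * deriv γ (a + t * (b - a))) t := by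
    intro t _
    have h1 : HasDerivAt (fun t : ℝ => a + t * (b - a)) (b - a) t := by
      simpa using ((hasDerivAt_id t).mul_const (b - a)).const_add a
    have h2 := (hγ.differentiable (a + t * (b - a))).hasDerivAt.scomp t h1
    rwa [Complex.real_smul] at h2
  have hc : Continuous fun t : ℝ => ((b - a : ℝ) : ℂ) * deriv γ (a + t * (b - a)) :=
    continuous_const.mul (hγ.continuous_deriv.comp (by fun_prop))
  have h := intervalIntegral.integral_eq_sub_of_hasDerivAt hd (hc.intervalIntegrable _ _)
  rw [intervalIntegral.integral_const_mul] at h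
  simpa [slopeMean] using h

theorem slopeMean_period (a : ℝ) : slopeMean γ a (a + 1) = 0 := by
  have h := hγ.slopeMean_mul a (a + 1)
  have h1 : γ (a + 1) = γ a := hγ.periodic a
  simpa [h1] using h

theorem slopeMean_add_one (a b : ℝ) : slopeMean γ (a + 1) (b + 1) = slopeMean γ a b := by
  unfold slopeMean
  congr 1
  ext t
  have := hγ.deriv_periodic (a + t * (b - a)) 1
  rw [← this]; push_cast; ring_nf

theorem chord_self (a : ℝ) : chord γ a a = deriv γ a := by
  rw [chord, slopeMean_self, hγ.slopeMean_period, sub_zero]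

/-- Both pairs give the same two points of the curve, in opposite order. This symmetry stands in for
the second half of Hopf's triangle. -/
theorem chord_swap (a b : ℝ) : chord γ b (a + 1) = -chord γ a b := by
  rw [chord, chord, hγ.slopeMean_add_one]; ring

theorem chord_mul (a b : ℝ) :
    (((b - a) * (a + 1 - b) : ℝ) : ℂ) * chord γ a b = γ b - γ a := by
  have h1 := hγ.slopeMean_mul a b
  have h2 := hγ.slopeMean_mul b (a + 1)
  have h3 : γ (a + 1) = γ a := hγ.periodic a
  rw [h3] at h2
  rw [chord]
  push_cast at *
  linear_combination (a + 1 - b : ℂ) * h1 - (b - a : ℂ) * h2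

theorem chord_ne_zero {a b : ℝ} (h1 : a ≤ b) (h2 : b ≤ a + 1) : chord γ a b ≠ 0 := by
  rcases h1.eq_or_lt with rfl | h1
  · rw [hγ.chord_self]; exact hγ.regular a
  rcases h2.eq_or_lt with rfl | h2
  · rw [hγ.chord_swap, hγ.chord_self, neg_ne_zero]; exact hγ.regular a
  intro h0
  have h := hγ.chord_mul a b
  rw [h0, mul_zero, eq_comm, sub_eq_zero] at h
  obtain ⟨k, hk⟩ := hγ.eq_iff.1 h
  have h3 : (-1 : ℝ) < k := by linarith
  have h4 : (k : ℝ) < 0 := by linarith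
  have h5 : -1 < k := by exact_mod_cast h3
  have h6 : k < 0 := by exact_mod_cast h4
  omega

theorem continuous_chord : Continuous fun p : ℝ × ℝ => chord γ p.1 p.2 := by
  unfold chord
  exact hγ.continuous_slopeMean.sub
    (hγ.continuous_slopeMean.comp (f := fun p : ℝ × ℝ => (p.2, p.1 + 1)) (by fun_prop))

/-- A point of the curve of least imaginary part. -/
theorem exists_lowest : ∃ a, (∀ b, (γ a).im ≤ (γ b).im) ∧ (deriv γ a).im = 0 := by
  obtain ⟨a, -, ha⟩ := isCompact_Icc.exists_isMinOn (Set.nonempty_Icc.2 (zero_le_one (α := ℝ)))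
    (Complex.continuous_im.comp hγ.differentiable.continuous).continuousOn
  have hmin : ∀ b, (γ a).im ≤ (γ b).im := by
    intro b
    have h1 := ha (show Int.fract b ∈ Set.Icc (0 : ℝ) 1 from
      ⟨Int.fract_nonneg b, (Int.fract_lt_one b).le⟩)
    have h2 : γ (Int.fract b) = γ b := by
      conv_rhs => rw [← Int.fract_add_floor b, hγ.periodic_int]
    simpa [h2] using h1
  refine ⟨a, hmin, ?_⟩
  have hd : HasDerivAt (fun x => (γ x).im) (deriv γ a).im a :=
    Complex.imCLM.hasFDerivAt.comp_hasDerivAt a (hγ.differentiable a).hasDerivAt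
  have hl : IsLocalMin (fun x => (γ x).im) a := Filter.Eventually.of_forall hmin
  exact hl.hasDerivAt_eq_zero hd

/-- Hopf's argument: the chord from a to a + u turns from γ'(a) to -γ'(a) as u runs over [0, 1],
hence by an odd multiple of π that does not depend on a, and by symmetry ϑ changes by twice this
amount over a period. At a lowest point all chords lie in the closed upper half plane, which leaves
only ±π. -/
theorem exists_tangentAngle : ∃ (ϑ : ℝ → ℝ) (n : ℤ), Continuous ϑ ∧ (n = 1 ∨ n = -1) ∧
    (∀ a, deriv γ a = ‖deriv γ a‖ * cis (ϑ a)) ∧ ∀ a, ϑ (a + 1) = ϑ a + 2 * Real.pi * n := by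
  -- Clamping u to [0, 1] gives a nonvanishing function on the whole plane, which is open and
  -- convex.
  have hclamp : Continuous fun u : ℝ => max 0 (min u 1) := by fun_prop
  obtain ⟨L, hLc, hL⟩ := exists_continuousOn_arg (E := ℝ × ℝ) convex_univ Set.univ_nonempty
    isOpen_univ (g := fun p => chord γ p.1 (p.1 + max 0 (min p.2 1)))
    (hγ.continuous_chord.comp
      (f := fun p : ℝ × ℝ => (p.1, p.1 + max 0 (min p.2 1))) (by fun_prop)).continuousOn
    (fun p _ => hγ.chord_ne_zero (by simp) (by simp))
  rw [continuousOn_univ] at hLc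
  have hL' : ∀ a, ∀ u ∈ Set.Icc (0 : ℝ) 1,
      chord γ a (a + u) = ‖chord γ a (a + u)‖ * cis (L (a, u)) := by
    intro a u hu
    have := hL (a, u) trivial
    simpa only [min_eq_left hu.2, max_eq_right hu.1] using this
  have hVc : IsPreconnected {p : ℝ × ℝ | p.2 ∈ Set.Icc (0 : ℝ) 1} :=
    (((convex_Icc (0 : ℝ) 1).linear_preimage (LinearMap.snd ℝ ℝ ℝ))).isPreconnected
  -- In the coordinates (a, u), `chord_swap` is the map (a, u) ↦ (a + u, 1 - u); it reverses the
  -- chord, so the argument changes by a constant odd multiple of π.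
  have hcl : ContinuousOn (fun p : ℝ × ℝ => L (p.1 + p.2, 1 - p.2) - L p - Real.pi)
      {p : ℝ × ℝ | p.2 ∈ Set.Icc (0 : ℝ) 1} := by
    apply Continuous.continuousOn
    exact ((hLc.comp (f := fun p : ℝ × ℝ => (p.1 + p.2, 1 - p.2)) (by fun_prop)).sub hLc).sub
      continuous_const
  have hint : ∀ p ∈ {p : ℝ × ℝ | p.2 ∈ Set.Icc (0 : ℝ) 1}, ∃ k : ℤ,
      L (p.1 + p.2, 1 - p.2) - L p - Real.pi = 2 * Real.pi * k := by
    rintro ⟨a, u⟩ hu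
    have hu' : 1 - u ∈ Set.Icc (0 : ℝ) 1 := ⟨by linarith [hu.2], by linarith [hu.1]⟩
    have h1 := hL' a u hu
    have h2 := hL' (a + u) (1 - u) hu'
    rw [show a + u + (1 - u) = a + 1 by ring, hγ.chord_swap, norm_neg] at h2
    have hpos : 0 < ‖chord γ a (a + u)‖ :=
      norm_pos_iff.2 (hγ.chord_ne_zero (by linarith [hu.1]) (by linarith [hu.2]))
    have h3 : cis (L (a + u, 1 - u)) = cis (L (a, u) + Real.pi) := by
      refine cis_eq_of_mul_eq hpos hpos ?_
      rw [← h2, cis_add, cis_pi]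
      linear_combination -h1
    obtain ⟨k, hk⟩ := cis_eq_cis_iff.1 h3
    exact ⟨k, by simp only; rw [hk]; ring⟩
  obtain ⟨k, hk⟩ := hint (0, 0) (by simp)
  have hsym : ∀ a, ∀ u ∈ Set.Icc (0 : ℝ) 1,
      L (a + u, 1 - u) = L (a, u) + Real.pi * (2 * k + 1) := by
    intro a u hu
    have := IsPreconnected.eq_of_int_valued hVc hcl (by positivity) hint
      (x := (a, u)) (y := (0, 0)) hu (by simp)
    rw [hk] at this
    simp only at this
    linarith
  refine ⟨fun a => L (a, 0), 2 * k + 1, hLc.comp (by fun_prop), ?_, fun a => ?_, fun a => ?_⟩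
  · obtain ⟨a, hmin, hda⟩ := hγ.exists_lowest
    have hsin : ∀ u ∈ Set.Icc (0 : ℝ) 1, 0 ≤ Real.sin (L (a, u)) := by
      intro u hu
      have him : 0 ≤ (chord γ a (a + u)).im := by
        rcases hu.1.eq_or_lt with rfl | h1
        · rw [add_zero, hγ.chord_self, hda]
        rcases hu.2.eq_or_lt with rfl | h2
        · rw [hγ.chord_swap, hγ.chord_self, Complex.neg_im, hda, neg_zero]
        have h := congrArg Complex.im (hγ.chord_mul a (a + u))
        rw [Complex.im_ofReal_mul, Complex.sub_im] at h
        have h3 : 0 < (a + u - a) * (a + 1 - (a + u)) := mul_pos (by linarith) (by linarith)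
        have h4 := hmin (a + u)
        nlinarith
      have hpos : 0 < ‖chord γ a (a + u)‖ :=
        norm_pos_iff.2 (hγ.chord_ne_zero (by linarith [hu.1]) (by linarith [hu.2]))
      rw [hL' a u hu, Complex.im_ofReal_mul, cis, Complex.exp_ofReal_mul_I_im] at him
      exact nonneg_of_mul_nonneg_right him hpos
    have hno : ∀ y, L (a, 0) ⊓ L (a, 1) ≤ y → y ≤ L (a, 0) ⊔ L (a, 1) → 0 ≤ Real.sin y := by
      intro y hy1 hy2
      obtain ⟨u, hu, rfl⟩ := intermediate_value_uIcc (a := (0 : ℝ)) (b := 1)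
        (f := fun u => L (a, u)) (hLc.comp (by fun_prop)).continuousOn ⟨hy1, hy2⟩
      rw [Set.uIcc_of_le zero_le_one] at hu
      exact hsin u hu
    have hend := hsym a 0 (by simp)
    rw [add_zero, sub_zero] at hend
    -- An increment π(2k + 1) with k ≥ 1 or k ≤ -2 has size at least 3π, so it would sweep a full
    -- period of the sine.
    have hfull : ∀ x, ∃ y ∈ Set.Ico x (x + 2 * Real.pi), Real.sin y < 0 := by
      intro x
      obtain ⟨y, hy, h⟩ := Real.sin_periodic.exists_mem_Ico Real.two_pi_pos (-(Real.pi / 2)) x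
      exact ⟨y, hy, by rw [← h, Real.sin_neg, Real.sin_pi_div_two]; norm_num⟩
    have hb1 : ¬ (1 ≤ k) := by
      intro hk1
      have hk1' : (1 : ℝ) ≤ k := by exact_mod_cast hk1
      obtain ⟨y, hy, hs⟩ := hfull (L (a, 0))
      refine absurd (hno y (inf_le_left.trans hy.1) ((hy.2.le.trans ?_).trans le_sup_right))
        (not_le.2 hs)
      rw [hend]; nlinarith [Real.pi_pos]
    have hb2 : ¬ (k ≤ -2) := by
      intro hk1
      have hk1' : (k : ℝ) ≤ -2 := by exact_mod_cast hk1
      obtain ⟨y, hy, hs⟩ := hfull (L (a, 1))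
      refine absurd (hno y (inf_le_right.trans hy.1) ((hy.2.le.trans ?_).trans le_sup_left))
        (not_le.2 hs)
      rw [hend]; nlinarith [Real.pi_pos]
    omega
  · have := hL' a 0 (by simp)
    rwa [add_zero, hγ.chord_self] at this
  · have h1 := hsym a 0 (by simp)
    have h2 := hsym a 1 (by simp)
    rw [add_zero, sub_zero] at h1
    rw [sub_self] at h2
    simp only [h2, h1]; push_cast; ring

end IsSmoothJordan

/-! ### Phases of Lagrangian planes -/

theorem omega_add_left (p q w : C2) : omega (p + q) w = omega p w + omega q w := by
  simp [omega]; ring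

theorem omega_add_right (w p q : C2) : omega w (p + q) = omega w p + omega w q := by
  simp [omega]; ring

theorem omega_smul_left (a : ℝ) (p q : C2) : omega (a • p) q = a * omega p q := by
  simp [omega]; ring

theorem omega_smul_right (a : ℝ) (p q : C2) : omega p (a • q) = a * omega p q := by
  simp [omega]; ring

theorem omega_self (p : C2) : omega p p = 0 := by
  simp [omega]; ring

theorem omega_swap (p q : C2) : omega q p = -omega p q := by
  simp [omega]; ring

theorem det2_combination (a b c d : ℝ) (u v : C2) :
    det2 (a • u + b • v) (c • u + d • v) = ((a * d - b * c : ℝ) : ℂ) * det2 u v := by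
  simp only [det2, Prod.fst_add, Prod.snd_add, Prod.smul_fst, Prod.smul_snd, Complex.real_smul]
  push_cast; ring

theorem isLagrangian_span {u v : C2} (hd : det2 u v ≠ 0) (hω : omega u v = 0) :
    IsLagrangian (Submodule.span ℝ {u, v}) := by
  constructor
  · have hli : LinearIndependent ℝ ![u, v] := by
      rw [LinearIndependent.pair_iff]
      intro a b h
      have h1 : det2 (a • u + b • v) ((0 : ℝ) • u + (1 : ℝ) • v) = 0 := by
        rw [h]; simp [det2]
      have h2 : det2 (a • u + b • v) ((1 : ℝ) • u + (0 : ℝ) • v) = 0 := by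
        rw [h]; simp [det2]
      rw [det2_combination, mul_eq_zero, Complex.ofReal_eq_zero] at h1 h2
      have h1 := h1.resolve_right hd
      have h2 := h2.resolve_right hd
      exact ⟨by linarith, by linarith⟩
    have := finrank_span_eq_card hli
    rwa [Matrix.range_cons_cons_empty, Fintype.card_fin] at this
  · intro p hp q hq
    obtain ⟨a, b, rfl⟩ := Submodule.mem_span_pair.1 hp
    obtain ⟨c, d, rfl⟩ := Submodule.mem_span_pair.1 hq
    simp only [omega_add_left, omega_add_right, omega_smul_left, omega_smul_right, omega_self,
      omega_swap u v, hω]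
    ring

/-- The square of the determinant of a real basis of `P` has argument `x`. -/
def HasPhase (P : Submodule ℝ C2) (x : ℝ) : Prop :=
  ∃ u v : C2, P = Submodule.span ℝ {u, v} ∧ det2 u v ≠ 0 ∧
    det2 u v ^ 2 = ((‖det2 u v‖ ^ 2 : ℝ) : ℂ) * cis x

/-- A change of real basis multiplies the determinant by a nonzero real number, whose square is
positive. -/
theorem HasPhase.cis_eq {P : Submodule ℝ C2} {x y : ℝ} (hx : HasPhase P x) (hy : HasPhase P y) :
    cis x = cis y := by
  obtain ⟨u, v, rfl, h0, h1⟩ := hx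
  obtain ⟨u', v', hP, h0', h1'⟩ := hy
  have hu' : u' ∈ Submodule.span ℝ {u, v} := hP ▸ Submodule.subset_span (by simp)
  have hv' : v' ∈ Submodule.span ℝ {u, v} := hP ▸ Submodule.subset_span (by simp)
  obtain ⟨a, b, rfl⟩ := Submodule.mem_span_pair.1 hu'
  obtain ⟨c, d, rfl⟩ := Submodule.mem_span_pair.1 hv'
  rw [det2_combination] at h0' h1'
  have he : ((a * d - b * c : ℝ) : ℂ) ≠ 0 := left_ne_zero_of_mul h0'
  rw [mul_pow, h1, norm_mul, Complex.norm_real, Real.norm_eq_abs, mul_pow, sq_abs,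
    Complex.ofReal_mul, mul_assoc, Complex.ofReal_pow (a * d - b * c)] at h1'
  have h2 := mul_left_cancel₀ (pow_ne_zero 2 he) h1'
  exact mul_left_cancel₀ (by exact_mod_cast pow_ne_zero 2 (norm_ne_zero_iff.2 h0)) h2

theorem HasPhase.congr {P : Submodule ℝ C2} {x y : ℝ} (hx : HasPhase P x) (h : cis x = cis y) :
    HasPhase P y := by
  obtain ⟨u, v, hP, h0, h1⟩ := hx
  exact ⟨u, v, hP, h0, h ▸ h1⟩

/-- The factor r may be negative, since only its square enters; later it is used to keep arguments
off the branch cut. -/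
theorem hasPhase_span {u v : C2} {r x : ℝ} (hr : r ≠ 0) (h : det2 u v = r * cis x) :
    HasPhase (Submodule.span ℝ {u, v}) (2 * x) := by
  refine ⟨u, v, rfl, ?_, ?_⟩
  · rw [h]; exact mul_ne_zero (by exact_mod_cast hr) (cis_ne_zero x)
  · rw [h, norm_mul, norm_cis, mul_one, Complex.norm_real, Real.norm_eq_abs, sq_abs, mul_pow,
      cis_pow]
    push_cast; rfl

theorem hasMaslovIndex_iff {P : unitInterval → Submodule ℝ C2} {n : ℤ} :
    HasMaslovIndex P n ↔ ∃ θ : C(unitInterval, ℝ), (∀ τ, HasPhase (P τ) (θ τ)) ∧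
      θ 1 - θ 0 = 2 * Real.pi * n := by
  constructor
  · rintro ⟨u, v, θ, h, hθ⟩
    exact ⟨θ, fun τ => ⟨u τ, v τ, h τ⟩, hθ⟩
  · rintro ⟨θ, h, hθ⟩
    choose u v h using h
    exact ⟨u, v, θ, h, hθ⟩

theorem range_eq_span (A : ℝ × ℝ →L[ℝ] C2) :
    LinearMap.range A.toLinearMap = Submodule.span ℝ {A (1, 0), A (0, 1)} := by
  ext p
  rw [Submodule.mem_span_pair]
  constructor
  · rintro ⟨⟨a, b⟩, rfl⟩
    refine ⟨a, b, ?_⟩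
    rw [← map_smul, ← map_smul, ← map_add]; simp
  · rintro ⟨a, b, rfl⟩
    exact ⟨(a, b), by
      show A (a, b) = _
      rw [← map_smul, ← map_smul, ← map_add]; simp⟩

/-! ### The tori -/

/-- The parametrization of the torus `R_φ ∘ F_r (γ × γ)`. -/
noncomputable def tor (γ : ℝ → ℂ) (r φ : ℝ) (x : ℝ × ℝ) : C2 := mapR φ (mapF r (γ x.1, γ x.2))

theorem mapR_zero (p : C2) : mapR 0 p = p := by simp [mapR]

theorem torus1_eq (γ : ℝ → ℂ) (s φ : ℝ) : torus1 γ s φ = Set.range (tor γ s φ) := by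
  ext p
  constructor
  · rintro ⟨⟨_, _⟩, ⟨⟨a, rfl⟩, ⟨b, rfl⟩⟩, rfl⟩; exact ⟨(a, b), rfl⟩
  · rintro ⟨⟨a, b⟩, rfl⟩; exact ⟨(γ a, γ b), ⟨⟨a, rfl⟩, ⟨b, rfl⟩⟩, rfl⟩

theorem torus2_eq (γ : ℝ → ℂ) (t : ℝ) : torus2 γ t = Set.range (tor γ t 0) := by
  ext p
  constructor
  · rintro ⟨⟨_, _⟩, ⟨⟨a, rfl⟩, ⟨b, rfl⟩⟩, rfl⟩; exact ⟨(a, b), mapR_zero _⟩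
  · rintro ⟨⟨a, b⟩, rfl⟩; exact ⟨(γ a, γ b), ⟨⟨a, rfl⟩, ⟨b, rfl⟩⟩, (mapR_zero _).symm⟩

/-- The chord `z - w` recovered from the point `R_φ (F_r (z, w))`. -/
noncomputable def torChord (r φ : ℝ) (p : C2) : ℂ := cis (-φ) * p.2 / Real.sqrt (r * (1 - r))

/-- The first factor `z` recovered from the point `R_φ (F_r (z, w))`. -/
noncomputable def torFst (r φ : ℝ) (p : C2) : ℂ := p.1 + (1 - r) * torChord r φ p

/-- The second factor `w` recovered from the point `R_φ (F_r (z, w))`. -/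
noncomputable def torSnd (r φ : ℝ) (p : C2) : ℂ := p.1 - r * torChord r φ p

theorem differentiable_torFst (r φ : ℝ) : Differentiable ℝ (torFst r φ) := by
  unfold torFst torChord; fun_prop

theorem differentiable_torSnd (r φ : ℝ) : Differentiable ℝ (torSnd r φ) := by
  unfold torSnd torChord; fun_prop

section

variable {γ : ℝ → ℂ} {r φ : ℝ}

theorem sqrt_pos_of_mem (hr : r ∈ Set.Ioo (0 : ℝ) 1) : 0 < Real.sqrt (r * (1 - r)) :=
  Real.sqrt_pos.2 (mul_pos hr.1 (by linarith [hr.2]))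

theorem torChord_tor (hr : r ∈ Set.Ioo (0 : ℝ) 1) (x : ℝ × ℝ) :
    torChord r φ (tor γ r φ x) = γ x.1 - γ x.2 := by
  have h : (Real.sqrt (r * (1 - r)) : ℂ) ≠ 0 := by exact_mod_cast (sqrt_pos_of_mem hr).ne'
  have h1 : cis (-φ) * Complex.exp (φ * Complex.I) = 1 := by
    rw [show Complex.exp (φ * Complex.I) = cis φ from rfl, ← cis_add]; simp [cis]
  simp only [torChord, tor, mapR, mapF]
  rw [div_eq_iff h]
  linear_combination ((Real.sqrt (r * (1 - r)) : ℂ) * γ x.1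
    - (Real.sqrt (r * (1 - r)) : ℂ) * γ x.2) * h1

theorem torFst_tor (hr : r ∈ Set.Ioo (0 : ℝ) 1) (x : ℝ × ℝ) :
    torFst r φ (tor γ r φ x) = γ x.1 := by
  rw [torFst, torChord_tor hr]; simp only [tor, mapR, mapF]; push_cast; ring

theorem torSnd_tor (hr : r ∈ Set.Ioo (0 : ℝ) 1) (x : ℝ × ℝ) :
    torSnd r φ (tor γ r φ x) = γ x.2 := by
  rw [torSnd, torChord_tor hr]; simp only [tor, mapR, mapF]; push_cast; ring

theorem tor_diag (a : ℝ) : tor γ r φ (a, a) = (γ a, 0) := by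
  simp only [tor, mapR, mapF]
  refine Prod.ext ?_ ?_
  · simp only; push_cast; ring
  · simp

variable (hγ : IsSmoothJordan γ)
include hγ

/-- For 0 < r < 1 the map R_φ F_r is invertible, so the torus is embedded. -/
theorem IsSmoothJordan.tor_eq_iff (hr : r ∈ Set.Ioo (0 : ℝ) 1) {x y : ℝ × ℝ} :
    tor γ r φ x = tor γ r φ y ↔ (∃ k : ℤ, y.1 = x.1 + k) ∧ ∃ l : ℤ, y.2 = x.2 + l := by
  rw [← hγ.eq_iff, ← hγ.eq_iff]
  constructor
  · intro h
    exact ⟨by rw [← torFst_tor (γ := γ) (φ := φ) hr x, h, torFst_tor hr],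
      by rw [← torSnd_tor (γ := γ) (φ := φ) hr x, h, torSnd_tor hr]⟩
  · rintro ⟨h1, h2⟩; simp only [tor, h1, h2]

theorem IsSmoothJordan.tor_add_int (x : ℝ × ℝ) (k l : ℤ) :
    tor γ r φ (x.1 + k, x.2 + l) = tor γ r φ x := by
  simp only [tor, hγ.periodic_int]

theorem IsSmoothJordan.contDiff_tor : ContDiff ℝ ∞ (tor γ r φ) := by
  have h1 : ContDiff ℝ ∞ fun x : ℝ × ℝ => γ x.1 := hγ.smooth.comp contDiff_fst
  have h2 : ContDiff ℝ ∞ fun x : ℝ × ℝ => γ x.2 := hγ.smooth.comp contDiff_snd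
  unfold tor mapR mapF
  exact ContDiff.prodMk ((contDiff_const.mul h1).add (contDiff_const.mul h2))
    (contDiff_const.mul ((contDiff_const.mul h1).sub (contDiff_const.mul h2)))

theorem IsSmoothJordan.differentiable_tor : Differentiable ℝ (tor γ r φ) :=
  hγ.contDiff_tor.differentiable (by simp)

theorem IsSmoothJordan.fderiv_tor_add_int (x : ℝ × ℝ) (k l : ℤ) :
    fderiv ℝ (tor γ r φ) (x.1 + k, x.2 + l) = fderiv ℝ (tor γ r φ) x := by
  have h : (fun y : ℝ × ℝ => tor γ r φ (y + ((k : ℝ), (l : ℝ)))) = tor γ r φ :=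
    funext fun y => hγ.tor_add_int y k l
  conv_rhs => rw [← h, fderiv_comp_add_right]
  rfl

theorem IsSmoothJordan.fderiv_tor_fst (x : ℝ × ℝ) :
    fderiv ℝ (tor γ r φ) x (1, 0) = mapR φ (mapF r (deriv γ x.1, 0)) := by
  have h1 : HasDerivAt (fun s : ℝ => ((s, x.2) : ℝ × ℝ)) (1, 0) x.1 :=
    (hasDerivAt_id x.1).prodMk (hasDerivAt_const x.1 x.2)
  have h2 := (hγ.differentiable_tor (r := r) (φ := φ) x).hasFDerivAt.comp_hasDerivAt x.1 h1
  have hz := (hγ.differentiable x.1).hasDerivAt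
  refine h2.unique ?_
  have hc : HasDerivAt (fun _ : ℝ => γ x.2) 0 x.1 := hasDerivAt_const _ _
  exact HasDerivAt.prodMk ((hz.const_mul (r : ℂ)).add (hc.const_mul ((1 - r : ℝ) : ℂ)))
    (((hz.const_mul (Real.sqrt (r * (1 - r)) : ℂ)).sub
      (hc.const_mul (Real.sqrt (r * (1 - r)) : ℂ))).const_mul (Complex.exp (φ * Complex.I)))

theorem IsSmoothJordan.fderiv_tor_snd (x : ℝ × ℝ) :
    fderiv ℝ (tor γ r φ) x (0, 1) = mapR φ (mapF r (0, deriv γ x.2)) := by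
  have h1 : HasDerivAt (fun s : ℝ => ((x.1, s) : ℝ × ℝ)) (0, 1) x.2 :=
    (hasDerivAt_const x.2 x.1).prodMk (hasDerivAt_id x.2)
  have h2 := (hγ.differentiable_tor (r := r) (φ := φ) x).hasFDerivAt.comp_hasDerivAt x.2 h1
  have hz := (hγ.differentiable x.2).hasDerivAt
  refine h2.unique ?_
  have hc : HasDerivAt (fun _ : ℝ => γ x.1) 0 x.2 := hasDerivAt_const _ _
  exact HasDerivAt.prodMk ((hc.const_mul (r : ℂ)).add (hz.const_mul ((1 - r : ℝ) : ℂ)))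
    (((hc.const_mul (Real.sqrt (r * (1 - r)) : ℂ)).sub
      (hz.const_mul (Real.sqrt (r * (1 - r)) : ℂ))).const_mul (Complex.exp (φ * Complex.I)))

theorem det2_fderiv_tor (x : ℝ × ℝ) :
    det2 (fderiv ℝ (tor γ r φ) x (1, 0)) (fderiv ℝ (tor γ r φ) x (0, 1)) =
      -(cis φ * Real.sqrt (r * (1 - r)) * deriv γ x.1 * deriv γ x.2) := by
  rw [hγ.fderiv_tor_fst, hγ.fderiv_tor_snd]
  simp only [det2, mapR, mapF, cis]
  push_cast; ring

/-- The columns of F_r are Hermitian orthogonal, as r(1 - r) - √(r(1 - r))² = 0, and R_φ is unitary.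
-/
theorem omega_fderiv_tor (hr : r ∈ Set.Ioo (0 : ℝ) 1) (x : ℝ × ℝ) :
    omega (fderiv ℝ (tor γ r φ) x (1, 0)) (fderiv ℝ (tor γ r φ) x (0, 1)) = 0 := by
  rw [hγ.fderiv_tor_fst, hγ.fderiv_tor_snd]
  have h1 : (starRingEnd ℂ) (cis φ) * cis φ = 1 := by
    rw [mul_comm, Complex.mul_conj, Complex.normSq_eq_norm_sq, norm_cis]; simp
  have h2 : (Real.sqrt (r * (1 - r)) : ℂ) * Real.sqrt (r * (1 - r)) = r * (1 - r) := by
    rw [← Complex.ofReal_mul, Real.mul_self_sqrt (mul_nonneg hr.1.le (by linarith [hr.2]))]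
    push_cast; ring
  have h3 : Complex.exp (φ * Complex.I) = cis φ := rfl
  simp only [omega, mapR, mapF, h3, map_mul, map_add, map_sub, Complex.conj_ofReal, map_zero]
  rw [← Complex.zero_im]
  congr 1
  push_cast
  linear_combination (-(Real.sqrt (r * (1 - r)) : ℂ) * Real.sqrt (r * (1 - r)) *
    (starRingEnd ℂ) (deriv γ x.1) * deriv γ x.2) * h1 -
    (starRingEnd ℂ) (deriv γ x.1) * deriv γ x.2 * h2

theorem hasPhase_tor (hr : r ∈ Set.Ioo (0 : ℝ) 1) {ϑ : ℝ → ℝ}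
    (hϑ : ∀ a, deriv γ a = ‖deriv γ a‖ * cis (ϑ a)) (x : ℝ × ℝ) :
    HasPhase (LinearMap.range (fderiv ℝ (tor γ r φ) x).toLinearMap)
      (2 * (φ + ϑ x.1 + ϑ x.2)) := by
  rw [range_eq_span]
  have hpos : 0 < Real.sqrt (r * (1 - r)) * ‖deriv γ x.1‖ * ‖deriv γ x.2‖ :=
    mul_pos (mul_pos (sqrt_pos_of_mem hr) (norm_pos_iff.2 (hγ.regular _)))
      (norm_pos_iff.2 (hγ.regular _))
  -- The summand π is the minus sign of the determinant; doubling makes it invisible.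
  refine (hasPhase_span (x := φ + ϑ x.1 + ϑ x.2 + Real.pi) hpos.ne' ?_).congr
    (cis_eq_cis_iff.2 ⟨1, by push_cast; ring⟩)
  rw [det2_fderiv_tor hγ, hϑ x.1, hϑ x.2, cis_add, cis_add, cis_add, cis_pi]
  simp only [norm_mul, norm_cis, Complex.norm_real, norm_norm, mul_one]
  push_cast; ring

theorem isLagrangian_tor (hr : r ∈ Set.Ioo (0 : ℝ) 1) (x : ℝ × ℝ) :
    IsLagrangian (LinearMap.range (fderiv ℝ (tor γ r φ) x).toLinearMap) := by
  rw [range_eq_span]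
  refine isLagrangian_span ?_ (omega_fderiv_tor hγ hr x)
  rw [det2_fderiv_tor hγ, neg_ne_zero]
  exact mul_ne_zero (mul_ne_zero (mul_ne_zero (cis_ne_zero _)
    (by exact_mod_cast (sqrt_pos_of_mem hr).ne')) (hγ.regular _)) (hγ.regular _)

end

/-! ### Sheets of the tori along the diagonal -/

/-- The strip `|x.2| < ε`. -/
def strip (ε : ℝ) : Set (ℝ × ℝ) := {x | |x.2| < ε}

theorem isOpen_strip (ε : ℝ) : IsOpen (strip ε) :=
  isOpen_lt (by fun_prop) continuous_const

theorem convex_strip (ε : ℝ) : Convex ℝ (strip ε) := by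
  have h : strip ε = (LinearMap.snd ℝ ℝ ℝ) ⁻¹' Set.Ioo (-ε) ε := by
    ext x; simp [strip, abs_lt]
  rw [h]
  exact (convex_Ioo _ _).linear_preimage _

/-- `Φ` parametrizes a neighbourhood of the diagonal circle in the torus `R_φ ∘ F_r (γ × γ)`. -/
structure IsSheet (γ : ℝ → ℂ) (r φ ε : ℝ) (Φ : ℝ × ℝ → C2) : Prop where
  pos : 0 < ε
  differentiable : ∀ x ∈ strip ε, DifferentiableAt ℝ Φ x
  immersive : ∀ x ∈ strip ε, Function.Injective (fderiv ℝ Φ x)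
  mem : ∀ x ∈ strip ε, Φ x ∈ Set.range (tor γ r φ)
  inj : ∀ x ∈ strip ε, ∀ y ∈ strip ε, Φ x = Φ y ↔ (∃ k : ℤ, y.1 = x.1 + k) ∧ y.2 = x.2
  core : Set.range (fun x : ℝ => Φ (x, 0)) = Set.range γ ×ˢ {0}

/-- `(a, b)` is a lift of the sheet `Φ` to the universal cover of the torus; the second coordinate
of the sheet is positive on one side of the diagonal `a = b`, according to the sign `s`. -/
structure IsSheetLift (γ : ℝ → ℂ) (r φ ε : ℝ) (Φ : ℝ × ℝ → C2) (a b : ℝ × ℝ → ℝ) (d : ℤ) (s : ℝ) :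
    Prop where
  cont_fst : ContinuousOn a (strip ε)
  cont_snd : ContinuousOn b (strip ε)
  eq_tor : ∀ x ∈ strip ε, Φ x = tor γ r φ (a x, b x)
  range_fderiv : ∀ x ∈ strip ε, LinearMap.range (fderiv ℝ Φ x).toLinearMap =
    LinearMap.range (fderiv ℝ (tor γ r φ) (a x, b x)).toLinearMap
  shift_fst : ∀ x ∈ strip ε, a (x.1 + 1, x.2) = a x + d
  shift_snd : ∀ x ∈ strip ε, b (x.1 + 1, x.2) = b x + d
  degree : d = 1 ∨ d = -1
  sign : s = 1 ∨ s = -1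
  side_pos : ∀ x ∈ strip ε, 0 < x.2 → s * (b x - a x) ∈ Set.Ioo (0 : ℝ) 1
  side_neg : ∀ x ∈ strip ε, x.2 < 0 → s * (b x - a x) ∈ Set.Ioo (-1 : ℝ) 0

theorem IsPreconnected.mem_Ioo_of_ne {X : Type*} [TopologicalSpace X] {U : Set X}
    (hU : IsPreconnected U) {f : X → ℝ} (hf : ContinuousOn f U) (h0 : ∀ x ∈ U, f x ≠ 0)
    (h1 : ∀ x ∈ U, f x ≠ 1) {x y : X} (hx : x ∈ U) (hfx : f x ∈ Set.Ioo (0 : ℝ) 1) (hy : y ∈ U) :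
    f y ∈ Set.Ioo (0 : ℝ) 1 := by
  constructor
  · by_contra h
    obtain ⟨z, hz, hfz⟩ := hU.intermediate_value hy hx hf ⟨not_lt.1 h, hfx.1.le⟩
    exact h0 z hz hfz
  · by_contra h
    obtain ⟨z, hz, hfz⟩ := hU.intermediate_value hx hy hf ⟨hfx.2.le, not_lt.1 h⟩
    exact h1 z hz hfz

/-- A continuous lift of an injective map between circles has degree `± 1`. -/
theorem degree_eq_one_or_neg_one {α : ℝ → ℝ} (hα : Continuous α) {d : ℤ}
    (hd : ∀ t, α (t + 1) = α t + d) (hinj : ∀ t u, (∃ k : ℤ, α u = α t + k) → ∃ k : ℤ, u = t + k) :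
    d = 1 ∨ d = -1 := by
  by_contra hne
  push Not at hne
  rcases eq_or_ne d 0 with rfl | h0
  -- In degree 0, this half-period difference takes opposite values at 0 and 1/2, so it vanishes
  -- somewhere between.
  · have hc : Continuous fun t => α (t + 1 / 2) - α t := by fun_prop
    have h1 := hd 0
    have hz : (0 : ℝ) ∈ Set.uIcc (α (0 + 1 / 2) - α 0) (α (1 / 2 + 1 / 2) - α (1 / 2)) := by
      rw [Set.mem_uIcc]
      norm_num at h1 ⊢
      rw [h1]
      rcases le_total (α 0) (α (1 / 2)) with h | h
      · right; constructor <;> linarith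
      · left; constructor <;> linarith
    obtain ⟨t, -, ht⟩ := intermediate_value_uIcc (a := (0 : ℝ)) (b := 1 / 2)
      (f := fun t => α (t + 1 / 2) - α t) hc.continuousOn hz
    obtain ⟨k, hk⟩ := hinj t (t + 1 / 2) ⟨0, by simp only at ht; push_cast; linarith⟩
    have h2 : (2 * k : ℝ) = 1 := by linarith
    have h3 : 2 * k = 1 := by exact_mod_cast h2
    omega
  -- If α(0) + e were attained on [0, 1], injectivity would place it at an endpoint. With |d| ≥ 2,
  -- one of e = ±1 contradicts this.
  · have key : ∀ e : ℤ, e ≠ 0 → e ≠ d → α 0 + e ∉ Set.uIcc (α 0) (α 1) := by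
      intro e he hed hmem
      obtain ⟨t, ht, hte⟩ := intermediate_value_uIcc (a := (0 : ℝ)) (b := 1)
        hα.continuousOn hmem
      obtain ⟨k, hk⟩ := hinj 0 t ⟨e, hte⟩
      rw [zero_add] at hk
      rw [Set.uIcc_of_le zero_le_one, hk] at ht
      have h1 : 0 ≤ k := by exact_mod_cast ht.1
      have h2 : k ≤ 1 := by exact_mod_cast ht.2
      obtain rfl | rfl : k = 0 ∨ k = 1 := by omega
      · rw [hk] at hte; simp at hte; exact he (by exact_mod_cast hte)
      · rw [hk, Int.cast_one, ← zero_add (1 : ℝ), hd 0, add_right_inj] at hte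
        exact hed (by exact_mod_cast hte.symm)
    have h1 : α 1 = α 0 + d := by simpa using hd 0
    rcases lt_or_gt_of_ne h0 with h | h
    · refine key (-1) (by norm_num) (Ne.symm hne.2) (Set.mem_uIcc.2 (Or.inr ?_))
      have : (d : ℝ) ≤ -1 := by exact_mod_cast (by omega : d ≤ -1)
      rw [h1]; push_cast; constructor <;> linarith
    · refine key 1 (by norm_num) (Ne.symm hne.1) (Set.mem_uIcc.2 (Or.inl ?_))
      have : (1 : ℝ) ≤ d := by exact_mod_cast (by omega : 1 ≤ d)
      rw [h1]; push_cast; constructor <;> linarith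

namespace IsSheet

variable {γ : ℝ → ℂ} {r φ ε : ℝ} {Φ : ℝ × ℝ → C2}

theorem mem_strip_zero (hΦ : IsSheet γ r φ ε Φ) (x : ℝ) : ((x, 0) : ℝ × ℝ) ∈ strip ε := by
  simp [strip, hΦ.pos]

/-- A lift of a sheet to pairs of parameters which maps the core to the diagonal `a = b`. -/
theorem exists_param (hΦ : IsSheet γ r φ ε Φ) (hγ : IsSmoothJordan γ)
    (hr : r ∈ Set.Ioo (0 : ℝ) 1) :
    ∃ a b : ℝ × ℝ → ℝ, ContinuousOn a (strip ε) ∧ ContinuousOn b (strip ε) ∧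
      (∀ x ∈ strip ε, Φ x = tor γ r φ (a x, b x)) ∧ (∀ x, b (x, 0) = a (x, 0)) := by
  have hne : (strip ε).Nonempty := ⟨_, hΦ.mem_strip_zero 0⟩
  have hΦc : ContinuousOn Φ (strip ε) := fun x hx =>
    (hΦ.differentiable x hx).continuousAt.continuousWithinAt
  obtain ⟨a, ha, haΦ⟩ := hγ.exists_lift (convex_strip ε) hne (isOpen_strip ε)
    ((differentiable_torFst r φ).continuous.comp_continuousOn hΦc) (by
      intro x hx
      obtain ⟨y, hy⟩ := hΦ.mem x hx
      exact ⟨y.1, by simp only [Function.comp, ← hy, torFst_tor hr]⟩)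
  obtain ⟨b, hb, hbΦ⟩ := hγ.exists_lift (convex_strip ε) hne (isOpen_strip ε)
    ((differentiable_torSnd r φ).continuous.comp_continuousOn hΦc) (by
      intro x hx
      obtain ⟨y, hy⟩ := hΦ.mem x hx
      exact ⟨y.2, by simp only [Function.comp, ← hy, torSnd_tor hr]⟩)
  have heq : ∀ x ∈ strip ε, Φ x = tor γ r φ (a x, b x) := by
    intro x hx
    obtain ⟨y, hy⟩ := hΦ.mem x hx
    have h1 := haΦ x hx
    have h2 := hbΦ x hx
    simp only [Function.comp, ← hy, torFst_tor hr, torSnd_tor hr] at h1 h2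
    rw [← hy, tor, tor, h1, h2]
  have hi : Continuous fun x : ℝ => ((x, 0) : ℝ × ℝ) := by fun_prop
  have hint : ∀ x ∈ (Set.univ : Set ℝ), ∃ k : ℤ, b (x, 0) - a (x, 0) = 1 * k := by
    intro x _
    have h1 : Φ (x, 0) ∈ Set.range γ ×ˢ ({0} : Set ℂ) := hΦ.core ▸ ⟨x, rfl⟩
    have h2 : torChord r φ (Φ (x, 0)) = 0 := by
      have : (Φ (x, 0)).2 = 0 := h1.2
      simp [torChord, this]
    rw [heq _ (hΦ.mem_strip_zero x), torChord_tor hr, sub_eq_zero] at h2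
    obtain ⟨k, hk⟩ := hγ.eq_iff.1 h2
    exact ⟨k, by simp only at hk; rw [hk]; ring⟩
  have hmap : Set.MapsTo (fun x : ℝ => ((x, 0) : ℝ × ℝ)) Set.univ (strip ε) :=
    fun x _ => hΦ.mem_strip_zero x
  have hcst : ∀ x, b (x, 0) - a (x, 0) = b (0, 0) - a (0, 0) := fun x =>
    IsPreconnected.eq_of_int_valued isPreconnected_univ
      ((hb.comp hi.continuousOn hmap).sub (ha.comp hi.continuousOn hmap)) one_pos hint
      (Set.mem_univ x) (Set.mem_univ 0)
  obtain ⟨k, hk⟩ := hint 0 trivial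
  -- On the core b - a is a constant integer, which is removed by a deck transformation.
  refine ⟨a, fun x => b x - k, ha, hb.sub continuousOn_const, fun x hx => ?_, fun x => ?_⟩
  · rw [heq x hx, hγ.tor_eq_iff hr]
    exact ⟨⟨0, by simp⟩, ⟨-k, by push_cast; ring⟩⟩
  · have := hcst x; simp only; linarith

/-- The diagonal of the torus is γ × {0}, the core of the sheet; hence b - a can be an integer only
on the core. -/
theorem snd_eq_zero (hΦ : IsSheet γ r φ ε Φ) (hγ : IsSmoothJordan γ)
    {x : ℝ × ℝ} (hx : x ∈ strip ε) {a : ℝ} {k : ℤ} (h : Φ x = tor γ r φ (a, a + k)) :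
    x.2 = 0 := by
  have h1 : tor γ r φ (a, a + k) = (γ a, 0) := by
    rw [← tor_diag (r := r) (φ := φ)]; simpa using hγ.tor_add_int (r := r) (φ := φ) (a, a) 0 k
  have h2 : Φ x ∈ Set.range (fun x : ℝ => Φ (x, 0)) := by
    rw [hΦ.core, h, h1]; exact ⟨⟨a, rfl⟩, rfl⟩
  obtain ⟨y, hy⟩ := h2
  exact ((hΦ.inj _ (hΦ.mem_strip_zero y) x hx).1 hy).2

theorem hasFDerivAt_param (hΦ : IsSheet γ r φ ε Φ) (hγ : IsSmoothJordan γ)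
    (hr : r ∈ Set.Ioo (0 : ℝ) 1) {a b : ℝ × ℝ → ℝ}
    (ha : ContinuousOn a (strip ε)) (hb : ContinuousOn b (strip ε))
    (h : ∀ x ∈ strip ε, Φ x = tor γ r φ (a x, b x)) {x : ℝ × ℝ} (hx : x ∈ strip ε) :
    ∃ a' b' : ℝ × ℝ →L[ℝ] ℝ, HasFDerivAt a a' x ∧ HasFDerivAt b b' x ∧
      fderiv ℝ Φ x = (fderiv ℝ (tor γ r φ) (a x, b x)).comp (a'.prod b') := by
  have hn := (isOpen_strip ε).mem_nhds hx
  have hda : DifferentiableAt ℝ a x := by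
    refine hγ.differentiableAt_lift (ha.continuousAt hn)
      ((differentiable_torFst r φ (Φ x)).comp x (hΦ.differentiable x hx)) ?_
    filter_upwards [hn] with y hy
    rw [Function.comp, h y hy, torFst_tor hr]
  have hdb : DifferentiableAt ℝ b x := by
    refine hγ.differentiableAt_lift (hb.continuousAt hn)
      ((differentiable_torSnd r φ (Φ x)).comp x (hΦ.differentiable x hx)) ?_
    filter_upwards [hn] with y hy
    rw [Function.comp, h y hy, torSnd_tor hr]
  refine ⟨_, _, hda.hasFDerivAt, hdb.hasFDerivAt, ?_⟩
  have h1 : HasFDerivAt (fun y => tor γ r φ (a y, b y)) _ x :=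
    HasFDerivAt.comp (g := tor γ r φ) (f := fun y => (a y, b y)) x
      (hγ.differentiable_tor (a x, b x)).hasFDerivAt (hda.hasFDerivAt.prodMk hdb.hasFDerivAt)
  refine (h1.congr_of_eventuallyEq ?_).fderiv
  filter_upwards [hn] with y hy using h y hy

/-- Since Φ is an immersion, b - a vanishes transversally on the core. Off the core it is never an
integer, so on each side it keeps its sign and stays below 1 in absolute value. -/
theorem exists_lift (hΦ : IsSheet γ r φ ε Φ) (hγ : IsSmoothJordan γ)
    (hr : r ∈ Set.Ioo (0 : ℝ) 1) :
    ∃ a b d s, IsSheetLift γ r φ ε Φ a b d s := by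
  obtain ⟨a, b, ha, hb, heq, hdiag⟩ := hΦ.exists_param hγ hr
  have hnoint : ∀ x ∈ strip ε, ∀ k : ℤ, b x - a x = k → x.2 = 0 := by
    intro x hx k hk
    refine hΦ.snd_eq_zero hγ hx (a := a x) (k := k) ?_
    rw [heq x hx, ← hk, add_sub_cancel]
  -- the derivative of `b - a` across the core
  obtain ⟨a', b', ha', hb', hcomp⟩ :=
    hΦ.hasFDerivAt_param hγ hr ha hb heq (hΦ.mem_strip_zero 0)
  have hinj : Function.Injective (a'.prod b') := by
    have := hΦ.immersive _ (hΦ.mem_strip_zero 0)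
    rw [hcomp] at this
    exact Function.Injective.of_comp (f := fderiv ℝ (tor γ r φ) (a (0, 0), b (0, 0))) this
  -- On u the form b' - a' equals 1; as it kills (1, 0), it cannot also kill (0, 1).
  obtain ⟨u, hu⟩ := (LinearMap.injective_iff_surjective (f := (a'.prod b').toLinearMap)).1 hinj (0, 1)
  have hua : a' u = 0 := congrArg Prod.fst hu
  have hub : b' u = 1 := congrArg Prod.snd hu
  have hline1 : HasDerivAt (fun x : ℝ => ((x, 0) : ℝ × ℝ)) (1, 0) 0 :=
    (hasDerivAt_id 0).prodMk (hasDerivAt_const 0 0)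
  have hline2 : HasDerivAt (fun y : ℝ => ((0, y) : ℝ × ℝ)) (0, 1) 0 :=
    (hasDerivAt_const 0 0).prodMk (hasDerivAt_id 0)
  have hf' := hb'.sub ha'
  have hd1 : (b' - a') (1, 0) = 0 := by
    have h1 : HasDerivAt (fun x : ℝ => b (x, 0) - a (x, 0)) ((b' - a') (1, 0)) 0 :=
      HasFDerivAt.comp_hasDerivAt (f := fun x : ℝ => ((x, 0) : ℝ × ℝ)) (0 : ℝ) hf' hline1
    simp only [hdiag, sub_self] at h1
    exact h1.unique (hasDerivAt_const _ _)
  have hd2 : (b' - a') (0, 1) ≠ 0 := by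
    intro h0
    have h1 : (b' - a') u = u.1 * (b' - a') (1, 0) + u.2 * (b' - a') (0, 1) := by
      rw [← smul_eq_mul, ← smul_eq_mul, ← map_smul, ← map_smul, ← map_add]; simp
    rw [h0, hd1] at h1
    simp [hua, hub] at h1
  set c := (b' - a') (0, 1) with hc
  have hg : HasDerivAt (fun y : ℝ => b (0, y) - a (0, y)) c 0 :=
    HasFDerivAt.comp_hasDerivAt (f := fun y : ℝ => ((0, y) : ℝ × ℝ)) (0 : ℝ) hf' hline2
  -- The sign s of the transverse derivative tells which side of the diagonal is x₂ > 0 on T₁,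
  -- respectively y₂ > 0 on T₂.
  obtain ⟨s, hs, hsc⟩ : ∃ s : ℝ, (s = 1 ∨ s = -1) ∧ 0 < s * c := by
    rcases lt_or_gt_of_ne hd2 with h | h
    · exact ⟨-1, Or.inr rfl, by linarith⟩
    · exact ⟨1, Or.inl rfl, by linarith⟩
  have hslope : ∀ᶠ y in nhdsWithin (0 : ℝ) {0}ᶜ, 0 < s * ((b (0, y) - a (0, y)) / y) := by
    have h1 := (hasDerivAt_iff_tendsto_slope.1 hg).const_mul s
    filter_upwards [h1.eventually (lt_mem_nhds hsc)] with y hy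
    simpa [slope_def_field, hdiag] using hy
  have hsmall : ∀ᶠ y in nhds (0 : ℝ), |s * (b (0, y) - a (0, y))| < 1 := by
    have h1 : ContinuousAt (fun y : ℝ => |s * (b (0, y) - a (0, y))|) 0 :=
      (hg.continuousAt.const_mul s).abs
    exact h1.eventually (gt_mem_nhds (by simp [hdiag]))
  have hsmall' : ∀ᶠ y in nhds (0 : ℝ), |y| < ε :=
    continuous_abs.continuousAt.eventually (gt_mem_nhds (by simpa using hΦ.pos))
  obtain ⟨y₁, hy₁, hy₁', hy₁s, hy₁ε⟩ : ∃ y : ℝ, 0 < y ∧ 0 < s * (b (0, y) - a (0, y)) ∧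
      |s * (b (0, y) - a (0, y))| < 1 ∧ |y| < ε := by
    have h1 : nhdsWithin (0 : ℝ) (Set.Ioi 0) ≤ nhdsWithin 0 {0}ᶜ :=
      nhdsWithin_mono _ fun y hy => ne_of_gt hy
    obtain ⟨y, h2, h3, h4, h5⟩ := ((hslope.filter_mono h1).and
      ((hsmall.filter_mono nhdsWithin_le_nhds).and ((hsmall'.filter_mono nhdsWithin_le_nhds).and
        (self_mem_nhdsWithin (s := Set.Ioi (0 : ℝ)) (a := 0))))).exists
    have h5' : 0 < y := h5
    refine ⟨y, h5', ?_, h3, h4⟩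
    rw [← mul_div_assoc] at h2
    exact (div_pos_iff_of_pos_right h5').1 h2
  obtain ⟨y₂, hy₂, hy₂', hy₂s, hy₂ε⟩ : ∃ y : ℝ, y < 0 ∧ s * (b (0, y) - a (0, y)) < 0 ∧
      |s * (b (0, y) - a (0, y))| < 1 ∧ |y| < ε := by
    have h1 : nhdsWithin (0 : ℝ) (Set.Iio 0) ≤ nhdsWithin 0 {0}ᶜ :=
      nhdsWithin_mono _ fun y hy => ne_of_lt hy
    obtain ⟨y, h2, h3, h4, h5⟩ := ((hslope.filter_mono h1).and
      ((hsmall.filter_mono nhdsWithin_le_nhds).and ((hsmall'.filter_mono nhdsWithin_le_nhds).and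
        (self_mem_nhdsWithin (s := Set.Iio (0 : ℝ)) (a := 0))))).exists
    have h5' : y < 0 := h5
    refine ⟨y, h5', ?_, h3, h4⟩
    rw [← mul_div_assoc] at h2
    by_contra h6
    exact absurd h2 (not_lt.2 (div_nonpos_of_nonneg_of_nonpos (not_lt.1 h6) h5'.le))
  have hfc : ContinuousOn (fun x => s * (b x - a x)) (strip ε) :=
    continuousOn_const.mul (hb.sub ha)
  have hsint : ∀ x ∈ strip ε, ∀ k : ℤ, s * (b x - a x) = k → x.2 = 0 := by
    intro x hx k hk
    rcases hs with rfl | rfl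
    · exact hnoint x hx k (by linarith)
    · exact hnoint x hx (-k) (by push_cast; linarith)
  have hconn1 : IsPreconnected (strip ε ∩ {x | 0 < x.2}) :=
    ((convex_strip ε).inter ((convex_Ioi (0 : ℝ)).linear_preimage
      (LinearMap.snd ℝ ℝ ℝ))).isPreconnected
  have hconn2 : IsPreconnected (strip ε ∩ {x | x.2 < 0}) :=
    ((convex_strip ε).inter ((convex_Iio (0 : ℝ)).linear_preimage
      (LinearMap.snd ℝ ℝ ℝ))).isPreconnected
  -- the degree along the core
  have hshift : ∀ x ∈ strip ε, ((x.1 + 1, x.2) : ℝ × ℝ) ∈ strip ε := fun x hx => hx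
  have hper : ∀ x ∈ strip ε, tor γ r φ (a x, b x) =
      tor γ r φ (a (x.1 + 1, x.2), b (x.1 + 1, x.2)) := by
    intro x hx
    rw [← heq x hx, ← heq _ (hshift x hx), hΦ.inj x hx _ (hshift x hx)]
    exact ⟨⟨1, by simp⟩, rfl⟩
  have hconst : ∀ f : ℝ × ℝ → ℝ, ContinuousOn f (strip ε) →
      (∀ x ∈ strip ε, ∃ k : ℤ, f (x.1 + 1, x.2) = f x + k) →
      ∃ d : ℤ, ∀ x ∈ strip ε, f (x.1 + 1, x.2) = f x + d := by
    intro f hf hk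
    obtain ⟨d, hd⟩ := hk (0, 0) (hΦ.mem_strip_zero 0)
    refine ⟨d, fun x hx => ?_⟩
    have hcomp : ContinuousOn (fun x : ℝ × ℝ => f (x.1 + 1, x.2) - f x) (strip ε) :=
      (hf.comp (f := fun x : ℝ × ℝ => (x.1 + 1, x.2)) (by fun_prop) hshift).sub hf
    have := IsPreconnected.eq_of_int_valued (convex_strip ε).isPreconnected hcomp one_pos
      (fun y hy => by obtain ⟨k, hk⟩ := hk y hy; exact ⟨k, by rw [hk]; ring⟩)
      hx (hΦ.mem_strip_zero 0)
    simp only at this hd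
    linarith
  obtain ⟨d, hd⟩ := hconst a ha fun x hx => ((hγ.tor_eq_iff hr).1 (hper x hx)).1
  obtain ⟨d', hd'⟩ := hconst b hb fun x hx => ((hγ.tor_eq_iff hr).1 (hper x hx)).2
  obtain rfl : d = d' := by
    have h1 := hd _ (hΦ.mem_strip_zero 0)
    have h2 := hd' _ (hΦ.mem_strip_zero 0)
    simp only [hdiag] at h1 h2
    have : (d : ℝ) = d' := by linarith
    exact_mod_cast this
  refine ⟨a, b, d, s, ha, hb, heq, ?_, hd, hd', ?_, hs, ?_, ?_⟩
  · intro x hx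
    obtain ⟨a', b', -, -, hcomp⟩ := hΦ.hasFDerivAt_param hγ hr ha hb heq hx
    refine Submodule.eq_of_le_of_finrank_le ?_ ?_
    · rw [hcomp]
      rintro _ ⟨u, rfl⟩
      exact ⟨(a'.prod b') u, rfl⟩
    · rw [LinearMap.finrank_range_of_inj (hΦ.immersive x hx)]
      exact LinearMap.finrank_range_le _
  · refine degree_eq_one_or_neg_one (α := fun t => a (t, 0)) ?_
      (fun t => hd _ (hΦ.mem_strip_zero t)) ?_
    · exact ha.comp_continuous (by fun_prop) fun t => hΦ.mem_strip_zero t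
    · rintro t u ⟨k, hk⟩
      refine ((hΦ.inj _ (hΦ.mem_strip_zero t) _ (hΦ.mem_strip_zero u)).1 ?_).1
      rw [heq _ (hΦ.mem_strip_zero t), heq _ (hΦ.mem_strip_zero u), hγ.tor_eq_iff hr]
      exact ⟨⟨k, hk⟩, ⟨k, by simpa only [hdiag] using hk⟩⟩
  · intro x hx hx2
    refine IsPreconnected.mem_Ioo_of_ne hconn1 (hfc.mono Set.inter_subset_left)
      (fun y hy h => ?_) (fun y hy h => ?_) (x := (0, y₁)) ⟨hy₁ε, hy₁⟩
      ⟨hy₁', (abs_lt.1 hy₁s).2⟩ ⟨hx, hx2⟩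
    · exact hy.2.ne' (hsint y hy.1 0 (by simpa using h))
    · exact hy.2.ne' (hsint y hy.1 1 (by simpa using h))
  · intro x hx hx2
    have := IsPreconnected.mem_Ioo_of_ne (f := fun x => -(s * (b x - a x))) hconn2
      (hfc.mono Set.inter_subset_left).neg
      (fun y hy h => ?_) (fun y hy h => ?_) (x := (0, y₂)) ⟨hy₂ε, hy₂⟩
      ⟨by simpa using hy₂', by linarith [(abs_lt.1 hy₂s).1]⟩ (y := x) ⟨hx, hx2⟩
    · exact ⟨by linarith [this.2], by linarith [this.1]⟩
    · exact hy.2.ne (hsint y hy.1 0 (by push_cast; linarith))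
    · exact hy.2.ne (hsint y hy.1 (-1) (by push_cast; linarith))

end IsSheet

/-! ### Smoothing arcs -/

namespace IsSmoothingArc

variable {δ : ℝ} {c : ℝ → ℝ × ℝ}

theorem hasDerivAt (hc : IsSmoothingArc δ c) (τ : ℝ) : HasDerivAt c (deriv c τ) τ :=
  (hc.smooth.differentiable (by simp) τ).hasDerivAt

theorem hasDerivAt_fst (hc : IsSmoothingArc δ c) (τ : ℝ) :
    HasDerivAt (fun τ => (c τ).1) (deriv c τ).1 τ :=
  (ContinuousLinearMap.fst ℝ ℝ ℝ).hasFDerivAt.comp_hasDerivAt τ (hc.hasDerivAt τ)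

theorem hasDerivAt_snd (hc : IsSmoothingArc δ c) (τ : ℝ) :
    HasDerivAt (fun τ => (c τ).2) (deriv c τ).2 τ :=
  (ContinuousLinearMap.snd ℝ ℝ ℝ).hasFDerivAt.comp_hasDerivAt τ (hc.hasDerivAt τ)

theorem antitone (hc : IsSmoothingArc δ c) : Antitone fun τ => (c τ).1 :=
  antitone_of_deriv_nonpos (fun τ => (hc.hasDerivAt_fst τ).differentiableAt) fun τ => by
    rw [(hc.hasDerivAt_fst τ).deriv]; exact hc.monotone_fst τ

theorem monotone (hc : IsSmoothingArc δ c) : Monotone fun τ => (c τ).2 :=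
  monotone_of_deriv_nonneg (fun τ => (hc.hasDerivAt_snd τ).differentiableAt) fun τ => by
    rw [(hc.hasDerivAt_snd τ).deriv]; exact hc.monotone_snd τ

theorem speed_pos (hc : IsSmoothingArc δ c) (τ : ℝ) : 0 < (deriv c τ).2 - (deriv c τ).1 := by
  have h1 := hc.monotone_fst τ
  have h2 := hc.monotone_snd τ
  by_contra h
  exact hc.regular τ (Prod.ext (by simp only [Prod.fst_zero]; linarith)
    (by simp only [Prod.snd_zero]; linarith))

theorem injective (hc : IsSmoothingArc δ c) : Function.Injective c := by
  have h : StrictMono fun τ => (c τ).2 - (c τ).1 := by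
    refine strictMono_of_deriv_pos fun τ => ?_
    have h := ((hc.hasDerivAt_snd τ).sub (hc.hasDerivAt_fst τ)).deriv
    rw [show (fun τ => (c τ).2 - (c τ).1) = (fun τ => (c τ).2) - fun τ => (c τ).1 from rfl, h]
    exact hc.speed_pos τ
  intro τ τ' heq
  exact h.injective (by simp only [heq])

theorem fst_nonneg (hc : IsSmoothingArc δ c) (τ : ℝ) : 0 ≤ (c τ).1 := by
  have h := hc.antitone (le_max_left τ δ)
  simp only [hc.outgoing _ (le_max_right τ δ)] at h
  exact h

theorem snd_nonneg (hc : IsSmoothingArc δ c) (τ : ℝ) : 0 ≤ (c τ).2 := by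
  have h := hc.monotone (min_le_left τ (-δ))
  simp only [hc.incoming _ (min_le_right τ (-δ))] at h
  exact h

theorem deriv_snd_eq_zero (hc : IsSmoothingArc δ c) {τ : ℝ} (h : (c τ).2 = 0) :
    (deriv c τ).2 = 0 := by
  have hl : IsLocalMin (fun τ => (c τ).2) τ :=
    Filter.Eventually.of_forall fun u => by simp only [h]; exact hc.snd_nonneg u
  exact hl.hasDerivAt_eq_zero (hc.hasDerivAt_snd τ)

theorem deriv_fst_eq_zero (hc : IsSmoothingArc δ c) {τ : ℝ} (h : (c τ).1 = 0) :
    (deriv c τ).1 = 0 := by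
  have hl : IsLocalMin (fun τ => (c τ).1) τ :=
    Filter.Eventually.of_forall fun u => by simp only [h]; exact hc.fst_nonneg u
  exact hl.hasDerivAt_eq_zero (hc.hasDerivAt_fst τ)

/-- At the origin both coordinates would be minimal and the velocity would vanish. Thus the label y
/ (x + y) has a nonzero denominator. -/
theorem add_pos (hc : IsSmoothingArc δ c) (τ : ℝ) : 0 < (c τ).1 + (c τ).2 := by
  have h1 := hc.fst_nonneg τ
  have h2 := hc.snd_nonneg τ
  by_contra h
  have h3 := hc.deriv_fst_eq_zero (τ := τ) (by linarith)
  have h4 := hc.deriv_snd_eq_zero (τ := τ) (by linarith)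
  have := hc.speed_pos τ
  linarith

theorem bounds (hc : IsSmoothingArc δ c) {η τ : ℝ} (hδ : δ ≤ η) (hτ : |τ| ≤ η) :
    (c τ).1 ≤ η ∧ (c τ).2 ≤ η := by
  have h1 := hc.antitone (abs_le.1 hτ).1
  have h2 := hc.monotone (abs_le.1 hτ).2
  simp only [hc.incoming (-η) (by linarith), hc.outgoing η hδ] at h1 h2
  exact ⟨by linarith, h2⟩

theorem abs_lt (hc : IsSmoothingArc δ c) {ε τ : ℝ} (hδ : δ < ε) (hτ : |τ| < ε) :
    |(c τ).1| < ε ∧ |(c τ).2| < ε := by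
  have h := hc.bounds (le_max_left δ |τ|) (le_max_right δ |τ|)
  rw [abs_of_nonneg (hc.fst_nonneg τ), abs_of_nonneg (hc.snd_nonneg τ)]
  exact ⟨h.1.trans_lt (max_lt hδ hτ), h.2.trans_lt (max_lt hδ hτ)⟩

theorem label_eq_zero (hc : IsSmoothingArc δ c) {τ : ℝ} :
    (c τ).2 / ((c τ).1 + (c τ).2) = 0 ↔ (c τ).2 = 0 := by
  rw [div_eq_zero_iff]
  exact or_iff_left (hc.add_pos τ).ne'

theorem label_eq_one (hc : IsSmoothingArc δ c) {τ : ℝ} :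
    (c τ).2 / ((c τ).1 + (c τ).2) = 1 ↔ (c τ).1 = 0 := by
  rw [div_eq_one_iff_eq (hc.add_pos τ).ne']
  constructor <;> intro h <;> linarith

end IsSmoothingArc

/-! ### The frame of the adapted chart along the slice `y₁ = 0` -/

/-- By Lagrange's identity the product is |e|²⟨u, v⟩ - ⟨u, e⟩⟨e, v⟩, and the two hypotheses make the
last term real. -/
theorem im_conj_det2_mul_det2 {e u v : C2} (hu : omega u e = 0) (hv : omega e v = 0) :
    ((starRingEnd ℂ) (det2 e u) * det2 e v).im = (‖e.1‖ ^ 2 + ‖e.2‖ ^ 2) * omega u v := by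
  have h : (starRingEnd ℂ) (det2 e u) * det2 e v =
      ((‖e.1‖ ^ 2 + ‖e.2‖ ^ 2 : ℝ) : ℂ) *
        ((starRingEnd ℂ) u.1 * v.1 + (starRingEnd ℂ) u.2 * v.2) -
      ((starRingEnd ℂ) u.1 * e.1 + (starRingEnd ℂ) u.2 * e.2) *
        ((starRingEnd ℂ) e.1 * v.1 + (starRingEnd ℂ) e.2 * v.2) := by
    simp only [det2, map_sub, map_mul]
    push_cast
    rw [← Complex.mul_conj', ← Complex.mul_conj']
    ring
  unfold omega at *
  rw [h, Complex.sub_im, Complex.im_ofReal_mul, Complex.mul_im, hu, hv]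
  ring

theorem det2_combination_right (e u v : C2) (p q : ℝ) :
    det2 e (p • u + q • v) = p * det2 e u + q * det2 e v := by
  simp only [det2, Prod.fst_add, Prod.snd_add, Prod.smul_fst, Prod.smul_snd, Complex.real_smul]
  ring

theorem span_pair_smul {u v : C2} {a : ℝ} (ha : a ≠ 0) :
    Submodule.span ℝ {u, a • v} = Submodule.span ℝ {u, v} := by
  rw [Submodule.span_insert, Submodule.span_insert, Submodule.span_singleton_smul_eq ha.isUnit]

theorem isOpen_openBox (ε : ℝ) : IsOpen (openBox ε) := by
  have h1 : IsOpen {p : Coord | |p.2.1| < ε} := isOpen_lt (by fun_prop) continuous_const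
  have h2 : IsOpen {p : Coord | |p.2.2.1| < ε} := isOpen_lt (by fun_prop) continuous_const
  have h3 : IsOpen {p : Coord | |p.2.2.2| < ε} := isOpen_lt (by fun_prop) continuous_const
  exact h1.inter (h2.inter h3)

/-- The points `(x₁, x₂, y₂)` of the slice `y₁ = 0` of the box of size `ε`. -/
def sliceBox (ε : ℝ) : Set (ℝ × ℝ × ℝ) := {m | |m.2.1| < ε ∧ |m.2.2| < ε}

theorem isOpen_sliceBox (ε : ℝ) : IsOpen (sliceBox ε) := by
  have h1 : IsOpen {m : ℝ × ℝ × ℝ | |m.2.1| < ε} := isOpen_lt (by fun_prop) continuous_const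
  have h2 : IsOpen {m : ℝ × ℝ × ℝ | |m.2.2| < ε} := isOpen_lt (by fun_prop) continuous_const
  exact h1.inter h2

theorem convex_sliceBox (ε : ℝ) : Convex ℝ (sliceBox ε) := by
  have h : sliceBox ε = (Set.univ : Set ℝ) ×ˢ (Set.Ioo (-ε) ε ×ˢ Set.Ioo (-ε) ε) := by
    ext m; simp [sliceBox, abs_lt]
  rw [h]
  exact convex_univ.prod ((convex_Ioo _ _).prod (convex_Ioo _ _))

/-- The point `(x₁, 0, x₂, y₂)`. -/
def slice (m : ℝ × ℝ × ℝ) : Coord := (m.1, 0, m.2.1, m.2.2)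

theorem continuous_slice : Continuous slice := by unfold slice; fun_prop

namespace Smoothing

variable {γ : ℝ → ℂ} {s t φ : ℝ} (D : Smoothing γ s t φ)

theorem ε_pos : 0 < D.ε := D.δ_pos.trans D.δ_lt

theorem slice_mem {m : ℝ × ℝ × ℝ} (hm : m ∈ sliceBox D.ε) : slice m ∈ openBox D.ε :=
  ⟨by simpa [slice] using D.ε_pos, hm⟩

theorem differentiableAt_Ψ {p : Coord} (hp : p ∈ openBox D.ε) : DifferentiableAt ℝ D.Ψ p :=
  (D.chart.smooth.contDiffAt ((isOpen_openBox _).mem_nhds hp)).differentiableAt (by simp)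

theorem continuousOn_fderiv_Ψ : ContinuousOn (fderiv ℝ D.Ψ) (openBox D.ε) :=
  D.chart.smooth.continuousOn_fderiv_of_isOpen (isOpen_openBox _) (by simp)

/-- The pullback of `omega` is nondegenerate. -/
theorem injective_fderiv_Ψ {p : Coord} (hp : p ∈ openBox D.ε) :
    Function.Injective (fderiv ℝ D.Ψ p) := by
  rw [injective_iff_map_eq_zero]
  intro u hu
  have h := D.chart.symplectic p hp u
  simp only [hu] at h
  have hz : ∀ q, omega 0 q = 0 := fun q => by simp [omega]
  simp only [hz] at h
  have h1 := h (1, 0, 0, 0)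
  have h2 := h (0, 1, 0, 0)
  have h3 := h (0, 0, 1, 0)
  have h4 := h (0, 0, 0, 1)
  simp at h1 h2 h3 h4
  exact Prod.ext h2.symm (Prod.ext h1 (Prod.ext h4.symm h3))

/-- The first vector `∂Ψ/∂x₁` of the frame. -/
noncomputable def e₁ (m : ℝ × ℝ × ℝ) : C2 := fderiv ℝ D.Ψ (slice m) (1, 0, 0, 0)

/-- The vector `∂Ψ/∂x₂` of the frame. -/
noncomputable def e₃ (m : ℝ × ℝ × ℝ) : C2 := fderiv ℝ D.Ψ (slice m) (0, 0, 1, 0)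

/-- The vector `∂Ψ/∂y₂` of the frame. -/
noncomputable def e₄ (m : ℝ × ℝ × ℝ) : C2 := fderiv ℝ D.Ψ (slice m) (0, 0, 0, 1)

theorem fderiv_slice (m : ℝ × ℝ × ℝ) (p q : ℝ) :
    fderiv ℝ D.Ψ (slice m) (0, 0, p, q) = p • D.e₃ m + q • D.e₄ m := by
  rw [e₃, e₄, ← map_smul, ← map_smul, ← map_add]; simp

/-- The determinant of the plane spanned by `∂Ψ/∂x₁` and `∂Ψ/∂x₂`. -/
noncomputable def det₃ (m : ℝ × ℝ × ℝ) : ℂ := det2 (D.e₁ m) (D.e₃ m)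

/-- The ratio of the determinants of the planes spanned by `∂Ψ/∂x₁` and `∂Ψ/∂y₂`, respectively
`∂Ψ/∂x₂`. -/
noncomputable def ratio (m : ℝ × ℝ × ℝ) : ℂ := det2 (D.e₁ m) (D.e₄ m) / D.det₃ m

variable {m : ℝ × ℝ × ℝ}

theorem omega_e₁_e₃ (hm : m ∈ sliceBox D.ε) : omega (D.e₁ m) (D.e₃ m) = 0 := by
  rw [e₁, e₃, D.chart.symplectic _ (D.slice_mem hm)]; simp

theorem omega_e₁_e₄ (hm : m ∈ sliceBox D.ε) : omega (D.e₁ m) (D.e₄ m) = 0 := by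
  rw [e₁, e₄, D.chart.symplectic _ (D.slice_mem hm)]; simp

theorem omega_e₃_e₄ (hm : m ∈ sliceBox D.ε) : omega (D.e₃ m) (D.e₄ m) = 1 := by
  rw [e₃, e₄, D.chart.symplectic _ (D.slice_mem hm)]; simp

theorem im_conj_det_pos (hm : m ∈ sliceBox D.ε) :
    0 < ((starRingEnd ℂ) (D.det₃ m) * det2 (D.e₁ m) (D.e₄ m)).im := by
  rw [det₃, im_conj_det2_mul_det2 (by rw [omega_swap, D.omega_e₁_e₃ hm, neg_zero])
    (D.omega_e₁_e₄ hm), D.omega_e₃_e₄ hm, mul_one]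
  have hne : D.e₁ m ≠ 0 := by
    intro h
    have := D.injective_fderiv_Ψ (D.slice_mem hm) (h.trans (map_zero _).symm)
    simp at this
  by_contra h
  have h1 := sq_nonneg ‖(D.e₁ m).1‖
  have h2 := sq_nonneg ‖(D.e₁ m).2‖
  refine hne (Prod.ext ?_ ?_)
  · exact norm_eq_zero.1 (pow_eq_zero_iff two_ne_zero |>.1 (by linarith))
  · exact norm_eq_zero.1 (pow_eq_zero_iff two_ne_zero |>.1 (by linarith))

theorem det₃_ne_zero (hm : m ∈ sliceBox D.ε) : D.det₃ m ≠ 0 := by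
  intro h
  have := D.im_conj_det_pos hm
  simp [h] at this

theorem det2_e₁_e₄ (hm : m ∈ sliceBox D.ε) :
    det2 (D.e₁ m) (D.e₄ m) = D.det₃ m * D.ratio m := by
  rw [ratio, mul_div_cancel₀ _ (D.det₃_ne_zero hm)]

/-- Positivity comes from ω(∂/∂x₂, ∂/∂y₂) = 1. It fixes the sense in which the plane turns from the
T₁ direction to the T₂ direction, uniformly over the slice. -/
theorem ratio_im_pos (hm : m ∈ sliceBox D.ε) : 0 < (D.ratio m).im := by
  have h := D.im_conj_det_pos hm
  rw [D.det2_e₁_e₄ hm, ← mul_assoc, mul_comm _ (D.det₃ m), Complex.mul_conj,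
    Complex.im_ofReal_mul] at h
  exact pos_of_mul_pos_right h (Complex.normSq_nonneg _)

theorem continuousOn_frame (v : Coord) :
    ContinuousOn (fun m => fderiv ℝ D.Ψ (slice m) v) (sliceBox D.ε) :=
  (D.continuousOn_fderiv_Ψ.comp continuous_slice.continuousOn fun _ hm =>
    D.slice_mem hm).clm_apply continuousOn_const

theorem continuousOn_det2_frame (u v : Coord) : ContinuousOn
    (fun m => det2 (fderiv ℝ D.Ψ (slice m) u) (fderiv ℝ D.Ψ (slice m) v)) (sliceBox D.ε) := by
  have hu := D.continuousOn_frame u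
  have hv := D.continuousOn_frame v
  unfold det2
  exact (hu.fst.mul hv.snd).sub (hu.snd.mul hv.fst)

theorem continuousOn_det₃ : ContinuousOn D.det₃ (sliceBox D.ε) := D.continuousOn_det2_frame _ _

theorem continuousOn_ratio : ContinuousOn D.ratio (sliceBox D.ε) :=
  (D.continuousOn_det2_frame _ _).div D.continuousOn_det₃ fun _ hm => D.det₃_ne_zero hm

theorem fderiv_Ψ_add_one {p : Coord} (hp : p ∈ openBox D.ε) :
    fderiv ℝ D.Ψ (p + (1, 0, 0, 0)) = fderiv ℝ D.Ψ p := by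
  rw [← fderiv_comp_add_right]
  refine Filter.EventuallyEq.fderiv_eq ?_
  filter_upwards [(isOpen_openBox D.ε).mem_nhds hp] with q hq
  have hq' : q + (1, 0, 0, 0) ∈ openBox D.ε := by simpa [openBox] using hq
  exact ((D.chart.injective q hq _ hq').2 ⟨⟨1, by simp⟩, by simp⟩).symm

theorem frame_add_one (hm : m ∈ sliceBox D.ε) :
    fderiv ℝ D.Ψ (slice (m.1 + 1, m.2)) = fderiv ℝ D.Ψ (slice m) := by
  rw [← D.fderiv_Ψ_add_one (D.slice_mem hm)]
  congr 1
  simp [slice]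

/-- A nonzero vector `p ∂/∂x₂ + q ∂/∂y₂` gives, together with `∂/∂x₁`, a Lagrangian plane. -/
theorem combination_ne_zero (hm : m ∈ sliceBox D.ε) {p q : ℝ} (h : p ≠ 0 ∨ q ≠ 0) :
    (p : ℂ) + q * D.ratio m ≠ 0 := by
  intro h0
  have h1 := congrArg Complex.im h0
  simp only [Complex.add_im, Complex.ofReal_im, Complex.im_ofReal_mul, Complex.zero_im,
    zero_add] at h1
  have hq : q = 0 := (mul_eq_zero.1 h1).resolve_right (D.ratio_im_pos hm).ne'
  rw [hq, Complex.ofReal_zero, zero_mul, add_zero, Complex.ofReal_eq_zero] at h0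
  tauto

theorem det2_combination_frame (hm : m ∈ sliceBox D.ε) (p q : ℝ) :
    det2 (D.e₁ m) (p • D.e₃ m + q • D.e₄ m) = D.det₃ m * (p + q * D.ratio m) := by
  rw [det2_combination_right, D.det2_e₁_e₄ hm, det₃]; ring

theorem isLagrangian_frame (hm : m ∈ sliceBox D.ε) {p q : ℝ} (h : p ≠ 0 ∨ q ≠ 0) :
    IsLagrangian (Submodule.span ℝ {D.e₁ m, p • D.e₃ m + q • D.e₄ m}) := by
  refine isLagrangian_span ?_ ?_
  · rw [D.det2_combination_frame hm]
    exact mul_ne_zero (D.det₃_ne_zero hm) (D.combination_ne_zero hm h)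
  · rw [omega_add_right, omega_smul_right, omega_smul_right, D.omega_e₁_e₃ hm, D.omega_e₁_e₄ hm]
    ring

/-- The real factor r does not change the plane; it is free so that the principal argument can be
taken away from its discontinuity. -/
theorem hasPhase_frame (hm : m ∈ sliceBox D.ε) {p q : ℝ} (h : p ≠ 0 ∨ q ≠ 0) {r θ : ℝ}
    (hr : r ≠ 0) (hθ : D.det₃ m = ‖D.det₃ m‖ * cis θ) :
    HasPhase (Submodule.span ℝ {D.e₁ m, p • D.e₃ m + q • D.e₄ m})
      (2 * (θ + (r * (p + q * D.ratio m) : ℂ).arg)) := by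
  have h0 : (r * (p + q * D.ratio m) : ℂ) ≠ 0 :=
    mul_ne_zero (by exact_mod_cast hr) (D.combination_ne_zero hm h)
  refine hasPhase_span (r := r⁻¹ * (‖D.det₃ m‖ * ‖(r * (p + q * D.ratio m) : ℂ)‖)) ?_ ?_
  · exact mul_ne_zero (inv_ne_zero hr) (mul_ne_zero (norm_ne_zero_iff.2 (D.det₃_ne_zero hm))
      (norm_ne_zero_iff.2 h0))
  · have h1 := cis_arg (z := (r * (p + q * D.ratio m) : ℂ))
    have h2 : (p + q * D.ratio m : ℂ) = (r : ℂ)⁻¹ * (r * (p + q * D.ratio m) : ℂ) := by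
      rw [inv_mul_cancel_left₀]; exact_mod_cast hr
    have h3 : D.det₃ m * (p + q * D.ratio m) = ‖D.det₃ m‖ * cis θ * ((r : ℂ)⁻¹ *
        (‖(r * (p + q * D.ratio m) : ℂ)‖ * cis (r * (p + q * D.ratio m) : ℂ).arg)) := by
      rw [← hθ, ← h1, ← h2]
    rw [D.det2_combination_frame hm, cis_add, h3]
    push_cast
    generalize (r * (p + q * D.ratio m) : ℂ) = w
    ring

end Smoothing

namespace Smoothing

variable {γ : ℝ → ℂ} {s t φ : ℝ} (D : Smoothing γ s t φ)

/-! ### The two sheets and the necks in the adapted chart -/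

/-- The sheet `T₁ ∩ N`. -/
noncomputable def sheet₁ (x : ℝ × ℝ) : C2 := D.Ψ (slice (x.1, x.2, 0))

/-- The sheet `T₂ ∩ N`. -/
noncomputable def sheet₂ (x : ℝ × ℝ) : C2 := D.Ψ (slice (x.1, 0, x.2))

theorem mem_sliceBox₁ {x : ℝ × ℝ} (hx : x ∈ strip D.ε) : (x.1, x.2, 0) ∈ sliceBox D.ε :=
  ⟨hx, by simpa using D.ε_pos⟩

theorem mem_sliceBox₂ {x : ℝ × ℝ} (hx : x ∈ strip D.ε) : (x.1, 0, x.2) ∈ sliceBox D.ε :=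
  ⟨by simpa using D.ε_pos, hx⟩

theorem Ψ_slice_eq_iff {m m' : ℝ × ℝ × ℝ} (hm : m ∈ sliceBox D.ε) (hm' : m' ∈ sliceBox D.ε) :
    D.Ψ (slice m) = D.Ψ (slice m') ↔ (∃ k : ℤ, m'.1 = m.1 + k) ∧ m'.2 = m.2 := by
  rw [D.chart.injective _ (D.slice_mem hm) _ (D.slice_mem hm')]
  refine and_congr Iff.rfl ?_
  simp [slice, Prod.ext_iff]

theorem hasFDerivAt_comp_slice {f : ℝ × ℝ → ℝ × ℝ × ℝ} {p q : ℝ} {x : ℝ × ℝ}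
    {f₂ f₃ : ℝ × ℝ →L[ℝ] ℝ} (hm : f x ∈ sliceBox D.ε) (h1 : ∀ y, (f y).1 = y.1)
    (h2 : HasFDerivAt (fun y => (f y).2.1) f₂ x) (h3 : HasFDerivAt (fun y => (f y).2.2) f₃ x)
    (hf2 : f₂ = p • ContinuousLinearMap.snd ℝ ℝ ℝ) (hf3 : f₃ = q • ContinuousLinearMap.snd ℝ ℝ ℝ) :
    ∃ A : ℝ × ℝ →L[ℝ] C2, HasFDerivAt (fun y => D.Ψ (slice (f y))) A x ∧
      A (1, 0) = D.e₁ (f x) ∧ A (0, 1) = p • D.e₃ (f x) + q • D.e₄ (f x) := by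
  have hs : HasFDerivAt (fun y => slice (f y))
      ((ContinuousLinearMap.fst ℝ ℝ ℝ).prod ((0 : ℝ × ℝ →L[ℝ] ℝ).prod (f₂.prod f₃))) x := by
    simp only [slice, h1]
    exact hasFDerivAt_fst.prodMk ((hasFDerivAt_const _ _).prodMk (h2.prodMk h3))
  refine ⟨_, (D.differentiableAt_Ψ (D.slice_mem hm)).hasFDerivAt.comp x hs, ?_, ?_⟩
  · simp [hf2, hf3, e₁]
  · rw [← D.fderiv_slice]; simp [hf2, hf3]

theorem hasFDerivAt_sheet₁ {x : ℝ × ℝ} (hx : x ∈ strip D.ε) :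
    ∃ A : ℝ × ℝ →L[ℝ] C2, HasFDerivAt D.sheet₁ A x ∧ A (1, 0) = D.e₁ (x.1, x.2, 0) ∧
      A (0, 1) = (1 : ℝ) • D.e₃ (x.1, x.2, 0) + (0 : ℝ) • D.e₄ (x.1, x.2, 0) :=
  D.hasFDerivAt_comp_slice (f := fun y => (y.1, y.2, 0)) (D.mem_sliceBox₁ hx) (fun _ => rfl)
    hasFDerivAt_snd (hasFDerivAt_const _ _) (by simp) (by simp)

theorem hasFDerivAt_sheet₂ {x : ℝ × ℝ} (hx : x ∈ strip D.ε) :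
    ∃ A : ℝ × ℝ →L[ℝ] C2, HasFDerivAt D.sheet₂ A x ∧ A (1, 0) = D.e₁ (x.1, 0, x.2) ∧
      A (0, 1) = (0 : ℝ) • D.e₃ (x.1, 0, x.2) + (1 : ℝ) • D.e₄ (x.1, 0, x.2) :=
  D.hasFDerivAt_comp_slice (f := fun y => (y.1, 0, y.2)) (D.mem_sliceBox₂ hx) (fun _ => rfl)
    (hasFDerivAt_const _ _) hasFDerivAt_snd (by simp) (by simp)

theorem range_fderiv_sheet₁ {x : ℝ × ℝ} (hx : x ∈ strip D.ε) :
    LinearMap.range (fderiv ℝ D.sheet₁ x).toLinearMap = Submodule.span ℝ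
      {D.e₁ (x.1, x.2, 0), (1 : ℝ) • D.e₃ (x.1, x.2, 0) + (0 : ℝ) • D.e₄ (x.1, x.2, 0)} := by
  obtain ⟨A, hA, h1, h2⟩ := D.hasFDerivAt_sheet₁ hx
  rw [hA.fderiv, range_eq_span, h1, h2]

theorem range_fderiv_sheet₂ {x : ℝ × ℝ} (hx : x ∈ strip D.ε) :
    LinearMap.range (fderiv ℝ D.sheet₂ x).toLinearMap = Submodule.span ℝ
      {D.e₁ (x.1, 0, x.2), (0 : ℝ) • D.e₃ (x.1, 0, x.2) + (1 : ℝ) • D.e₄ (x.1, 0, x.2)} := by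
  obtain ⟨A, hA, h1, h2⟩ := D.hasFDerivAt_sheet₂ hx
  rw [hA.fderiv, range_eq_span, h1, h2]

theorem apply_eq_fderiv {m : ℝ × ℝ × ℝ} {A : ℝ × ℝ →L[ℝ] C2} {p q : ℝ} (h1 : A (1, 0) = D.e₁ m)
    (h2 : A (0, 1) = p • D.e₃ m + q • D.e₄ m) (u : ℝ × ℝ) :
    A u = fderiv ℝ D.Ψ (slice m) (u.1, 0, u.2 * p, u.2 * q) := by
  have hu : u = u.1 • ((1, 0) : ℝ × ℝ) + u.2 • ((0, 1) : ℝ × ℝ) := by simp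
  have hv : ((u.1, 0, u.2 * p, u.2 * q) : Coord) = u.1 • ((1, 0, 0, 0) : Coord) +
    u.2 • ((0, 0, p, q) : Coord) := by simp
  rw [hv, map_add, map_smul, map_smul, D.fderiv_slice, ← h2, ← e₁, ← h1]
  conv_lhs => rw [hu, map_add, map_smul, map_smul]

theorem isSheet₁ : IsSheet γ s φ D.ε D.sheet₁ where
  pos := D.ε_pos
  differentiable x hx := by
    obtain ⟨A, hA, -⟩ := D.hasFDerivAt_sheet₁ hx
    exact hA.differentiableAt
  immersive x hx := by
    obtain ⟨A, hA, h1, h2⟩ := D.hasFDerivAt_sheet₁ hx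
    rw [hA.fderiv, injective_iff_map_eq_zero]
    intro u hu
    rw [D.apply_eq_fderiv h1 h2] at hu
    have := D.injective_fderiv_Ψ (D.slice_mem (D.mem_sliceBox₁ hx)) (hu.trans (map_zero _).symm)
    simpa [Prod.ext_iff] using this
  mem x hx := by
    rw [← torus1_eq]
    exact (D.chart.mem_torus1 _ (D.slice_mem (D.mem_sliceBox₁ hx))).2 ⟨rfl, rfl⟩
  inj x hx y hy := by
    refine (D.Ψ_slice_eq_iff (D.mem_sliceBox₁ hx) (D.mem_sliceBox₁ hy)).trans ?_
    simp
  core := D.chart.core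

theorem isSheet₂ : IsSheet γ t 0 D.ε D.sheet₂ where
  pos := D.ε_pos
  differentiable x hx := by
    obtain ⟨A, hA, -⟩ := D.hasFDerivAt_sheet₂ hx
    exact hA.differentiableAt
  immersive x hx := by
    obtain ⟨A, hA, h1, h2⟩ := D.hasFDerivAt_sheet₂ hx
    rw [hA.fderiv, injective_iff_map_eq_zero]
    intro u hu
    rw [D.apply_eq_fderiv h1 h2] at hu
    have := D.injective_fderiv_Ψ (D.slice_mem (D.mem_sliceBox₂ hx)) (hu.trans (map_zero _).symm)
    simpa [Prod.ext_iff] using this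
  mem x hx := by
    rw [← torus2_eq]
    exact (D.chart.mem_torus2 _ (D.slice_mem (D.mem_sliceBox₂ hx))).2 ⟨rfl, rfl⟩
  inj x hx y hy := by
    refine (D.Ψ_slice_eq_iff (D.mem_sliceBox₂ hx) (D.mem_sliceBox₂ hy)).trans ?_
    simp
  core := D.chart.core

/-- The coordinates `(x₁, x₂, y₂)` of a point of a neck. -/
noncomputable def neckSlice (κ : ℝ) (c : ℝ → ℝ × ℝ) (x : ℝ × ℝ) : ℝ × ℝ × ℝ :=
  (x.1, κ * (c x.2).1, κ * (D.σ * (c x.2).2))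

theorem neck_map (κ : ℝ) (c : ℝ → ℝ × ℝ) (x : ℝ × ℝ) : (D.neck κ c).map x =
    (D.Ψ (slice (D.neckSlice κ c x)), (c x.2).2 / ((c x.2).1 + (c x.2).2)) := rfl

/-- The tangent plane of a neck. -/
noncomputable def neckPlane (κ : ℝ) (c : ℝ → ℝ × ℝ) (x : ℝ × ℝ) : Submodule ℝ C2 :=
  Submodule.span ℝ {D.e₁ (D.neckSlice κ c x),
    (κ * (deriv c x.2).1) • D.e₃ (D.neckSlice κ c x) +
      (κ * (D.σ * (deriv c x.2).2)) • D.e₄ (D.neckSlice κ c x)}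

theorem abs_sign {κ : ℝ} (hκ : κ = 1 ∨ κ = -1) : |κ| = 1 := by
  rcases hκ with rfl | rfl <;> simp

theorem sign_mul_self {κ : ℝ} (hκ : κ = 1 ∨ κ = -1) : κ * κ = 1 := by
  rcases hκ with rfl | rfl <;> simp

theorem sign_ne_zero {κ : ℝ} (hκ : κ = 1 ∨ κ = -1) : κ ≠ 0 := by
  rcases hκ with rfl | rfl <;> simp

section

variable {κ : ℝ} (hκ : κ = 1 ∨ κ = -1) {c : ℝ → ℝ × ℝ} (hc : IsSmoothingArc D.δ c)
include hκ hc

theorem neckSlice_mem {x : ℝ × ℝ} (hx : |x.2| < D.ε) : D.neckSlice κ c x ∈ sliceBox D.ε := by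
  have h := hc.abs_lt D.δ_lt hx
  simpa [sliceBox, neckSlice, abs_mul, abs_sign hκ, abs_sign D.σ_sign] using h

theorem range_fderiv_neck {x : ℝ × ℝ} (hx : |x.2| < D.ε) :
    LinearMap.range (fderiv ℝ (fun y => ((D.neck κ c).map y).1) x).toLinearMap =
      D.neckPlane κ c x := by
  have h0 : HasFDerivAt (Prod.snd : ℝ × ℝ → ℝ) (ContinuousLinearMap.snd ℝ ℝ ℝ) x :=
    hasFDerivAt_snd
  have h1 := (hc.hasDerivAt_fst x.2).comp_hasFDerivAt x h0
  have h2 := (hc.hasDerivAt_snd x.2).comp_hasFDerivAt x h0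
  obtain ⟨A, hA, hA1, hA2⟩ := D.hasFDerivAt_comp_slice (f := D.neckSlice κ c)
    (D.neckSlice_mem hκ hc hx) (fun _ => rfl) (h1.const_mul κ) ((h2.const_mul D.σ).const_mul κ)
    (p := κ * (deriv c x.2).1) (q := κ * (D.σ * (deriv c x.2).2))
    (by rw [smul_smul]) (by rw [smul_smul, smul_smul, mul_assoc])
  have hA' : HasFDerivAt (fun y => ((D.neck κ c).map y).1) A x := hA
  rw [hA'.fderiv, range_eq_span, hA1, hA2, neckPlane]

theorem neck_direction_ne_zero (τ : ℝ) :
    κ * (deriv c τ).1 ≠ 0 ∨ κ * (D.σ * (deriv c τ).2) ≠ 0 := by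
  have h := hc.speed_pos τ
  by_contra! h'
  have h1 := (mul_eq_zero.1 h'.1).resolve_left (sign_ne_zero hκ)
  have h2 := (mul_eq_zero.1 ((mul_eq_zero.1 h'.2).resolve_left (sign_ne_zero hκ))).resolve_left
    (sign_ne_zero D.σ_sign)
  linarith

theorem neckPlane_of_snd_eq_zero {x : ℝ × ℝ} (hx : |x.2| < D.ε) (h : (c x.2).2 = 0) :
    (x.1, κ * (c x.2).1) ∈ strip D.ε ∧
      D.neckSlice κ c x = (x.1, κ * (c x.2).1, 0) ∧
      D.neckPlane κ c x =
        LinearMap.range (fderiv ℝ D.sheet₁ (x.1, κ * (c x.2).1)).toLinearMap := by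
  have hm := D.neckSlice_mem hκ hc hx
  have he : D.neckSlice κ c x = (x.1, κ * (c x.2).1, 0) := by simp [neckSlice, h]
  have hs : (x.1, κ * (c x.2).1) ∈ strip D.ε := hm.1
  refine ⟨hs, he, ?_⟩
  have h0 := hc.deriv_snd_eq_zero h
  have h1 := hc.speed_pos x.2
  rw [D.range_fderiv_sheet₁ hs, neckPlane, he, h0, one_smul, mul_zero, mul_zero, zero_smul,
    add_zero, add_zero, span_pair_smul (mul_ne_zero (sign_ne_zero hκ) (by linarith))]

theorem neckPlane_of_fst_eq_zero {x : ℝ × ℝ} (hx : |x.2| < D.ε) (h : (c x.2).1 = 0) :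
    (x.1, κ * (D.σ * (c x.2).2)) ∈ strip D.ε ∧
      D.neckSlice κ c x = (x.1, 0, κ * (D.σ * (c x.2).2)) ∧
      D.neckPlane κ c x =
        LinearMap.range (fderiv ℝ D.sheet₂ (x.1, κ * (D.σ * (c x.2).2))).toLinearMap := by
  have hm := D.neckSlice_mem hκ hc hx
  have he : D.neckSlice κ c x = (x.1, 0, κ * (D.σ * (c x.2).2)) := by simp [neckSlice, h]
  have hs : (x.1, κ * (D.σ * (c x.2).2)) ∈ strip D.ε := hm.2
  refine ⟨hs, he, ?_⟩
  have h0 := hc.deriv_fst_eq_zero h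
  have h1 := hc.speed_pos x.2
  rw [D.range_fderiv_sheet₂ hs, neckPlane, he, h0, one_smul, mul_zero, zero_smul,
    zero_add, zero_add, span_pair_smul (mul_ne_zero (sign_ne_zero hκ)
      (mul_ne_zero (sign_ne_zero D.σ_sign) (by linarith)))]

end

/-! ### Branches of the phase -/

/-- Continuous choices of the arguments of the tangents of `γ`, of the frame in the adapted chart
and of the sheets, from which the phase of the tangent planes is computed. -/
structure Branch where
  ϑ : ℝ → ℝ
  n : ℤ
  ϑ_cont : Continuous ϑ
  n_sign : n = 1 ∨ n = -1
  ϑ_eq : ∀ a, deriv γ a = ‖deriv γ a‖ * cis (ϑ a)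
  ϑ_shift : ∀ a, ϑ (a + 1) = ϑ a + 2 * Real.pi * n
  θ : ℝ × ℝ × ℝ → ℝ
  θ_cont : ContinuousOn θ (sliceBox D.ε)
  θ_eq : ∀ m ∈ sliceBox D.ε, D.det₃ m = ‖D.det₃ m‖ * cis (θ m)
  a₁ : ℝ × ℝ → ℝ
  b₁ : ℝ × ℝ → ℝ
  d₁ : ℤ
  s₁ : ℝ
  lift₁ : IsSheetLift γ s φ D.ε D.sheet₁ a₁ b₁ d₁ s₁
  a₂ : ℝ × ℝ → ℝ
  b₂ : ℝ × ℝ → ℝ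
  d₂ : ℤ
  s₂ : ℝ
  lift₂ : IsSheetLift γ t 0 D.ε D.sheet₂ a₂ b₂ d₂ s₂
  k₁ : ℤ
  θ_sheet₁ : ∀ x ∈ strip D.ε, θ (x.1, x.2, 0) = φ + ϑ (a₁ x) + ϑ (b₁ x) + Real.pi * k₁
  k₂ : ℤ
  θ_sheet₂ : ∀ x ∈ strip D.ε, θ (x.1, 0, x.2) + (-(D.σ * D.ratio (x.1, 0, x.2)) : ℂ).arg =
    0 + ϑ (a₂ x) + ϑ (b₂ x) + Real.pi * k₂

theorem slitPlane_of_im_ne_zero {z : ℂ} (h : z.im ≠ 0) : z ∈ Complex.slitPlane := Or.inr h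

/-- On each sheet the frame and the torus parametrization compute the phase of the same planes, so
half of the difference of these phases is a continuous function with values in πℤ, hence constant.
-/
theorem nonempty_branch (hγ : IsSmoothJordan γ) (hs : s ∈ Set.Ioo (0 : ℝ) 1)
    (ht : t ∈ Set.Ioo (0 : ℝ) 1) : Nonempty D.Branch := by
  obtain ⟨ϑ, n, hϑc, hn, hϑ, hϑs⟩ := hγ.exists_tangentAngle
  have h0 : ((0, 0) : ℝ × ℝ) ∈ strip D.ε := D.isSheet₁.mem_strip_zero 0
  obtain ⟨θ, hθc, hθ⟩ := exists_continuousOn_arg (convex_sliceBox D.ε)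
    ⟨_, D.mem_sliceBox₁ h0⟩ (isOpen_sliceBox _) D.continuousOn_det₃
    fun m hm => D.det₃_ne_zero hm
  obtain ⟨a₁, b₁, d₁, s₁, L₁⟩ := D.isSheet₁.exists_lift hγ hs
  obtain ⟨a₂, b₂, d₂, s₂, L₂⟩ := D.isSheet₂.exists_lift hγ ht
  have key : ∀ {x y : ℝ}, cis (2 * x) = cis (2 * y) → ∃ k : ℤ, x - y = Real.pi * k := by
    intro x y h
    obtain ⟨k, hk⟩ := cis_eq_cis_iff.1 h
    exact ⟨k, by linarith⟩
  have hconst : ∀ f : ℝ × ℝ → ℝ, ContinuousOn f (strip D.ε) →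
      (∀ x ∈ strip D.ε, ∃ k : ℤ, f x = Real.pi * k) →
      ∃ k : ℤ, ∀ x ∈ strip D.ε, f x = Real.pi * k := by
    intro f hf h
    obtain ⟨k, hk⟩ := h _ h0
    exact ⟨k, fun x hx => hk ▸ IsPreconnected.eq_of_int_valued (convex_strip D.ε).isPreconnected
      hf Real.pi_pos h hx h0⟩
  obtain ⟨k₁, hk₁⟩ := hconst (fun x => θ (x.1, x.2, 0) - (φ + ϑ (a₁ x) + ϑ (b₁ x))) (by
      refine (hθc.comp (f := fun x : ℝ × ℝ => (x.1, x.2, 0)) (by fun_prop)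
        fun x hx => D.mem_sliceBox₁ hx).sub ((continuousOn_const.add ?_).add ?_)
      · exact hϑc.comp_continuousOn L₁.cont_fst
      · exact hϑc.comp_continuousOn L₁.cont_snd) (by
    intro x hx
    have h1 := D.hasPhase_frame (D.mem_sliceBox₁ hx) (p := 1) (q := 0) (Or.inl one_ne_zero)
      one_ne_zero (hθ _ (D.mem_sliceBox₁ hx))
    rw [← D.range_fderiv_sheet₁ hx, L₁.range_fderiv x hx] at h1
    have h2 := h1.cis_eq (hasPhase_tor hγ hs hϑ _)
    simp at h2
    exact key h2)
  obtain ⟨k₂, hk₂⟩ := hconst (fun x => θ (x.1, 0, x.2) +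
      (-(D.σ * D.ratio (x.1, 0, x.2)) : ℂ).arg - (0 + ϑ (a₂ x) + ϑ (b₂ x))) (by
      have hi : ContinuousOn (fun x : ℝ × ℝ => ((x.1, 0, x.2) : ℝ × ℝ × ℝ)) (strip D.ε) := by
        fun_prop
      have hmaps : Set.MapsTo (fun x : ℝ × ℝ => ((x.1, 0, x.2) : ℝ × ℝ × ℝ)) (strip D.ε)
        (sliceBox D.ε) := fun x hx => D.mem_sliceBox₂ hx
      refine ((hθc.comp hi hmaps).add ?_).sub ((continuousOn_const.add ?_).add ?_)
      · intro x hx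
        refine ContinuousAt.comp_continuousWithinAt (g := Complex.arg)
          (Complex.continuousAt_arg (slitPlane_of_im_ne_zero ?_)) ?_
        · simpa [sign_ne_zero D.σ_sign] using (D.ratio_im_pos (D.mem_sliceBox₂ hx)).ne'
        · exact ((continuousOn_const.mul (D.continuousOn_ratio.comp hi hmaps)).neg) x hx
      · exact hϑc.comp_continuousOn L₂.cont_fst
      · exact hϑc.comp_continuousOn L₂.cont_snd) (by
    intro x hx
    -- The factor -σ makes the argument agree with the one reached at the end of either neck.
    have h1 := D.hasPhase_frame (D.mem_sliceBox₂ hx) (p := 0) (q := 1) (Or.inr one_ne_zero)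
      (neg_ne_zero.2 (sign_ne_zero D.σ_sign)) (hθ _ (D.mem_sliceBox₂ hx))
    rw [← D.range_fderiv_sheet₂ hx, L₂.range_fderiv x hx] at h1
    have h2 := h1.cis_eq (hasPhase_tor hγ ht hϑ _)
    have h3 : ((-D.σ : ℝ) : ℂ) * (((0 : ℝ) : ℂ) + ((1 : ℝ) : ℂ) * D.ratio (x.1, 0, x.2)) =
      -(D.σ * D.ratio (x.1, 0, x.2)) := by push_cast; ring
    rw [h3] at h2
    exact key h2)
  exact ⟨⟨ϑ, n, hϑc, hn, hϑ, hϑs, θ, hθc, hθ, a₁, b₁, d₁, s₁, L₁, a₂, b₂, d₂, s₂, L₂,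
    k₁, fun x hx => by linarith [hk₁ x hx], k₂, fun x hx => by linarith [hk₂ x hx]⟩⟩

end Smoothing

/-! ### Fourth roots of the phase on the tori cut along the diagonal -/

theorem shift_int {ϑ : ℝ → ℝ} {p : ℝ} (h : ∀ a, ϑ (a + 1) = ϑ a + p) (a : ℝ) (k : ℤ) :
    ϑ (a + k) = ϑ a + p * k := by
  induction k using Int.induction_on with
  | zero => simp
  | succ i ih => push_cast at *; rw [← add_assoc, h, ih]; ring
  | pred i ih =>
    have h1 := h (a + (-(i : ℝ) - 1))
    push_cast at *
    rw [show a + (-(i : ℝ) - 1) + 1 = a + -(i : ℝ) by ring, ih] at h1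
    linarith

/-- A fourth root of the phase of the torus `R_φ ∘ F_r (γ × γ)` away from the diagonal. -/
noncomputable def outerValue (ϑ : ℝ → ℝ) (φ e : ℝ) (k : ℤ) (y : ℝ × ℝ) : ℂ :=
  e * cis ((φ + ϑ y.1 + ϑ y.2 + Real.pi * k) / 2)

theorem sign_pow_four {e : ℝ} (he : e = 1 ∨ e = -1) : (e : ℂ) ^ 4 = 1 := by
  rcases he with rfl | rfl <;> norm_num

theorem sign_mul {e f : ℝ} (he : e = 1 ∨ e = -1) (hf : f = 1 ∨ f = -1) :
    e * f = 1 ∨ e * f = -1 := by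
  rcases he with rfl | rfl <;> rcases hf with rfl | rfl <;> simp

theorem outerValue_pow_four {ϑ : ℝ → ℝ} {φ e : ℝ} (he : e = 1 ∨ e = -1) (k : ℤ) (y : ℝ × ℝ) :
    outerValue ϑ φ e k y ^ 4 = cis (2 * (φ + ϑ y.1 + ϑ y.2)) := by
  rw [outerValue, mul_pow, sign_pow_four he, one_mul, cis_pow]
  exact cis_eq_cis_iff.2 ⟨k, by push_cast; ring⟩

theorem norm_sign_mul_cis {e : ℝ} (he : e = 1 ∨ e = -1) (x : ℝ) : ‖(e : ℂ) * cis x‖ = 1 := by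
  rw [norm_mul, norm_cis, mul_one, Complex.norm_real, Real.norm_eq_abs, Smoothing.abs_sign he]

section

variable {γ : ℝ → ℂ} (hγ : IsSmoothJordan γ) {r φ : ℝ} (hr : r ∈ Set.Ioo (0 : ℝ) 1)
  {ϑ : ℝ → ℝ} {n : ℤ} (hϑ : ∀ a, ϑ (a + 1) = ϑ a + 2 * Real.pi * n)
include hγ hr hϑ

/-- The only deck transformations preserving a < b < a + 1 shift both parameters by the same i; the
half-angle then changes by 2πni. -/
theorem outerValue_eq {e : ℝ} {k : ℤ} {x y : ℝ × ℝ} (hx : x.1 < x.2 ∧ x.2 < x.1 + 1)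
    (hy : y.1 < y.2 ∧ y.2 < y.1 + 1) (h : tor γ r φ x = tor γ r φ y) :
    fderiv ℝ (tor γ r φ) x = fderiv ℝ (tor γ r φ) y ∧
      outerValue ϑ φ e k x = outerValue ϑ φ e k y := by
  obtain ⟨⟨i, hi⟩, ⟨j, hj⟩⟩ := (hγ.tor_eq_iff hr).1 h
  obtain rfl : y = (x.1 + i, x.2 + j) := Prod.ext hi hj
  refine ⟨(hγ.fderiv_tor_add_int x i j).symm, ?_⟩
  have h1 : (j - i : ℝ) < 1 := by linarith [hx.1, hy.2]
  have h2 : (-1 : ℝ) < j - i := by linarith [hx.2, hy.1]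
  have h1' : j - i < 1 := by exact_mod_cast h1
  have h2' : -1 < j - i := by exact_mod_cast h2
  obtain rfl : i = j := by omega
  rw [outerValue, outerValue, shift_int hϑ, shift_int hϑ]
  congr 1
  exact cis_eq_cis_iff.2 ⟨-(n * i), by push_cast; ring⟩

/-- The sign jump at the diagonal. The lift of the sheet crosses a = b, whereas y stays in a < b < a
+ 1; on one side the two differ by an extra turn of b, which changes the half-angle by πn with n
odd. -/
theorem outerValue_sheet (hn : n = 1 ∨ n = -1) {ε : ℝ} {Φ : ℝ × ℝ → C2} {a b : ℝ × ℝ → ℝ} {d : ℤ}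
    {sg : ℝ} (L : IsSheetLift γ r φ ε Φ a b d sg) {x y : ℝ × ℝ} (hx : x ∈ strip ε)
    (hy : y.1 < y.2 ∧ y.2 < y.1 + 1) (h : Φ x = tor γ r φ y) {κ : ℝ} (hκ : κ = 1 ∨ κ = -1)
    (hκx : 0 < κ * x.2) (e : ℝ) (k : ℤ) :
    LinearMap.range (fderiv ℝ (tor γ r φ) y).toLinearMap =
      LinearMap.range (fderiv ℝ Φ x).toLinearMap ∧
    outerValue ϑ φ e k y =
      ((e * (sg * κ) : ℝ) : ℂ) * cis ((φ + ϑ (a x) + ϑ (b x) + Real.pi * k) / 2) := by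
  rw [L.eq_tor x hx] at h
  obtain ⟨⟨i, hi⟩, ⟨j, hj⟩⟩ := (hγ.tor_eq_iff hr).1 h
  obtain rfl : y = (a x + i, b x + j) := Prod.ext hi hj
  refine ⟨?_, ?_⟩
  · rw [L.range_fderiv x hx, hγ.fderiv_tor_add_int (a x, b x) i j]
  simp only at hy
  have hside : (sg * κ) * (b x - a x) ∈ Set.Ioo (0 : ℝ) 1 := by
    rcases hκ with rfl | rfl
    · have := L.side_pos x hx (by linarith)
      rwa [mul_one]
    · have := L.side_neg x hx (by linarith)
      exact ⟨by linarith [this.2], by linarith [this.1]⟩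
  rw [outerValue, shift_int hϑ, shift_int hϑ]
  rcases sign_mul L.sign hκ with hs | hs
  · rw [hs, one_mul] at hside
    have h1 : (j - i : ℝ) < 1 := by linarith [hside.1, hy.2]
    have h2 : (-1 : ℝ) < j - i := by linarith [hside.2, hy.1]
    have h1' : j - i < 1 := by exact_mod_cast h1
    have h2' : -1 < j - i := by exact_mod_cast h2
    obtain rfl : i = j := by omega
    rw [hs, mul_one]
    congr 1
    exact cis_eq_cis_iff.2 ⟨n * i, by push_cast; ring⟩
  · rw [hs] at hside
    have h1 : (j - i : ℝ) < 2 := by linarith [hside.2, hy.2]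
    have h2 : (0 : ℝ) < j - i := by linarith [hside.1, hy.1]
    have h1' : j - i < 2 := by exact_mod_cast h1
    have h2' : 0 < j - i := by exact_mod_cast h2
    -- Here b < a on the sheet, so b must be shifted once more than a to enter the strip.
    obtain rfl : j = i + 1 := by omega
    have h3 : cis ((φ + (ϑ (a x) + 2 * Real.pi * n * i) +
        (ϑ (b x) + 2 * Real.pi * n * ((i + 1 : ℤ) : ℝ)) + Real.pi * k) / 2) =
        cis ((φ + ϑ (a x) + ϑ (b x) + Real.pi * k) / 2 + Real.pi) := by
      rcases hn with rfl | rfl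
      · exact cis_eq_cis_iff.2 ⟨i, by push_cast; ring⟩
      · exact cis_eq_cis_iff.2 ⟨-i - 1, by push_cast; ring⟩
    rw [h3, hs, cis_add, cis_pi]
    push_cast; ring

end

/-- The points, the tangent planes and the fourth roots of the phase of an outer patch. -/
def OuterRel (γ : ℝ → ℂ) (r φ ℓ : ℝ) (g : ℝ × ℝ → ℂ) (q : C2 × ℝ) (P : Submodule ℝ C2) (z : ℂ) :
    Prop :=
  ∃ y : ℝ × ℝ, (y.1 < y.2 ∧ y.2 < y.1 + 1) ∧ q = (tor γ r φ y, ℓ) ∧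
    P = LinearMap.range (fderiv ℝ (tor γ r φ) y).toLinearMap ∧ z = g y

/-! ### Fourth roots on the necks and their agreement with those on the tori -/

namespace Smoothing

namespace Branch

variable {γ : ℝ → ℂ} {s t φ : ℝ} {D : Smoothing γ s t φ} (B : D.Branch)

/-- The fourth root of the phase on `T₁`. -/
noncomputable def value₁ : ℝ × ℝ → ℂ := outerValue B.ϑ φ B.s₁ B.k₁

/-- The fourth root of the phase on `T₂`. -/
noncomputable def value₂ : ℝ × ℝ → ℂ := outerValue B.ϑ 0 (D.σ * B.s₂) B.k₂

/-- The determinant of the tangent plane of a neck, relative to that of the sheet `T₁ ∩ N`. -/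
noncomputable def neckRatio (_ : D.Branch) (κ : ℝ) (c : ℝ → ℝ × ℝ) (x : ℝ × ℝ) : ℂ :=
  -((deriv c x.2).1 + D.σ * (deriv c x.2).2 * D.ratio (D.neckSlice κ c x))

/-- The fourth root of the phase on a neck. -/
noncomputable def neckValue (κ : ℝ) (c : ℝ → ℝ × ℝ) (x : ℝ × ℝ) : ℂ :=
  κ * cis ((B.θ (D.neckSlice κ c x) + (B.neckRatio κ c x).arg) / 2)

/-- The points, the tangent planes and the fourth roots of the phase of a neck. -/
def NeckRel (κ : ℝ) (c : ℝ → ℝ × ℝ) (q : C2 × ℝ) (P : Submodule ℝ C2) (z : ℂ) : Prop :=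
  ∃ x : ℝ × ℝ, |x.2| < D.ε ∧ q = (D.neck κ c).map x ∧ P = D.neckPlane κ c x ∧
    z = B.neckValue κ c x

/-- The points, the tangent planes and the fourth roots of the phase of the surface. -/
def Rel (q : C2 × ℝ) (P : Submodule ℝ C2) (z : ℂ) : Prop :=
  OuterRel γ s φ 0 B.value₁ q P z ∨ OuterRel γ t 0 1 B.value₂ q P z ∨
    B.NeckRel 1 D.c₁ q P z ∨ B.NeckRel (-1) D.c₂ q P z

/-- The frame is periodic, so the period of θ is a constant in 2πℤ. On the core of T₁ it is the
change of ϑ(a) + ϑ(b), each term contributing 2πnd₁. -/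
theorem θ_shift {m : ℝ × ℝ × ℝ} (hm : m ∈ sliceBox D.ε) (k : ℤ) :
    B.θ (m.1 + k, m.2) = B.θ m + 4 * Real.pi * (B.n * B.d₁) * k := by
  have hshift : ∀ m ∈ sliceBox D.ε, ((m.1 + 1, m.2) : ℝ × ℝ × ℝ) ∈ sliceBox D.ε := fun _ h => h
  have h0 : ((0, 0) : ℝ × ℝ) ∈ strip D.ε := D.isSheet₁.mem_strip_zero 0
  have hint : ∀ m ∈ sliceBox D.ε, ∃ k : ℤ, B.θ (m.1 + 1, m.2) - B.θ m = 2 * Real.pi * k := by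
    intro m hm
    have h1 := B.θ_eq _ (hshift m hm)
    have h2 := B.θ_eq m hm
    have h3 : D.det₃ (m.1 + 1, m.2) = D.det₃ m := by
      simp only [det₃, e₁, e₃, D.frame_add_one hm]
    have hpos : 0 < ‖D.det₃ m‖ := norm_pos_iff.2 (D.det₃_ne_zero hm)
    rw [h3, h2] at h1
    simp only [norm_mul, norm_cis, mul_one, Complex.norm_real, norm_norm] at h1
    obtain ⟨k, hk⟩ := cis_eq_cis_iff.1 (cis_eq_of_mul_eq hpos hpos h1)
    exact ⟨-k, by rw [hk]; push_cast; ring⟩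
  have hone : ∀ m ∈ sliceBox D.ε, B.θ (m.1 + 1, m.2) = B.θ m + 4 * Real.pi * (B.n * B.d₁) := by
    intro m hm
    have hcont : ContinuousOn (fun m : ℝ × ℝ × ℝ => B.θ (m.1 + 1, m.2) - B.θ m) (sliceBox D.ε) :=
      (B.θ_cont.comp (f := fun m : ℝ × ℝ × ℝ => (m.1 + 1, m.2)) (by fun_prop) hshift).sub B.θ_cont
    have h1 := IsPreconnected.eq_of_int_valued (convex_sliceBox D.ε).isPreconnected hcont
      Real.two_pi_pos hint hm (D.mem_sliceBox₁ h0)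
    have h2 := B.θ_sheet₁ _ h0
    have h3 := B.θ_sheet₁ (0 + 1, 0) h0
    rw [B.lift₁.shift_fst _ h0, B.lift₁.shift_snd _ h0, shift_int B.ϑ_shift,
      shift_int B.ϑ_shift] at h3
    simp only at h1 h2 h3
    rw [h2, h3] at h1
    linarith
  induction k using Int.induction_on with
  | zero => simp
  | succ i ih =>
    have h1 := hone (m.1 + (i : ℤ), m.2) hm
    simp only at h1
    push_cast at *
    rw [← add_assoc, h1, ih]; ring
  | pred i ih =>
    have h1 := hone (m.1 + ((-(i : ℤ) - 1 : ℤ) : ℝ), m.2) hm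
    simp only at h1
    push_cast at *
    rw [show m.1 + (-(i : ℝ) - 1) + 1 = m.1 + -(i : ℝ) by ring, ih] at h1
    linarith

theorem cis_half_θ_shift {m : ℝ × ℝ × ℝ} (hm : m ∈ sliceBox D.ε) (k : ℤ) (y : ℝ) :
    cis ((B.θ (m.1 + k, m.2) + y) / 2) = cis ((B.θ m + y) / 2) := by
  rw [B.θ_shift hm]
  exact cis_eq_cis_iff.2 ⟨B.n * B.d₁ * k, by push_cast; ring⟩

theorem arg_neckRatio (κ : ℝ) {c : ℝ → ℝ × ℝ} (hc : IsSmoothingArc D.δ c) {x : ℝ × ℝ}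
    (h2 : (c x.2).2 = 0) : (B.neckRatio κ c x).arg = 0 := by
  rw [neckRatio, hc.deriv_snd_eq_zero h2]
  have : (-((deriv c x.2).1 + D.σ * ((0 : ℝ) : ℂ) * D.ratio (D.neckSlice κ c x)) : ℂ) =
    ((-(deriv c x.2).1 : ℝ) : ℂ) := by push_cast; ring
  rw [this, Complex.arg_ofReal_of_nonneg (by linarith [hc.monotone_fst x.2])]

section

variable {κ : ℝ} (hκ : κ = 1 ∨ κ = -1) {c : ℝ → ℝ × ℝ} (hc : IsSmoothingArc D.δ c)
include hκ hc

/-- Where y is stationary along the arc, x strictly decreases and the value is positive; elsewhere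
`ratio_im_pos` makes it nonreal. So the principal argument is continuous along the entire neck. -/
theorem neckRatio_mem_slitPlane {x : ℝ × ℝ} (hx : |x.2| < D.ε) :
    B.neckRatio κ c x ∈ Complex.slitPlane := by
  have him := D.ratio_im_pos (D.neckSlice_mem hκ hc hx)
  by_cases h2 : (deriv c x.2).2 = 0
  · left
    have := hc.speed_pos x.2
    simp [neckRatio, h2]; linarith
  · right
    have h3 := sign_ne_zero D.σ_sign
    rw [neckRatio, Complex.neg_im, Complex.add_im, Complex.ofReal_im, zero_add,
      ← Complex.ofReal_mul, Complex.im_ofReal_mul]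
    exact neg_ne_zero.2 (mul_ne_zero (mul_ne_zero h3 h2) him.ne')

theorem hasPhase_neckPlane {x : ℝ × ℝ} (hx : |x.2| < D.ε) : HasPhase (D.neckPlane κ c x)
    (2 * (B.θ (D.neckSlice κ c x) + (B.neckRatio κ c x).arg)) := by
  have hm := D.neckSlice_mem hκ hc hx
  have h0 := D.hasPhase_frame hm (D.neck_direction_ne_zero hκ hc x.2)
    (neg_ne_zero.2 (sign_ne_zero hκ)) (B.θ_eq _ hm)
  have h1 : ((-κ : ℝ) : ℂ) * (((κ * (deriv c x.2).1 : ℝ) : ℂ) +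
      ((κ * (D.σ * (deriv c x.2).2) : ℝ) : ℂ) * D.ratio (D.neckSlice κ c x)) =
      B.neckRatio κ c x := by
    have h2 : (κ : ℂ) * κ = 1 := by exact_mod_cast sign_mul_self hκ
    rw [neckRatio]
    push_cast
    linear_combination (-((deriv c x.2).1 : ℂ) -
      D.σ * (deriv c x.2).2 * D.ratio (D.neckSlice κ c x)) * h2
  rwa [h1] at h0

theorem neckRel_phase {q : C2 × ℝ} {P : Submodule ℝ C2} {z : ℂ} (h : B.NeckRel κ c q P z) :
    IsLagrangian P ∧ ‖z‖ = 1 ∧ ∃ x, HasPhase P x ∧ z ^ 4 = cis x := by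
  obtain ⟨x, hx, rfl, rfl, rfl⟩ := h
  refine ⟨D.isLagrangian_frame (D.neckSlice_mem hκ hc hx) (D.neck_direction_ne_zero hκ hc x.2),
    norm_sign_mul_cis hκ _, _, B.hasPhase_neckPlane hκ hc hx, ?_⟩
  rw [neckValue, mul_pow, sign_pow_four hκ, one_mul, cis_pow]
  congr 1; push_cast; ring

/-- The arc is injective, so parameters of the same point differ by an integer in x₁, under which
the frame and the half-angle are invariant. -/
theorem neckRel_unique {q : C2 × ℝ} {P P' : Submodule ℝ C2} {z z' : ℂ}
    (h : B.NeckRel κ c q P z) (h' : B.NeckRel κ c q P' z') : P = P' ∧ z = z' := by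
  obtain ⟨x, hx, rfl, rfl, rfl⟩ := h
  obtain ⟨y, hy, hq, rfl, rfl⟩ := h'
  rw [neck_map, neck_map, Prod.mk.injEq,
    D.Ψ_slice_eq_iff (D.neckSlice_mem hκ hc hx) (D.neckSlice_mem hκ hc hy)] at hq
  obtain ⟨⟨⟨k, hk⟩, h2⟩, -⟩ := hq
  simp only [neckSlice, Prod.mk.injEq] at hk h2
  have hcc : c y.2 = c x.2 := Prod.ext (mul_left_cancel₀ (sign_ne_zero hκ) h2.1)
    (mul_left_cancel₀ (sign_ne_zero D.σ_sign) (mul_left_cancel₀ (sign_ne_zero hκ) h2.2))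
  have hyx : y.2 = x.2 := hc.injective hcc
  have hs : D.neckSlice κ c y = ((D.neckSlice κ c x).1 + k, (D.neckSlice κ c x).2) := by
    simp only [neckSlice, hk, hyx]
  have hf : fderiv ℝ D.Ψ (slice (D.neckSlice κ c y)) =
      fderiv ℝ D.Ψ (slice (D.neckSlice κ c x)) := by
    have hper : ∀ m ∈ sliceBox D.ε, ∀ k : ℤ,
        fderiv ℝ D.Ψ (slice (m.1 + k, m.2)) = fderiv ℝ D.Ψ (slice m) := by
      intro m hm k
      induction k using Int.induction_on with
      | zero => simp
      | succ i ih =>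
        have h1 := D.frame_add_one (m := (m.1 + (i : ℤ), m.2)) hm
        simp only at h1
        push_cast at *
        rw [← add_assoc, h1, ih]
      | pred i ih =>
        have h1 := D.frame_add_one (m := (m.1 + ((-(i : ℤ) - 1 : ℤ) : ℝ), m.2)) hm
        simp only at h1
        push_cast at *
        rw [show m.1 + (-(i : ℝ) - 1) + 1 = m.1 + -(i : ℝ) by ring, ih] at h1
        exact h1.symm
    rw [hs, hper _ (D.neckSlice_mem hκ hc hx)]
  have h1 : D.e₁ (D.neckSlice κ c y) = D.e₁ (D.neckSlice κ c x) := by rw [e₁, e₁, hf]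
  have h3 : D.e₃ (D.neckSlice κ c y) = D.e₃ (D.neckSlice κ c x) := by rw [e₃, e₃, hf]
  have h4 : D.e₄ (D.neckSlice κ c y) = D.e₄ (D.neckSlice κ c x) := by rw [e₄, e₄, hf]
  have hr : B.neckRatio κ c y = B.neckRatio κ c x := by
    rw [neckRatio, neckRatio, ratio, ratio, det₃, det₃, h1, h3, h4, hyx]
  refine ⟨by rw [neckPlane, neckPlane, h1, h3, h4, hyx], ?_⟩
  rw [neckValue, neckValue, hr, hs, B.cis_half_θ_shift (D.neckSlice_mem hκ hc hx)]

variable (hγ : IsSmoothJordan γ)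
include hγ

/-- Label 0 forces y₂ = 0, so the point is on the sheet of T₁ and the arc is tangent to the x₂-axis.
The sign of the torus root there is s₁(s₁κ) = κ, that of the neck. -/
theorem outerRel₁_neckRel (hs : s ∈ Set.Ioo (0 : ℝ) 1) {q : C2 × ℝ} {P P' : Submodule ℝ C2}
    {z z' : ℂ} (h : OuterRel γ s φ 0 B.value₁ q P z) (h' : B.NeckRel κ c q P' z') :
    P = P' ∧ z = z' := by
  obtain ⟨y, hy, rfl, rfl, rfl⟩ := h
  obtain ⟨x, hx, hq, rfl, rfl⟩ := h'
  rw [neck_map, Prod.mk.injEq] at hq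
  obtain ⟨hq, hl⟩ := hq
  have h2 := hc.label_eq_zero.1 hl.symm
  obtain ⟨hst, he, hP⟩ := D.neckPlane_of_snd_eq_zero hκ hc hx h2
  rw [he] at hq
  have hpos := hc.add_pos x.2
  obtain ⟨h3, h4⟩ := outerValue_sheet hγ hs B.ϑ_shift B.n_sign B.lift₁ hst hy hq.symm hκ
    (by rw [← mul_assoc, sign_mul_self hκ, one_mul]; linarith) B.s₁ B.k₁
  refine ⟨h3.trans hP.symm, ?_⟩
  have h5 := B.θ_sheet₁ _ hst
  rw [value₁, h4, neckValue, B.arg_neckRatio κ hc h2, he, h5, ← mul_assoc, sign_mul_self B.lift₁.sign, one_mul, add_zero]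

/-- Label 1 forces x₂ = 0, and y₂ has the sign κσ. The normalization σs₂ in `value₂` is chosen to
give the sign κ again, simultaneously for both necks. -/
theorem outerRel₂_neckRel (ht : t ∈ Set.Ioo (0 : ℝ) 1) {q : C2 × ℝ} {P P' : Submodule ℝ C2}
    {z z' : ℂ} (h : OuterRel γ t 0 1 B.value₂ q P z) (h' : B.NeckRel κ c q P' z') :
    P = P' ∧ z = z' := by
  obtain ⟨y, hy, rfl, rfl, rfl⟩ := h
  obtain ⟨x, hx, hq, rfl, rfl⟩ := h'
  rw [neck_map, Prod.mk.injEq] at hq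
  obtain ⟨hq, hl⟩ := hq
  have h2 := hc.label_eq_one.1 hl.symm
  obtain ⟨hst, he, hP⟩ := D.neckPlane_of_fst_eq_zero hκ hc hx h2
  rw [he] at hq
  have hpos := hc.add_pos x.2
  have hσ := sign_mul_self D.σ_sign
  have hκκ := sign_mul_self hκ
  obtain ⟨h3, h4⟩ := outerValue_sheet hγ ht B.ϑ_shift B.n_sign B.lift₂ hst hy hq.symm
    (sign_mul hκ D.σ_sign)
    (by
      have h5 : κ * D.σ * (κ * (D.σ * (c x.2).2)) = (κ * κ) * (D.σ * D.σ) * (c x.2).2 := by ring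
      rw [h5, hκκ, hσ]; linarith) (D.σ * B.s₂) B.k₂
  refine ⟨h3.trans hP.symm, ?_⟩
  have h5 := B.θ_sheet₂ _ hst
  have hr : (B.neckRatio κ c x).arg = (-(D.σ * D.ratio (D.neckSlice κ c x)) : ℂ).arg := by
    have h0 := hc.deriv_fst_eq_zero h2
    have h1 := hc.speed_pos x.2
    rw [h0, sub_zero] at h1
    rw [neckRatio, h0]
    have : (-(((0 : ℝ) : ℂ) + D.σ * (deriv c x.2).2 * D.ratio (D.neckSlice κ c x)) : ℂ) =
      ((deriv c x.2).2 : ℂ) * -(D.σ * D.ratio (D.neckSlice κ c x)) := by push_cast; ring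
    rw [this, Complex.arg_real_mul _ h1]
  have h6 : D.σ * B.s₂ * (B.s₂ * (κ * D.σ)) = κ := by
    have h7 := sign_mul_self B.lift₂.sign
    linear_combination κ * D.σ * D.σ * h7 + κ * hσ
  rw [value₂, h4, neckValue, hr, he, h5, h6]

end

theorem outerRel_phase {r χ ℓ e : ℝ} {k : ℤ} (hγ : IsSmoothJordan γ) (hr : r ∈ Set.Ioo (0 : ℝ) 1)
    (he : e = 1 ∨ e = -1) {q : C2 × ℝ} {P : Submodule ℝ C2} {z : ℂ}
    (h : OuterRel γ r χ ℓ (outerValue B.ϑ χ e k) q P z) :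
    IsLagrangian P ∧ ‖z‖ = 1 ∧ ∃ x, HasPhase P x ∧ z ^ 4 = cis x := by
  obtain ⟨y, hy, rfl, rfl, rfl⟩ := h
  exact ⟨isLagrangian_tor hγ hr y, norm_sign_mul_cis he _, _, hasPhase_tor hγ hr B.ϑ_eq y,
    outerValue_pow_four he k y⟩

theorem rel_phase (hγ : IsSmoothJordan γ) (hs : s ∈ Set.Ioo (0 : ℝ) 1)
    (ht : t ∈ Set.Ioo (0 : ℝ) 1) {q : C2 × ℝ} {P : Submodule ℝ C2} {z : ℂ} (h : B.Rel q P z) :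
    IsLagrangian P ∧ ‖z‖ = 1 ∧ ∃ x, HasPhase P x ∧ z ^ 4 = cis x := by
  rcases h with h | h | h | h
  · exact B.outerRel_phase hγ hs B.lift₁.sign h
  · exact B.outerRel_phase hγ ht (sign_mul D.σ_sign B.lift₂.sign) h
  · exact B.neckRel_phase (Or.inl rfl) D.arc₁ h
  · exact B.neckRel_phase (Or.inr rfl) D.arc₂ h

theorem outerRel_unique {r χ ℓ e : ℝ} {k : ℤ} (hγ : IsSmoothJordan γ)
    (hr : r ∈ Set.Ioo (0 : ℝ) 1) {q : C2 × ℝ} {P P' : Submodule ℝ C2} {z z' : ℂ}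
    (h : OuterRel γ r χ ℓ (outerValue B.ϑ χ e k) q P z)
    (h' : OuterRel γ r χ ℓ (outerValue B.ϑ χ e k) q P' z') : P = P' ∧ z = z' := by
  obtain ⟨y, hy, rfl, rfl, rfl⟩ := h
  obtain ⟨y', hy', hq, rfl, rfl⟩ := h'
  obtain ⟨h1, h2⟩ := outerValue_eq hγ hr B.ϑ_shift (e := e) (k := k) hy hy'
    (congrArg Prod.fst hq)
  exact ⟨by rw [h1], h2⟩

theorem not_outerRel₁_outerRel₂ {q : C2 × ℝ} {P P' : Submodule ℝ C2} {z z' : ℂ}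
    (h : OuterRel γ s φ 0 B.value₁ q P z) (h' : OuterRel γ t 0 1 B.value₂ q P' z') : False := by
  obtain ⟨y, -, rfl, -⟩ := h
  obtain ⟨y', -, hq, -⟩ := h'
  exact zero_ne_one (congrArg Prod.snd hq)

/-- The arcs lie in opposite closed quadrants, which meet only at the origin, and they avoid it. -/
theorem not_neckRel_neckRel {q : C2 × ℝ} {P P' : Submodule ℝ C2} {z z' : ℂ}
    (h : B.NeckRel 1 D.c₁ q P z) (h' : B.NeckRel (-1) D.c₂ q P' z') : False := by
  obtain ⟨x, hx, rfl, -⟩ := h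
  obtain ⟨y, hy, hq, -⟩ := h'
  rw [neck_map, neck_map, Prod.mk.injEq, D.Ψ_slice_eq_iff
    (D.neckSlice_mem (Or.inl rfl) D.arc₁ hx) (D.neckSlice_mem (Or.inr rfl) D.arc₂ hy)] at hq
  obtain ⟨⟨-, h2⟩, -⟩ := hq
  simp only [neckSlice, Prod.mk.injEq] at h2
  have h3 : -1 * (D.c₂ y.2).2 = 1 * (D.c₁ x.2).2 :=
    mul_left_cancel₀ (sign_ne_zero D.σ_sign) (by linarith [h2.2])
  have := D.arc₁.add_pos x.2
  have := D.arc₂.add_pos y.2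
  linarith [h2.1]

theorem rel_unique (hγ : IsSmoothJordan γ) (hs : s ∈ Set.Ioo (0 : ℝ) 1)
    (ht : t ∈ Set.Ioo (0 : ℝ) 1) {q : C2 × ℝ} {P P' : Submodule ℝ C2} {z z' : ℂ}
    (h : B.Rel q P z) (h' : B.Rel q P' z') : P = P' ∧ z = z' := by
  have hswap : ∀ {P P' : Submodule ℝ C2} {z z' : ℂ}, P = P' ∧ z = z' → P' = P ∧ z' = z :=
    fun h => ⟨h.1.symm, h.2.symm⟩
  rcases h with h | h | h | h <;> rcases h' with h' | h' | h' | h'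
  · exact B.outerRel_unique hγ hs h h'
  · exact (B.not_outerRel₁_outerRel₂ h h').elim
  · exact B.outerRel₁_neckRel (Or.inl rfl) D.arc₁ hγ hs h h'
  · exact B.outerRel₁_neckRel (Or.inr rfl) D.arc₂ hγ hs h h'
  · exact (B.not_outerRel₁_outerRel₂ h' h).elim
  · exact B.outerRel_unique hγ ht h h'
  · exact B.outerRel₂_neckRel (Or.inl rfl) D.arc₁ hγ ht h h'
  · exact B.outerRel₂_neckRel (Or.inr rfl) D.arc₂ hγ ht h h'
  · exact hswap (B.outerRel₁_neckRel (Or.inl rfl) D.arc₁ hγ hs h' h)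
  · exact hswap (B.outerRel₂_neckRel (Or.inl rfl) D.arc₁ hγ ht h' h)
  · exact B.neckRel_unique (Or.inl rfl) D.arc₁ h h'
  · exact (B.not_neckRel_neckRel h h').elim
  · exact hswap (B.outerRel₁_neckRel (Or.inr rfl) D.arc₂ hγ hs h' h)
  · exact hswap (B.outerRel₂_neckRel (Or.inr rfl) D.arc₂ hγ ht h' h)
  · exact (B.not_neckRel_neckRel h' h).elim
  · exact B.neckRel_unique (Or.inr rfl) D.arc₂ h h'

end Branch

end Smoothing

/-- A function on the image of a compact set is continuous if its pullback is. -/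
theorem continuousOn_image_of_isCompact {X Y Z : Type*} [TopologicalSpace X] [TopologicalSpace Y]
    [T2Space Y] [TopologicalSpace Z] {K : Set X} (hK : IsCompact K) (hKc : IsClosed K) {f : X → Y}
    (hf : ContinuousOn f K) {G : Y → Z} (hG : ContinuousOn (fun x => G (f x)) K) :
    ContinuousOn G (f '' K) := by
  rw [continuousOn_iff_isClosed]
  intro C hC
  have h1 : IsClosed (K ∩ (fun x => G (f x)) ⁻¹' C) := hG.preimage_isClosed_of_isClosed hKc hC
  have h2 : IsCompact (K ∩ (fun x => G (f x)) ⁻¹' C) :=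
    hK.of_isClosed_subset h1 Set.inter_subset_left
  refine ⟨_, (h2.image_of_continuousOn (hf.mono Set.inter_subset_left)).isClosed, ?_⟩
  ext y
  constructor
  · rintro ⟨hy, x, hx, rfl⟩
    exact ⟨⟨x, ⟨hx, hy⟩, rfl⟩, ⟨x, hx, rfl⟩⟩
  · rintro ⟨⟨x, ⟨hx, hy⟩, rfl⟩, h⟩
    exact ⟨hy, h⟩

/-! ### Compact pieces covering the surface -/

namespace Smoothing

variable {γ : ℝ → ℂ} {s t φ : ℝ} (D : Smoothing γ s t φ)

theorem openBox_subset : openBox D.δ ⊆ openBox D.ε := fun _ h =>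
  ⟨h.1.trans D.δ_lt, h.2.1.trans D.δ_lt, h.2.2.trans D.δ_lt⟩

/-- Inverse function theorem. Removing this open set, rather than the closed box of the patches,
leaves compact outer pieces. -/
theorem isOpen_image_Ψ : IsOpen (D.Ψ '' openBox D.δ) := by
  rw [isOpen_iff_mem_nhds]
  rintro _ ⟨p, hp, rfl⟩
  have hp' := D.openBox_subset hp
  have hs : HasStrictFDerivAt D.Ψ (fderiv ℝ D.Ψ p) p :=
    (D.chart.smooth.contDiffAt ((isOpen_openBox _).mem_nhds hp')).hasStrictFDerivAt (by simp)
  have hfin : Module.finrank ℝ Coord = Module.finrank ℝ C2 := by simp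
  have hsurj : Function.Surjective (fderiv ℝ D.Ψ p) :=
    (LinearMap.injective_iff_surjective_of_finrank_eq_finrank
      (f := (fderiv ℝ D.Ψ p).toLinearMap) hfin).1 (D.injective_fderiv_Ψ hp')
  rw [← hs.map_nhds_eq_of_surj (LinearMap.range_eq_top.2 hsurj)]
  exact Filter.image_mem_map ((isOpen_openBox _).mem_nhds hp)

theorem diagonal_mem (a : ℝ) : (γ a, (0 : ℂ)) ∈ D.Ψ '' openBox D.δ := by
  have h : (γ a, (0 : ℂ)) ∈ Set.range fun x : ℝ => D.Ψ (x, 0, 0, 0) := by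
    rw [D.chart.core]; exact ⟨⟨a, rfl⟩, rfl⟩
  obtain ⟨x, hx⟩ := h
  exact ⟨_, by simp [openBox, D.δ_pos], hx⟩

/-- The parameters, in a fundamental domain, of the part of a torus outside of the box of
size `δ`. -/
def outerDomain (r χ : ℝ) : Set (ℝ × ℝ) :=
  {y | (y.1 ∈ Set.Icc (0 : ℝ) 1 ∧ y.1 ≤ y.2 ∧ y.2 ≤ y.1 + 1) ∧
    tor γ r χ y ∉ D.Ψ '' openBox D.δ}

/-- The lines b = a and b = a + 1 map to the core circle, which lies inside the removed box. -/
theorem lt_of_mem_outerDomain (hγ : IsSmoothJordan γ) {r χ : ℝ} {y : ℝ × ℝ}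
    (hy : y ∈ D.outerDomain r χ) : y.1 < y.2 ∧ y.2 < y.1 + 1 := by
  obtain ⟨⟨-, h1, h2⟩, h3⟩ := hy
  constructor
  · refine lt_of_le_of_ne h1 fun h => h3 ?_
    have : y = (y.1, y.1) := Prod.ext rfl h.symm
    rw [this, tor_diag]
    exact D.diagonal_mem _
  · refine lt_of_le_of_ne h2 fun h => h3 ?_
    have : y = (y.1 + ((0 : ℤ) : ℝ), y.1 + ((1 : ℤ) : ℝ)) := Prod.ext (by simp) (by simpa using h)
    rw [this, hγ.tor_add_int (y.1, y.1), tor_diag]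
    exact D.diagonal_mem _

theorem isClosed_outerDomain (hγ : IsSmoothJordan γ) (r χ : ℝ) :
    IsClosed (D.outerDomain r χ) := by
  have h1 : IsClosed {y : ℝ × ℝ | y.1 ∈ Set.Icc (0 : ℝ) 1} :=
    isClosed_Icc.preimage continuous_fst
  have h2 : IsClosed {y : ℝ × ℝ | y.1 ≤ y.2} := isClosed_le (by fun_prop) (by fun_prop)
  have h3 : IsClosed {y : ℝ × ℝ | y.2 ≤ y.1 + 1} := isClosed_le (by fun_prop) (by fun_prop)
  have h4 : IsClosed {y : ℝ × ℝ | tor γ r χ y ∉ D.Ψ '' openBox D.δ} :=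
    (D.isOpen_image_Ψ.preimage hγ.differentiable_tor.continuous).isClosed_compl
  exact (h1.inter (h2.inter h3)).inter h4

theorem isCompact_outerDomain (hγ : IsSmoothJordan γ) (r χ : ℝ) :
    IsCompact (D.outerDomain r χ) := by
  refine (isCompact_Icc (a := ((0, 0) : ℝ × ℝ)) (b := (1, 2))).of_isClosed_subset
    (D.isClosed_outerDomain hγ r χ) ?_
  rintro y ⟨⟨h1, h2, h3⟩, -⟩
  exact ⟨⟨h1.1, h1.1.trans h2⟩, ⟨h1.2, by simp only; linarith [h1.2]⟩⟩

theorem exists_mem_outerDomain (hγ : IsSmoothJordan γ) {r χ : ℝ} {x : ℝ × ℝ}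
    (hx : tor γ r χ x ∉ D.Ψ '' openBox D.δ) : ∃ y ∈ D.outerDomain r χ,
      tor γ r χ y = tor γ r χ x ∧ fderiv ℝ (tor γ r χ) y = fderiv ℝ (tor γ r χ) x := by
  have he : ((Int.fract x.1, Int.fract x.1 + Int.fract (x.2 - x.1)) : ℝ × ℝ) =
      (x.1 + ((-⌊x.1⌋ : ℤ) : ℝ), x.2 + ((-⌊x.1⌋ - ⌊x.2 - x.1⌋ : ℤ) : ℝ)) := by
    simp only [Int.fract]
    refine Prod.ext ?_ ?_ <;> simp only <;> push_cast <;> ring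
  have h1 : tor γ r χ (Int.fract x.1, Int.fract x.1 + Int.fract (x.2 - x.1)) = tor γ r χ x := by
    rw [he, hγ.tor_add_int]
  refine ⟨(Int.fract x.1, Int.fract x.1 + Int.fract (x.2 - x.1)), ⟨⟨⟨Int.fract_nonneg _,
    (Int.fract_lt_one _).le⟩, ?_, ?_⟩, by rwa [h1]⟩, h1, by rw [he, hγ.fderiv_tor_add_int]⟩
  · simp only; linarith [Int.fract_nonneg (x.2 - x.1)]
  · simp only; linarith [Int.fract_lt_one (x.2 - x.1)]

theorem openBox_subset_closedBox (δ : ℝ) : openBox δ ⊆ closedBox δ := fun _ h =>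
  ⟨h.1.le, h.2.1.le, h.2.2.le⟩

theorem outer2_map (x : ℝ × ℝ) : mapF t (γ x.1, γ x.2) = tor γ t 0 x := (mapR_zero _).symm

/-- The parameters of the part of a neck in the box of size `δ`. -/
def neckDomain : Set (ℝ × ℝ) := Set.Icc (0 : ℝ) 1 ×ˢ Set.Icc (-D.δ) D.δ

theorem abs_lt_of_mem_neckDomain {x : ℝ × ℝ} (hx : x ∈ D.neckDomain) : |x.2| < D.ε :=
  (abs_le.2 hx.2).trans_lt D.δ_lt

theorem isCompact_neckDomain : IsCompact D.neckDomain := isCompact_Icc.prod isCompact_Icc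

theorem isClosed_neckDomain : IsClosed D.neckDomain := isClosed_Icc.prod isClosed_Icc

theorem slice_notMem {m : ℝ × ℝ × ℝ} (hm : m ∈ sliceBox D.ε) (h : D.δ ≤ |m.2.1| ∨ D.δ ≤ |m.2.2|) :
    D.Ψ (slice m) ∉ D.Ψ '' openBox D.δ := by
  rintro ⟨p, hp, hpm⟩
  have h1 := ((D.chart.injective p (D.openBox_subset hp) _ (D.slice_mem hm)).1 hpm).2
  have h2 : p.2.2 = m.2 := by rw [← h1]; rfl
  have h3 := hp.2
  rw [h2] at h3
  rcases h with h | h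
  · exact absurd h3.1 (not_lt.2 h)
  · exact absurd h3.2 (not_lt.2 h)

theorem neck1_mem_T : D.neck 1 D.c₁ ∈ D.T := by simp [T]

theorem continuous_neckSlice (κ : ℝ) {c : ℝ → ℝ × ℝ} (hc : IsSmoothingArc D.δ c) :
    Continuous (D.neckSlice κ c) := by
  have := hc.smooth.continuous
  unfold neckSlice
  fun_prop

theorem continuousOn_neck_map {κ : ℝ} (hκ : κ = 1 ∨ κ = -1) {c : ℝ → ℝ × ℝ}
    (hc : IsSmoothingArc D.δ c) : ContinuousOn (D.neck κ c).map (strip D.ε) := by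
  have h := hc.smooth.continuous
  have h1 : ContinuousOn D.Ψ (openBox D.ε) := D.chart.smooth.continuousOn
  refine ContinuousOn.prodMk (h1.comp
    (continuous_slice.comp (D.continuous_neckSlice κ hc)).continuousOn
    fun x hx => D.slice_mem (D.neckSlice_mem hκ hc hx)) ?_
  have h2 : Continuous fun x : ℝ × ℝ => (c x.2).2 / ((c x.2).1 + (c x.2).2) :=
    Continuous.div (by fun_prop) (by fun_prop) fun x => (hc.add_pos x.2).ne'
  exact h2.continuousOn

variable {D}

namespace Branch

variable (B : D.Branch)

/-- The surface, as a union of four compact pieces. -/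
def pieces (D : Smoothing γ s t φ) : Set (C2 × ℝ) :=
  ((fun y => (tor γ s φ y, (0 : ℝ))) '' D.outerDomain s φ ∪
    (fun y => (tor γ t 0 y, (1 : ℝ))) '' D.outerDomain t 0) ∪
  ((D.neck 1 D.c₁).map '' D.neckDomain ∪ (D.neck (-1) D.c₂).map '' D.neckDomain)

section

variable (hγ : IsSmoothJordan γ)
include hγ

/-- For |τ| ≥ δ the neck runs along a half axis, so it belongs to a torus outside the open box; for
|τ| ≤ δ only x₁ has to be reduced modulo 1. -/
theorem neck_mem_pieces {κ : ℝ} (hκ : κ = 1 ∨ κ = -1)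
    {c : ℝ → ℝ × ℝ} (hc : IsSmoothingArc D.δ c)
    (hsub : (D.neck κ c).map '' D.neckDomain ⊆ pieces D) {x : ℝ × ℝ} (hx : |x.2| < D.ε) :
    (D.neck κ c).map x ∈ pieces D := by
  have hm := D.neckSlice_mem hκ hc hx
  rcases le_total x.2 (-D.δ) with h1 | h1
  · have hcx := hc.incoming x.2 h1
    obtain ⟨hst, he, -⟩ := D.neckPlane_of_snd_eq_zero hκ hc hx (by rw [hcx])
    obtain ⟨y, hy⟩ := D.isSheet₁.mem _ hst
    have hn : tor γ s φ y ∉ D.Ψ '' openBox D.δ := by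
      rw [hy]
      refine D.slice_notMem (D.mem_sliceBox₁ hst) (Or.inl ?_)
      simp only [abs_mul, abs_sign hκ, hcx, one_mul]
      rw [abs_of_nonneg (by linarith [D.δ_pos])]; linarith
    obtain ⟨y', hy', hyy, -⟩ := D.exists_mem_outerDomain hγ hn
    refine Or.inl (Or.inl ⟨y', hy', ?_⟩)
    simp only [hyy, hy]
    rw [neck_map, he, hc.label_eq_zero.2 (by rw [hcx])]
    rfl
  rcases le_total D.δ x.2 with h2 | h2
  · have hcx := hc.outgoing x.2 h2
    obtain ⟨hst, he, -⟩ := D.neckPlane_of_fst_eq_zero hκ hc hx (by rw [hcx])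
    obtain ⟨y, hy⟩ := D.isSheet₂.mem _ hst
    have hn : tor γ t 0 y ∉ D.Ψ '' openBox D.δ := by
      rw [hy]
      refine D.slice_notMem (D.mem_sliceBox₂ hst) (Or.inr ?_)
      simp only [abs_mul, abs_sign hκ, abs_sign D.σ_sign, hcx, one_mul]
      exact h2.trans (le_abs_self _)
    obtain ⟨y', hy', hyy, -⟩ := D.exists_mem_outerDomain hγ hn
    refine Or.inl (Or.inr ⟨y', hy', ?_⟩)
    simp only [hyy, hy]
    rw [neck_map, he, hc.label_eq_one.2 (by rw [hcx])]
    rfl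
  refine hsub ⟨(x.1 + ((-⌊x.1⌋ : ℤ) : ℝ), x.2), ⟨?_, h1, h2⟩, ?_⟩
  · have h3 : x.1 + ((-⌊x.1⌋ : ℤ) : ℝ) = Int.fract x.1 := by
      push_cast; rw [← sub_eq_add_neg]; rfl
    simp only [h3]
    exact ⟨Int.fract_nonneg _, (Int.fract_lt_one _).le⟩
  · rw [neck_map, neck_map]
    refine Prod.ext ?_ rfl
    have hm' : D.neckSlice κ c (x.1 + ((-⌊x.1⌋ : ℤ) : ℝ), x.2) ∈ sliceBox D.ε :=
      D.neckSlice_mem hκ hc hx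
    exact ((D.Ψ_slice_eq_iff hm hm').2 ⟨⟨-⌊x.1⌋, by simp only [neckSlice]⟩, rfl⟩).symm

theorem surface_subset_pieces : surface D.T ⊆ pieces D := by
  intro q hq
  simp only [surface, Set.mem_iUnion] at hq
  obtain ⟨f, hf, x, hx, rfl⟩ := hq
  rcases hf with rfl | rfl | rfl | rfl
  · have hx' : tor γ s φ x ∉ D.Ψ '' openBox D.δ := fun h =>
      hx (Set.image_mono (openBox_subset_closedBox _) h)
    obtain ⟨y, hy, hyx, -⟩ := D.exists_mem_outerDomain hγ hx'
    exact Or.inl (Or.inl ⟨y, hy, Prod.ext hyx rfl⟩)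
  · have hx' : tor γ t 0 x ∉ D.Ψ '' openBox D.δ := fun h =>
      hx (Set.image_mono (openBox_subset_closedBox _) (by rwa [← outer2_map] at h))
    obtain ⟨y, hy, hyx, -⟩ := D.exists_mem_outerDomain hγ hx'
    exact Or.inl (Or.inr ⟨y, hy, Prod.ext (hyx.trans (outer2_map x).symm) rfl⟩)
  · exact neck_mem_pieces hγ (Or.inl rfl) D.arc₁
      (fun _ h => Or.inr (Or.inl h)) hx
  · exact neck_mem_pieces hγ (Or.inr rfl) D.arc₂
      (fun _ h => Or.inr (Or.inr h)) hx

theorem exists_rel_of_isTangentPlane {q : C2 × ℝ} {P : Submodule ℝ C2}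
    (h : IsTangentPlane D.T q P) : ∃ z, B.Rel q P z := by
  obtain ⟨f, hf, x, hx, rfl, rfl⟩ := h
  rcases hf with rfl | rfl | rfl | rfl
  · have hx' : tor γ s φ x ∉ D.Ψ '' openBox D.δ := fun h =>
      hx (Set.image_mono (openBox_subset_closedBox _) h)
    obtain ⟨y, hy, hyx, hyd⟩ := D.exists_mem_outerDomain hγ hx'
    refine ⟨_, Or.inl ⟨y, D.lt_of_mem_outerDomain hγ hy, Prod.ext hyx.symm rfl, ?_, rfl⟩⟩
    rw [hyd]; rfl
  · have hx' : tor γ t 0 x ∉ D.Ψ '' openBox D.δ := fun h =>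
      hx (Set.image_mono (openBox_subset_closedBox _) (by rwa [← outer2_map] at h))
    obtain ⟨y, hy, hyx, hyd⟩ := D.exists_mem_outerDomain hγ hx'
    refine ⟨_, Or.inr (Or.inl ⟨y, D.lt_of_mem_outerDomain hγ hy,
      Prod.ext ((outer2_map x).trans hyx.symm) rfl, ?_, rfl⟩)⟩
    have hfun : (fun y => (D.outer2.map y).1) = tor γ t 0 := funext fun y => outer2_map y
    rw [hyd, hfun]
  · exact ⟨_, Or.inr (Or.inr (Or.inl ⟨x, hx, rfl,
      D.range_fderiv_neck (Or.inl rfl) D.arc₁ hx, rfl⟩))⟩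
  · exact ⟨_, Or.inr (Or.inr (Or.inr ⟨x, hx, rfl,
      D.range_fderiv_neck (Or.inr rfl) D.arc₂ hx, rfl⟩))⟩

end

/-! ### Continuity of the glued fourth root -/

theorem continuous_outerValue (χ e : ℝ) (k : ℤ) : Continuous (outerValue B.ϑ χ e k) := by
  have := B.ϑ_cont
  have := continuous_cis
  unfold outerValue
  fun_prop

theorem continuousOn_neckValue {κ : ℝ} (hκ : κ = 1 ∨ κ = -1) {c : ℝ → ℝ × ℝ}
    (hc : IsSmoothingArc D.δ c) : ContinuousOn (B.neckValue κ c) (strip D.ε) := by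
  have hmaps : Set.MapsTo (D.neckSlice κ c) (strip D.ε) (sliceBox D.ε) :=
    fun x hx => D.neckSlice_mem hκ hc hx
  have hcont := (D.continuous_neckSlice κ hc).continuousOn (s := strip D.ε)
  have hd : Continuous (deriv c) := hc.smooth.continuous_deriv (by simp)
  have h1 : ContinuousOn (B.neckRatio κ c) (strip D.ε) := by
    have h2 : Continuous fun x : ℝ × ℝ => ((deriv c x.2).1 : ℂ) := by fun_prop
    have h3 : Continuous fun x : ℝ × ℝ => (D.σ * (deriv c x.2).2 : ℂ) := by fun_prop
    exact (h2.continuousOn.add (h3.continuousOn.mul (D.continuousOn_ratio.comp hcont hmaps))).neg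
  have h4 : ContinuousOn (fun x => (B.neckRatio κ c x).arg) (strip D.ε) := fun x hx =>
    ContinuousAt.comp_continuousWithinAt (g := Complex.arg)
      (Complex.continuousAt_arg (B.neckRatio_mem_slitPlane hκ hc hx)) (h1 x hx)
  exact continuousOn_const.mul (continuous_cis.comp_continuousOn
    (((B.θ_cont.comp hcont hmaps).add h4).div_const 2))

open Classical in
/-- The continuous fourth root of the phase on the surface. -/
noncomputable def root (q : C2 × ℝ) : ℂ :=
  if h : ∃ z, ∃ P, B.Rel q P z then h.choose else 0

section

variable (hγ : IsSmoothJordan γ) (hs : s ∈ Set.Ioo (0 : ℝ) 1) (ht : t ∈ Set.Ioo (0 : ℝ) 1)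
include hγ hs ht

theorem root_eq {q : C2 × ℝ} {P : Submodule ℝ C2} {z : ℂ} (h : B.Rel q P z) : B.root q = z := by
  have h' : ∃ z, ∃ P, B.Rel q P z := ⟨z, P, h⟩
  rw [root, dif_pos h']
  obtain ⟨P', hP'⟩ := h'.choose_spec
  exact (B.rel_unique hγ hs ht hP' h).2

theorem continuousOn_root_neck {κ : ℝ} (hκ : κ = 1 ∨ κ = -1) {c : ℝ → ℝ × ℝ}
    (hc : IsSmoothingArc D.δ c) (hrel : ∀ q P z, B.NeckRel κ c q P z → B.Rel q P z) :
    ContinuousOn B.root ((D.neck κ c).map '' D.neckDomain) := by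
  have hsub : D.neckDomain ⊆ strip D.ε := fun x hx => D.abs_lt_of_mem_neckDomain hx
  refine continuousOn_image_of_isCompact D.isCompact_neckDomain D.isClosed_neckDomain
    ((D.continuousOn_neck_map hκ hc).mono hsub)
    (((B.continuousOn_neckValue hκ hc).mono hsub).congr fun x hx => ?_)
  exact B.root_eq hγ hs ht (hrel _ _ _ ⟨x, hsub hx, rfl, rfl, rfl⟩)

/-- Pasting over four compact, hence closed, pieces: `rel_unique` makes the local formulas agree on
overlaps, and on each piece continuity descends from the parameters. -/
theorem continuousOn_root : ContinuousOn B.root (surface D.T) := by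
  have hcl : ∀ {f : ℝ × ℝ → C2 × ℝ} {K : Set (ℝ × ℝ)}, IsCompact K → ContinuousOn f K →
      IsClosed (f '' K) := fun hK hf => (hK.image_of_continuousOn hf).isClosed
  have hsub : D.neckDomain ⊆ strip D.ε := fun x hx => D.abs_lt_of_mem_neckDomain hx
  have hf₁ : ContinuousOn (fun y => (tor γ s φ y, (0 : ℝ))) (D.outerDomain s φ) :=
    (hγ.differentiable_tor.continuous.prodMk continuous_const).continuousOn
  have hf₂ : ContinuousOn (fun y => (tor γ t 0 y, (1 : ℝ))) (D.outerDomain t 0) :=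
    (hγ.differentiable_tor.continuous.prodMk continuous_const).continuousOn
  have hc₁ := hcl (D.isCompact_outerDomain hγ s φ) hf₁
  have hc₂ := hcl (D.isCompact_outerDomain hγ t 0) hf₂
  have hc₃ := hcl D.isCompact_neckDomain
    ((D.continuousOn_neck_map (Or.inl rfl) D.arc₁).mono hsub)
  have hc₄ := hcl D.isCompact_neckDomain
    ((D.continuousOn_neck_map (Or.inr rfl) D.arc₂).mono hsub)
  refine ContinuousOn.mono ?_ (surface_subset_pieces hγ)
  refine ContinuousOn.union_of_isClosed (ContinuousOn.union_of_isClosed ?_ ?_ hc₁ hc₂)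
    (ContinuousOn.union_of_isClosed ?_ ?_ hc₃ hc₄) (hc₁.union hc₂) (hc₃.union hc₄)
  · refine continuousOn_image_of_isCompact (D.isCompact_outerDomain hγ s φ)
      (D.isClosed_outerDomain hγ s φ) hf₁
      ((B.continuous_outerValue φ B.s₁ B.k₁).continuousOn.congr fun y hy => ?_)
    exact B.root_eq hγ hs ht (Or.inl ⟨y, D.lt_of_mem_outerDomain hγ hy, rfl, rfl, rfl⟩)
  · refine continuousOn_image_of_isCompact (D.isCompact_outerDomain hγ t 0)
      (D.isClosed_outerDomain hγ t 0) hf₂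
      ((B.continuous_outerValue 0 (D.σ * B.s₂) B.k₂).continuousOn.congr fun y hy => ?_)
    exact B.root_eq hγ hs ht
      (Or.inr (Or.inl ⟨y, D.lt_of_mem_outerDomain hγ hy, rfl, rfl, rfl⟩))
  · exact B.continuousOn_root_neck hγ hs ht (Or.inl rfl) D.arc₁
      fun _ _ _ h => Or.inr (Or.inr (Or.inl h))
  · exact B.continuousOn_root_neck hγ hs ht (Or.inr rfl) D.arc₂
      fun _ _ _ h => Or.inr (Or.inr (Or.inr h))

end

/-! ### The Maslov class of the surface -/

theorem exists_tangentPlane {q : C2 × ℝ} (hq : q ∈ surface D.T) :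
    ∃ P, IsTangentPlane D.T q P := by
  simp only [surface, Set.mem_iUnion] at hq
  obtain ⟨f, hf, x, hx, rfl⟩ := hq
  exact ⟨_, f, hf, x, hx, rfl, rfl⟩

/-- On the edge τ = -δ of the first neck the tangent plane is that of T₁ and its phase is 2θ, which
changes by 8πnd₁. -/
theorem exists_coreLoop : ∃ (x : surface D.T) (α : Path x x),
    IsLoopIndex D.T α (4 * (B.n * B.d₁)) := by
  have hδ : |(-D.δ)| < D.ε := by rw [abs_neg, abs_of_pos D.δ_pos]; exact D.δ_lt
  have hdom : ∀ u : ℝ, ((u, -D.δ) : ℝ × ℝ) ∈ (D.neck 1 D.c₁).dom := fun u => hδ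
  have hmem : ∀ u : ℝ, (D.neck 1 D.c₁).map (u, -D.δ) ∈ surface D.T := fun u =>
    Set.mem_biUnion D.neck1_mem_T ⟨_, hdom u, rfl⟩
  have hm : ∀ u : ℝ, D.neckSlice 1 D.c₁ (u, -D.δ) ∈ sliceBox D.ε := fun u =>
    D.neckSlice_mem (Or.inl rfl) D.arc₁ hδ
  have hslice : ∀ u : ℝ, D.neckSlice 1 D.c₁ (u + 1, -D.δ) =
      ((D.neckSlice 1 D.c₁ (u, -D.δ)).1 + ((1 : ℤ) : ℝ), (D.neckSlice 1 D.c₁ (u, -D.δ)).2) := by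
    intro u; simp [neckSlice]
  have hline : Continuous fun u : ℝ => ((u, -D.δ) : ℝ × ℝ) := by fun_prop
  have hcont : Continuous fun u : ℝ => (D.neck 1 D.c₁).map (u, -D.δ) :=
    (D.continuousOn_neck_map (Or.inl rfl) D.arc₁).comp_continuous hline fun u => hδ
  refine ⟨⟨_, hmem 0⟩, ⟨⟨fun τ => ⟨_, hmem τ⟩, ?_⟩, ?_, ?_⟩, ?_⟩
  · exact (hcont.comp continuous_subtype_val).subtype_mk _
  · rfl
  · refine Subtype.ext (Prod.ext ?_ rfl)
    refine ((D.Ψ_slice_eq_iff (hm 0) (hm 1)).2 ⟨⟨1, ?_⟩, rfl⟩).symm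
    simp [neckSlice]
  · refine ⟨fun τ => D.neckPlane 1 D.c₁ (τ, -D.δ), fun τ => ?_, hasMaslovIndex_iff.2
      ⟨⟨fun τ => 2 * B.θ (D.neckSlice 1 D.c₁ (τ, -D.δ)), ?_⟩, fun τ => ?_, ?_⟩⟩
    · exact ⟨_, D.neck1_mem_T, _, hdom τ, rfl,
        (D.range_fderiv_neck (Or.inl rfl) D.arc₁ hδ).symm⟩
    · refine continuous_const.mul ?_
      exact B.θ_cont.comp_continuous (((D.continuous_neckSlice 1 D.arc₁).comp hline).comp
        continuous_subtype_val) fun τ => hm τ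
    · have h := B.hasPhase_neckPlane (Or.inl rfl) D.arc₁ (x := ((τ : ℝ), -D.δ)) hδ
      rwa [B.arg_neckRatio 1 D.arc₁ (by rw [D.arc₁.incoming _ le_rfl]), add_zero] at h
    · have h1 := hslice 0
      have h2 := B.θ_shift (hm 0) 1
      rw [← h1, zero_add] at h2
      simp only [ContinuousMap.coe_mk, Set.Icc.coe_zero, Set.Icc.coe_one]
      rw [h2]; push_cast; ring

section

variable (hγ : IsSmoothJordan γ) (hs : s ∈ Set.Ioo (0 : ℝ) 1) (ht : t ∈ Set.Ioo (0 : ℝ) 1)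
include B hγ hs ht

theorem tangentPlane_unique {q : C2 × ℝ} {P P' : Submodule ℝ C2} (h : IsTangentPlane D.T q P)
    (h' : IsTangentPlane D.T q P') : P = P' := by
  obtain ⟨z, hz⟩ := B.exists_rel_of_isTangentPlane hγ h
  obtain ⟨z', hz'⟩ := B.exists_rel_of_isTangentPlane hγ h'
  exact (B.rel_unique hγ hs ht hz hz').1

theorem isImmersedLagrangian : IsImmersedLagrangian D.T := by
  refine ⟨fun q hq => ?_, fun q P hP => ?_⟩
  · obtain ⟨P, hP⟩ := exists_tangentPlane hq
    exact ⟨P, hP, fun P' hP' => B.tangentPlane_unique hγ hs ht hP' hP⟩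
  · obtain ⟨z, hz⟩ := B.exists_rel_of_isTangentPlane hγ hP
    exact (B.rel_phase hγ hs ht hz).1

/-- If ψ is a continuous argument of the fourth root along α, then 4ψ is one of the phase, and ψ
changes by 2πk because the root takes the same value at both ends. -/
theorem exists_loopIndex {x : surface D.T} (α : Path x x) : ∃ k : ℤ, IsLoopIndex D.T α (4 * k) := by
  have hcont : Continuous fun τ => B.root (α τ) :=
    (B.continuousOn_root hγ hs ht).comp_continuous
      (continuous_subtype_val.comp α.continuous) fun τ => (α τ).2
  choose P hP using fun τ => exists_tangentPlane (α τ).2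
  choose z hz using fun τ => B.exists_rel_of_isTangentPlane hγ (hP τ)
  have hroot : ∀ τ, B.root (α τ) = z τ := fun τ => B.root_eq hγ hs ht (hz τ)
  have hph := fun τ => B.rel_phase hγ hs ht (hz τ)
  -- `Set.projIcc` extends the loop constantly to ℝ, where continuous arguments are available.
  obtain ⟨ψ, hψ, hψz⟩ := exists_continuousOn_arg (E := ℝ) convex_univ Set.univ_nonempty isOpen_univ
    (g := fun u => B.root (α (Set.projIcc 0 1 zero_le_one u)))
    (hcont.comp continuous_projIcc).continuousOn (fun u _ => by
      rw [hroot, ← norm_ne_zero_iff, (hph _).2.1]; exact one_ne_zero)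
  rw [continuousOn_univ] at hψ
  have hψ' : ∀ τ : unitInterval, z τ = cis (ψ τ) := by
    intro τ
    have h := hψz τ trivial
    simp only [Set.projIcc_val, hroot, (hph τ).2.1] at h
    simpa using h
  have hend : cis (ψ (1 : unitInterval)) = cis (ψ (0 : unitInterval)) := by
    rw [← hψ', ← hψ', ← hroot, ← hroot, α.source, α.target]
  obtain ⟨k, hk⟩ := cis_eq_cis_iff.1 hend
  refine ⟨k, P, hP, hasMaslovIndex_iff.2 ⟨⟨fun τ => 4 * ψ τ, by fun_prop⟩, fun τ => ?_, ?_⟩⟩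
  · obtain ⟨y, hy, hzy⟩ := (hph τ).2.2
    refine hy.congr ?_
    rw [← hzy, hψ', cis_pow]
    norm_num
  · simp only [ContinuousMap.coe_mk, hk]
    push_cast; ring

/-- Uniqueness of tangent planes determines the loop of planes, and two continuous arguments of its
phase differ by a constant. -/
theorem loopIndex_unique {x : surface D.T} {α : Path x x} {n n' : ℤ} (h : IsLoopIndex D.T α n)
    (h' : IsLoopIndex D.T α n') : n = n' := by
  obtain ⟨P, hP, hn⟩ := h
  obtain ⟨P', hP', hn'⟩ := h'
  obtain rfl : P = P' := funext fun τ => B.tangentPlane_unique hγ hs ht (hP τ) (hP' τ)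
  obtain ⟨θ, hθ, hθn⟩ := hasMaslovIndex_iff.1 hn
  obtain ⟨θ', hθ', hθn'⟩ := hasMaslovIndex_iff.1 hn'
  have h1 := IsPreconnected.eq_of_int_valued (X := unitInterval) (U := Set.univ)
    isPreconnected_univ (f := fun τ => θ τ - θ' τ) (by fun_prop) Real.two_pi_pos (fun τ _ => by
      obtain ⟨k, hk⟩ := cis_eq_cis_iff.1 ((hθ τ).cis_eq (hθ' τ))
      exact ⟨k, by simp only [hk]; ring⟩) (Set.mem_univ 1) (Set.mem_univ 0)
  have h2 : 2 * Real.pi * (n : ℝ) = 2 * Real.pi * n' := by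
    linarith
  exact_mod_cast mul_left_cancel₀ Real.two_pi_pos.ne' h2

theorem isMinimumMaslovNumber : IsMinimumMaslovNumber D.T 4 := by
  refine le_antisymm ((AddSubgroup.closure_le _).2 ?_) ?_
  · rintro n ⟨x, α, hn⟩
    obtain ⟨k, hk⟩ := B.exists_loopIndex hγ hs ht α
    rw [B.loopIndex_unique hγ hs ht hn hk]
    exact AddSubgroup.mem_zmultiples_iff.2 ⟨k, by push_cast; rw [smul_eq_mul]; ring⟩
  · rw [AddSubgroup.zmultiples_le]
    obtain ⟨x, α, hα⟩ := B.exists_coreLoop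
    have hmem := AddSubgroup.subset_closure
      (show _ ∈ {n : ℤ | ∃ (x : surface D.T) (α : Path x x), IsLoopIndex D.T α n} from ⟨x, α, hα⟩)
    -- The core loop has index 4nd₁ with n, d₁ = ±1, and either sign generates 4ℤ.
    rcases B.n_sign with hn | hn <;> rcases B.lift₁.degree with hd | hd <;>
      rw [hn, hd] at hmem
    · simpa using hmem
    · simpa using neg_mem hmem
    · simpa using neg_mem hmem
    · simpa using hmem

end

end Branch

end Smoothing

end CyclicQuad

theorem mainTheorem2 (γ : ℝ → ℂ) (hγ : CyclicQuad.IsSmoothJordan γ) (s t φ : ℝ)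
    (hs : s ∈ Set.Ioc (0 : ℝ) (1 / 2)) (ht : t ∈ Set.Ioc (0 : ℝ) (1 / 2))
    (hφ : φ ∈ Set.Ioo (0 : ℝ) Real.pi) (D : CyclicQuad.Smoothing γ s t φ) :
    CyclicQuad.IsImmersedLagrangian D.T ∧
      (∀ (x : CyclicQuad.surface D.T) (α : Path x x), ∃! n : ℤ, CyclicQuad.IsLoopIndex D.T α n) ∧
      CyclicQuad.IsMinimumMaslovNumber D.T 4 := by
  -- On (0, 1) the determinant -√(r(1 - r)) of F_r is nonzero.
  have hs' : s ∈ Set.Ioo (0 : ℝ) 1 := ⟨hs.1, hs.2.trans_lt (by norm_num)⟩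
  have ht' : t ∈ Set.Ioo (0 : ℝ) 1 := ⟨ht.1, ht.2.trans_lt (by norm_num)⟩
  obtain ⟨B⟩ := D.nonempty_branch hγ hs' ht'
  refine ⟨B.isImmersedLagrangian hγ hs' ht', fun x α => ?_, B.isMinimumMaslovNumber hγ hs' ht'⟩
  obtain ⟨k, hk⟩ := B.exists_loopIndex hγ hs' ht' α
  exact ⟨_, hk, fun n hn => B.loopIndex_unique hγ hs' ht' hn hk⟩
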